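/- **Model.** $n$ anonymous robots are points of the plane. Each carries a light with one of the colours off, terminal, candidate, symmetry, leader, done. Each robot has a fixed local coordinate system centred at its current position: the direction and orientation of the $X$-axis ("right") are common to all robots, while the unit distance and the orientation of the $Y$-axis ("up") are arbitrary and may differ from robot to robot. Robot $r'$ is visible to $r$ iff no other robot lies on the segment joining them. Every robot repeats Look–Compute–Move cycles: in Look it obtains the local positions and colours of all robots visible to it and its own colour; in Compute it decides from this snapshot and the number $n$ alone (by the deterministic algorithm below, the same for all robots) on a colour and a destination, and then sets its light to that colour; in Move it travels along the straight segment to its destination without being stopped. In one cycle the snapshot is taken strictly before the light is set, and the light is set strictly before the departure. The scheduler is asynchronous: all durations (of the phases, of the movements and of the idle periods) are finite, but otherwise arbitrary and unrelated between robots; speeds are arbitrary, and robots can be seen while moving. Every robot performs infinitely many cycles, finitely many in any bounded time. A robot is *stable* at time $t$ if it is not in the course of a movement and has no pending action, i.e. it is not the case that it took a snapshot before $t$ and has not yet carried out the change of colour, or begun the movement, decided on. The configuration at time $t$ is a *leader configuration* if all robots are stable and there is a unique robot $r_l$ such that $r_l$ has light leader, and all other robots have light off and lie strictly to the right of $r_l$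 and strictly above $r_l$ (up with respect to the coordinate system of $r_l$). An *initial configuration* has pairwise distinct positions, all robots at rest, all lights off. **Algorithm** (for a robot $r$; "robots" are those in the snapshot of $r$, $r$ included; left, right, up, down refer to the coordinates of $r$, in which $r$ is the origin; open half-planes unless stated otherwise; where nothing is specified, $r$ keeps its colour and position). If some light is leader, run a procedure "stage 2", which may be arbitrary. Otherwise, if two robots with light candidate are on the same vertical line or some light is symmetry, run Phase 2. Otherwise run Phase 1. *Phase 1.* (a) $r$ is off. If every other robot is strictly to the right of $r$, then: if all lights are off, $r$ sets its light to leader when every other robot is strictly above $r$, and otherwise moves vertically down by $|y|+1$, where $y$ is the ordinate of the bottommost robot; if some light is not off, $r$ does nothing. If not every other robot is strictly to the right of $r$, then $r$ sets its light to terminal and moves left by $d$, provided that either (i) there is no robot to the left of $r$, and no other robot on the upper, or none on the lower, open half of the vertical line through $r$, or (ii) there is exactly one robot $r'$ to the left, it has light candidate, and there is no robot on the part of the vertical line through $r$ in an upper or lower half-plane of $r$ that does not contain $r'$. Here $d$ is the distance from $r$ to the nearest vertical line to the right containing a robot, and $d=1$ (own unit) if there is no robot to the right. (b) $r$ is terminal: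 it sets its light to candidate. (c) $r$ is candidate: it sets its light to off if there is a robot with light candidate to the right, or a robot with light off to the left. *Phase 2.* (a) $r$ is candidate. Let $r'$ be another robot with light candidate or symmetry on the vertical line $L$ through $r$; let $r$ orient its $Y$-axis towards $r'$. Let $L'$ be the leftmost vertical line containing a robot to the right of $r$, $D$ its distance from $L$, $K$ the horizontal line through the mean of the positions of the robots on $L'$, and $d_r,d_{r'}$ the distances of $r,r'$ from $K$. Let $m=\frac D2\cdot\frac{y(r')}{y(r'')-y(r')}$ if $r''$ is the robot on $L'$ of maximal ordinate among those with $y>y(r')$, and $m=1$ if there is none. If $r'$ is symmetry: if $d_r<d_{r'}$, $r$ moves vertically away from $r'$ by $d_{r'}-d_r$; if $d_r=d_{r'}$, it sets its light to symmetry. If $r'$ is candidate and $r,r'$ lie in a common closed half-plane bounded by $K$: if $d_r>d_{r'}$, $r$ moves left by $m$. If $r'$ is candidate and $r,r'$ lie strictly on different sides of $K$: for $s\in\{r,r'\}$ let $\lambda(s)$ be the lexicographically sorted list of the positions of the robots other than $r,r'$ that lie strictly on the side of $K$ containing $s$, in coordinates with origin $K\cap L'$, the common $X$-axis, and $Y$-axis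 pointing into that side; let $\lambda'(s)$ be the sublist of terms with abscissa $0$. Compare lists lexicographically ($\prec$) after padding the shorter one with null terms larger than every other term. If $\lambda'(r)\prec\lambda'(r')$, $r$ moves left by $m$. If $\lambda'(r)=\lambda'(r')$ and $d_r\ge d_{r'}$: when $r$ sees all $n$ robots and none is strictly below $r$, it moves left by $m$ if $\lambda(r)\prec\lambda(r')$, moves right by $D/2$ if $\lambda(r)\succ\lambda(r')$, and if $\lambda(r)=\lambda(r')$ it moves left by $m$ when $K$ contains no robot and sets its light to symmetry otherwise; when $r$ does not see all robots or some robot is strictly below it, $r$ moves vertically away from $r'$ by $d_r$. (b) $r$ is symmetry: it sets its light to off if there is a robot with light off to the left. (c) $r$ is off: if there are two robots with light symmetry on a common vertical line to the left of $r$, at distance $d$ from $r$, and $r$ is the leftmost robot on the horizontal line through the midpoint of these two, then $r$ moves left by $d+1$. **Theorem.** Let the initial configuration $\mathbb C(0)$ be not symmetric with respect to any line parallel to the $X$-axis that contains no robot. Then in every asynchronous execution of the algorithm from $\mathbb C(0)$ there is a time $T_2>0$ such that $\mathbb C(T_2)$ is a leader configuration. -/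

import Mathlib

namespace OpaqueRobots

noncomputable section

open scoped Classical

/-! ### Lights, snapshots and actions -/

/-- The six colours of the lights. -/
inductive Light where
  | off
  | terminal
  | candidate
  | symmetry
  | leader
  | done

/-- A robot as it appears in a snapshot: its coordinates in the local coordinate system of the
observer, and its colour. -/
@[ext]
structure Sighting where
  x : ℝ
  y : ℝ
  light : Light

/-- What a robot gets in LOOK: its own colour, and the positions (in its own coordinate system,
which is centred at itself) and colours of the other robots visible to it. Robots are anonymous,
so this is a bare set. -/
structure Snapshot where
  light : Light
  others : Finset Sighting

/-- What a robot decides in COMPUTE: its new colour, and its destination in its own coordinate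
system. The destination `(0, 0)` means that it does not move. -/
structure Action where
  light : Light
  dest : ℝ × ℝ

/-- All robots of the snapshot, the observer included. -/
def Snapshot.all (S : Snapshot) : Finset Sighting := insert ⟨0, 0, S.light⟩ S.others

/-- Keep the colour and do not move. -/
def Snapshot.stay (S : Snapshot) : Action := ⟨S.light, (0, 0)⟩

/-- Keep the colour and move to `p`. -/
def Snapshot.moveTo (S : Snapshot) (p : ℝ × ℝ) : Action := ⟨S.light, p⟩

/-- Change the colour to `c` and do not move. -/
def setLight (c : Light) : Action := ⟨c, (0, 0)⟩

/-! ### Phase 1 -/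

/-- There is no other robot in the closed left half-plane of the observer. -/
def Snapshot.UniqueLeftmost (S : Snapshot) : Prop := ∀ q ∈ S.others, 0 < q.x

/-- `BecomeLeader()`: if there is no other robot in the closed lower half-plane, become leader;
otherwise go below the bottommost visible robot by one unit. -/
def becomeLeader (S : Snapshot) : Action :=
  if ∀ q ∈ S.others, 0 < q.y then setLight Light.leader
  else S.moveTo (0, -(|S.all.inf' (Finset.insert_nonempty _ _) Sighting.y| + 1))

/-- No robot on the part of the vertical line of the observer which is strictly above it. -/
def Snapshot.NoneAbove (S : Snapshot) : Prop := ∀ q ∈ S.others, q.x = 0 → ¬ 0 < q.y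

/-- No robot on the part of the vertical line of the observer which is strictly below it. -/
def Snapshot.NoneBelow (S : Snapshot) : Prop := ∀ q ∈ S.others, q.x = 0 → ¬ q.y < 0

/-- `LeftMostTerminal()`. -/
def LeftMostTerminal (S : Snapshot) : Prop :=
  if ∀ q ∈ S.others, ¬ q.x < 0 then S.NoneBelow ∨ S.NoneAbove
  else ∃ r', S.others.filter (fun q => q.x < 0) = {r'} ∧ r'.light = Light.candidate ∧
    ((¬ r'.y < 0 ∧ S.NoneBelow) ∨ (¬ 0 < r'.y ∧ S.NoneAbove))

/-- The robots strictly to the right of the observer. -/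
def Snapshot.right (S : Snapshot) : Finset Sighting := S.others.filter (fun q => 0 < q.x)

/-- The horizontal distance to the leftmost vertical line `L'` containing a robot strictly to the
right of the observer (`0` if there is no such robot). -/
def Snapshot.gap (S : Snapshot) : ℝ :=
  if h : S.right.Nonempty then S.right.inf' h Sighting.x else 0

/-- `ComputeDestination()`. -/
def computeDestination (S : Snapshot) : ℝ × ℝ :=
  if S.right.Nonempty then (-S.gap, 0) else (-1, 0)

/-- `Phase1()`. A robot with light `off` calls `LeftMostTerminal()` only if it is not the unique
leftmost robot; a unique leftmost robot waits until it sees no light other than `off`. (If it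
called `LeftMostTerminal()` while it still sees another light, it would set off to the left again,
and an asynchronous scheduler could make it repeat this forever.) -/
def phase1 (S : Snapshot) : Action :=
  match S.light with
  | Light.off =>
      if S.UniqueLeftmost then
        if ∀ q ∈ S.all, q.light = Light.off then becomeLeader S else S.stay
      else if LeftMostTerminal S then ⟨Light.terminal, computeDestination S⟩
      else S.stay
  | Light.terminal => setLight Light.candidate
  | Light.candidate =>
      if ∃ q ∈ S.others, 0 < q.x ∧ q.light = Light.candidate then setLight Light.off
      else if ∃ q ∈ S.others, q.x < 0 ∧ q.light = Light.off then setLight Light.off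
      else S.stay
  | _ => S.stay

/-! ### Phase 2 -/

/-- The robots on the line `L'`. -/
def Snapshot.nextColumn (S : Snapshot) : Finset Sighting :=
  S.others.filter (fun q => q.x = S.gap)

/-- The `y`-coordinate of the horizontal line `K` through the mean of the positions of the robots
on `L'`. -/
def Snapshot.axis (S : Snapshot) : ℝ :=
  (∑ q ∈ S.nextColumn, q.y) / (S.nextColumn.card : ℝ)

/-- The lexicographically sorted list of the coordinates of the robots of `H`, in the coordinate
system whose origin is the intersection of `K` and `L'`, whose `X`-axis is the agreed one, and
whose positive `Y`-axis points into the half-plane (delimited by `K`) that contains `H`. -/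
def Snapshot.string (S : Snapshot) (H : Finset Sighting) : List (ℝ ×ₗ ℝ) :=
  (H.image (fun q => toLex (q.x - S.gap, |q.y - S.axis|))).sort (· ≤ ·)

/-- Delete the terms whose first coordinate is not `0`. -/
def firstColumn (l : List (ℝ ×ₗ ℝ)) : List (ℝ ×ₗ ℝ) := l.filter (fun p => (ofLex p).1 = 0)

/-- Append null elements (which are larger than all other terms) up to length `m`. -/
def pad (m : ℕ) (l : List (ℝ ×ₗ ℝ)) : List (WithTop (ℝ ×ₗ ℝ)) :=
  l.map (fun p => (p : WithTop (ℝ ×ₗ ℝ))) ++ List.replicate (m - l.length) ⊤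

/-- `l ≺ l'`: the lexicographic comparison after padding to the same length. -/
def Prec (l l' : List (ℝ ×ₗ ℝ)) : Prop :=
  pad (max l.length l'.length) l < pad (max l.length l'.length) l'

/-- `ComputeDestination2()`, for a positive `Y`-axis towards `r'`. -/
def computeDestination2 (S : Snapshot) (r' : Sighting) : ℝ × ℝ :=
  if h : (S.nextColumn.filter (fun q => r'.y < q.y)).Nonempty then
    (-(1 / 2 * S.gap * (r'.y /
      ((S.nextColumn.filter (fun q => r'.y < q.y)).sup' h Sighting.y - r'.y))), 0)
  else (-1, 0)

/-- The branch of `Phase2()` for a robot with light `candidate`, where `r'` is the other robot on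
its vertical line, for a positive `Y`-axis towards `r'` (that is, `0 < r'.y`). When neither closed
half-plane delimited by `K` contains both robots, `r` is below `K` and `r'` is above `K`. -/
def phase2Candidate (n : ℕ) (S : Snapshot) (r' : Sighting) : Action :=
  let k := S.axis
  let d := |k|
  let d' := |r'.y - k|
  let str := S.string ((S.others.erase r').filter (fun q => q.y < k))
  let str' := S.string ((S.others.erase r').filter (fun q => k < q.y))
  if r'.light = Light.symmetry then
    if d < d' then S.moveTo (0, -(d' - d))
    else if d = d' then setLight Light.symmetry
    else S.stay
  else if (0 ≤ k ∧ r'.y ≤ k) ∨ (k ≤ 0 ∧ k ≤ r'.y) then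
    if d' < d then S.moveTo (computeDestination2 S r') else S.stay
  else if Prec (firstColumn str) (firstColumn str') then S.moveTo (computeDestination2 S r')
  else if firstColumn str = firstColumn str' then
    if d' ≤ d then
      if S.all.card = n ∧ ∀ q ∈ S.others, ¬ q.y < 0 then
        if Prec str str' then S.moveTo (computeDestination2 S r')
        else if Prec str' str then S.moveTo (S.gap / 2, 0)
        else if ∀ q ∈ S.all, q.y ≠ k then S.moveTo (computeDestination2 S r')
        else setLight Light.symmetry
      else S.moveTo (0, -d)
    else S.stay
  else S.stay

/-- Reversal of the `Y`-axis. -/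
def Sighting.flip (q : Sighting) : Sighting := ⟨q.x, -q.y, q.light⟩

/-- Reversal of the `Y`-axis. -/
def Snapshot.flip (S : Snapshot) : Snapshot := ⟨S.light, S.others.image Sighting.flip⟩

/-- Reversal of the `Y`-axis. -/
def Action.flip (a : Action) : Action := ⟨a.light, (a.dest.1, -a.dest.2)⟩

/-- `r'` is another robot on the vertical line of the observer with light `candidate` or
`symmetry`. -/
def Snapshot.IsPartner (S : Snapshot) (r' : Sighting) : Prop :=
  r' ∈ S.others ∧ r'.x = 0 ∧ (r'.light = Light.candidate ∨ r'.light = Light.symmetry)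

/-- `p.1` and `p.2` are two robots on a common vertical line strictly to the left of the observer,
both with light `symmetry`. -/
def Snapshot.IsSymmetryPair (S : Snapshot) (p : Sighting × Sighting) : Prop :=
  p.1 ∈ S.others ∧ p.2 ∈ S.others ∧ p.1 ≠ p.2 ∧ p.1.x < 0 ∧ p.1.x = p.2.x ∧
    p.1.light = Light.symmetry ∧ p.2.light = Light.symmetry

/-- `Phase2()`. -/
def phase2 (n : ℕ) (S : Snapshot) : Action :=
  match S.light with
  | Light.candidate =>
      if h : ∃ r', S.IsPartner r' then
        if 0 < h.choose.y then phase2Candidate n S h.choose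
        else (phase2Candidate n S.flip h.choose.flip).flip
      else S.stay
  | Light.symmetry =>
      if ∃ q ∈ S.others, q.x < 0 ∧ q.light = Light.off then setLight Light.off else S.stay
  | Light.off =>
      if h : ∃ p, S.IsSymmetryPair p then
        if (h.choose.1.y + h.choose.2.y) / 2 = 0 ∧ ∀ q ∈ S.others, q.y = 0 → 0 < q.x then
          S.moveTo (-(|h.choose.1.x| + 1), 0)
        else S.stay
      else S.stay
  | _ => S.stay

/-! ### The algorithm -/

/-- The algorithm run by each of the `n` robots. The procedure `stage2`, run by a robot that sees
a light set to `leader`, is a parameter: it belongs to pattern formation, not to leader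
election. -/
def algorithm (n : ℕ) (stage2 : Snapshot → Action) (S : Snapshot) : Action :=
  if ∃ q ∈ S.all, q.light = Light.leader then stage2 S
  else if (∃ p ∈ S.all, ∃ q ∈ S.all, p ≠ q ∧ p.x = q.x ∧
        p.light = Light.candidate ∧ q.light = Light.candidate) ∨
      (∃ q ∈ S.all, q.light = Light.symmetry) then phase2 n S
  else phase1 S

/-! ### Robots in the plane -/

/-- A configuration of `n` robots: positions and lights. The first global coordinate axis is the
agreed one. -/
structure Config (n : ℕ) where
  pos : Fin n → ℝ × ℝ
  light : Fin n → Light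

/-- The persistent part of a local coordinate system: the unit distance, and the orientation
`up = 1` or `up = -1` of the `Y`-axis. The `X`-axis has the agreed direction and orientation. -/
structure Frame where
  unit : ℝ
  unit_pos : 0 < unit
  up : ℝ
  up_eq : up = 1 ∨ up = -1

/-- The robot `j` is visible to the robot `i`. -/
def Config.Visible {n : ℕ} (C : Config n) (i j : Fin n) : Prop :=
  j ≠ i ∧ ∀ k, k ≠ i → k ≠ j → C.pos k ∉ segment ℝ (C.pos i) (C.pos j)

/-- How the robot `i`, with coordinate system `F`, records the robot `j`. -/
def Config.sighting {n : ℕ} (C : Config n) (F : Frame) (i j : Fin n) : Sighting :=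
  ⟨((C.pos j).1 - (C.pos i).1) / F.unit, F.up * ((C.pos j).2 - (C.pos i).2) / F.unit, C.light j⟩

/-- The snapshot that the robot `i`, with coordinate system `F`, takes of `C`. -/
def Config.snapshot {n : ℕ} (C : Config n) (F : Frame) (i : Fin n) : Snapshot :=
  ⟨C.light i, (Finset.univ.filter (fun j => C.Visible i j)).image (C.sighting F i)⟩

/-- The point with local coordinates `d` for a robot at `p` with coordinate system `F`. -/
def Frame.toPlane (F : Frame) (p d : ℝ × ℝ) : ℝ × ℝ :=
  (p.1 + F.unit * d.1, p.2 + F.unit * (F.up * d.2))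

/-- An initial configuration: distinct positions, all lights `off`. -/
def Config.IsInitial {n : ℕ} (C : Config n) : Prop :=
  Function.Injective C.pos ∧ ∀ i, C.light i = Light.off

/-- The configuration is symmetric in a line parallel to the agreed axis that contains no robot. -/
def Config.HasForbiddenSymmetry {n : ℕ} (C : Config n) : Prop :=
  ∃ c : ℝ, (∀ i, ∃ j, C.pos j = ((C.pos i).1, 2 * c - (C.pos i).2)) ∧ ∀ i, (C.pos i).2 ≠ c

/-! ### Asynchronous executions with rigid movements -/

/-- An execution of the algorithm `A` by `n` robots under an asynchronous scheduler. In its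
`k`-th cycle the robot `i` takes its snapshot at time `look i k`, sets its light at time
`compute i k`, leaves (if it moves at all) at time `depart i k`, and has reached its destination
at time `arrive i k`. In between it travels on the straight segment, at a speed chosen by the
scheduler: `progress i k t` is the fraction of the way covered at time `t`. If the decision of a
cycle is to keep the colour or to stay, then the corresponding times have no effect. Every robot
goes through infinitely many cycles, finitely many of them in bounded time. -/
structure Execution (n : ℕ) (A : Snapshot → Action) where
  /-- The configuration at each time `t ≥ 0`. -/
  config : ℝ → Config n
  frame : Fin n → Frame
  look : Fin n → ℕ → ℝ
  compute : Fin n → ℕ → ℝ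
  depart : Fin n → ℕ → ℝ
  arrive : Fin n → ℕ → ℝ
  progress : Fin n → ℕ → ℝ → ℝ
  /-- The decision taken in each cycle. -/
  action : Fin n → ℕ → Action
  look_zero : ∀ i, 0 ≤ look i 0
  look_lt_compute : ∀ i k, look i k < compute i k
  compute_lt_depart : ∀ i k, compute i k < depart i k
  depart_lt_arrive : ∀ i k, depart i k < arrive i k
  arrive_le_look : ∀ i k, arrive i k ≤ look i (k + 1)
  look_tendsto : ∀ i, Filter.Tendsto (look i) Filter.atTop Filter.atTop
  action_eq : ∀ i k, action i k = A ((config (look i k)).snapshot (frame i) i)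
  light_start : ∀ i t, 0 ≤ t → t < compute i 0 → (config t).light i = (config 0).light i
  light_cycle : ∀ i k t, compute i k ≤ t → t < compute i (k + 1) →
    (config t).light i = (action i k).light
  progress_continuous : ∀ i k, ContinuousOn (progress i k) (Set.Icc (depart i k) (arrive i k))
  progress_monotone : ∀ i k, MonotoneOn (progress i k) (Set.Icc (depart i k) (arrive i k))
  progress_depart : ∀ i k, progress i k (depart i k) = 0
  progress_pos : ∀ i k t, depart i k < t → t ≤ arrive i k → 0 < progress i k t
  progress_arrive : ∀ i k, progress i k (arrive i k) = 1
  pos_start : ∀ i t, 0 ≤ t → t ≤ depart i 0 → (config t).pos i = (config 0).pos i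
  pos_move : ∀ i k t, depart i k ≤ t → t ≤ arrive i k →
    (config t).pos i = AffineMap.lineMap ((config (look i k)).pos i)
      ((frame i).toPlane ((config (look i k)).pos i) (action i k).dest) (progress i k t)
  pos_rest : ∀ i k t, arrive i k ≤ t → t ≤ depart i (k + 1) →
    (config t).pos i = (config (arrive i k)).pos i

namespace Execution

variable {n : ℕ} {A : Snapshot → Action}

/-- In its `k`-th cycle the robot `i` decides to change its colour. -/
def Recolors (E : Execution n A) (i : Fin n) (k : ℕ) : Prop :=
  (E.action i k).light ≠ (E.config (E.look i k)).light i

/-- In its `k`-th cycle the robot `i` decides to move. -/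
def Moves (E : Execution n A) (i : Fin n) (k : ℕ) : Prop := (E.action i k).dest ≠ (0, 0)

/-- The robot `i` has a pending move at time `t`: it has taken a snapshot, but has not yet carried
out the change of colour, or not yet begun the movement, that it has decided on. -/
def HasPendingMove (E : Execution n A) (i : Fin n) (t : ℝ) : Prop :=
  ∃ k, (E.Recolors i k ∧ ¬ E.Moves i k ∧ E.look i k < t ∧ t < E.compute i k) ∨
    (E.Moves i k ∧ E.look i k < t ∧ t ≤ E.depart i k)

/-- The robot `i` is in the course of a movement at time `t`. -/
def IsMoving (E : Execution n A) (i : Fin n) (t : ℝ) : Prop :=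
  ∃ k, E.Moves i k ∧ E.depart i k < t ∧ t < E.arrive i k

/-- The robot `i` is stable at time `t`. -/
def StableAt (E : Execution n A) (i : Fin n) (t : ℝ) : Prop :=
  ¬ E.IsMoving i t ∧ ¬ E.HasPendingMove i t

/-- The configuration at time `t` is a leader configuration: every robot is stable, and there is a
unique robot `l` such that `l` has light `leader`, and all other robots have light `off` and are
strictly to the right of `l` and strictly above `l`, where "above" refers to the local coordinate
system of `l`. -/
def IsLeaderConfiguration (E : Execution n A) (t : ℝ) : Prop :=
  (∀ i, E.StableAt i t) ∧
  ∃! l : Fin n, (E.config t).light l = Light.leader ∧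
    (∀ i, i ≠ l → (E.config t).light i = Light.off) ∧
    ∀ i, i ≠ l → ((E.config t).pos l).1 < ((E.config t).pos i).1 ∧
      0 < (E.frame l).up * (((E.config t).pos i).2 - ((E.config t).pos l).2)

end Execution

end

end OpaqueRobots

/-!
An execution is first replaced by a run of a transition system, in which a robot takes a snapshot,
sets its light, or covers a part of the way to its destination; simultaneous snapshots may be
executed one after the other, since a snapshot does not change what the others see. Fairness enters
only through the inductive predicate `Win`: a stage, that is, a set of states, is winning if some
robot leaves it whenever this robot takes a snapshot, and if every step out of it leads to a winning
state. As every robot takes infinitely many snapshots, an execution that starts in a winning state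
reaches a leader configuration (`Execution.exists_isLeaderConfiguration`), and it remains to show
that initial states without the forbidden symmetry are winning (`win_of_initial`). At any time at
most three robots are active; the others stay, mainly because from none of them does a single
candidate hide all other robots on the left.

* A unique leftmost robot descends by at least one unit in every cycle, until it is below all others
  and becomes leader (`win_of_leftmost`).
* Otherwise the two ends `r`, `r'` of the leftmost column leave it to the left and become candidates
  (`Start.win_of_leaving`). If they arrive at different abscissas, then the left one switches its
  light off, the right one follows, and the left one is a unique leftmost robot (`win_of_apart`).
* If they arrive in a common column, let `K` be the horizontal line through the mean of the next
  column. When both candidates are on the same side of `K`, when the robots on the two sides of `K`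
  differ, or when they do not and `K` contains no robot, there is a verdict on which both candidates
  agree although they compute it from different snapshots: the lists of the next column are visible from everywhere, and a candidate uses the
  lists of all robots only when it sees all of them, for which it doubles its distance from `K`
  finitely often. The verdict persists during these moves, so that one candidate leaves the column
  and the case of different abscissas applies (`Leaning.win`, `win_of_candidates`). Only equal
  distances from `K` could prevent this when the robots on both sides agree and `K` contains no
  robot, and that is the forbidden symmetry.
* If the robots are symmetric in `K` and `K` contains a robot, then both candidates climb the ladder
  of distances `M`, `2 * M`, `4 * M`, …, where `M` is the larger initial distance. By symmetry all
  robots become visible at the same rung on both sides, and there both candidates set their lights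
  to `symmetry` (`Tie.win_of_climbs`). The leftmost robot on `K` then moves to the left of both and
  waits until they have switched off, when it is the unique leftmost robot
  (`Breaking.win_of_symmetry`).

The sign `τ = 1` or `τ = -1` orients the vertical axis in such a way that `r` is below `r'`; by
exchanging `r` and `r'` and reversing `τ`, every statement about `r` yields one about `r'`.
-/

namespace OpaqueRobots

noncomputable section

open scoped Classical

/-! ### The transition system behind an execution -/

/-- The state of a robot: where it took its last snapshot, the destination it chose then, its
present position, its present light, and the light it chose. -/
structure Rob where
  src : ℝ × ℝ
  tgt : ℝ × ℝ
  pos : ℝ × ℝ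
  light : Light
  nl : Light

/-- The global state: one `Rob` for each robot. -/
abbrev St (n : ℕ) := Fin n → Rob

/-- A robot at rest without any pending action. -/
def Rob.idle (p : ℝ × ℝ) (c : Light) : Rob := ⟨p, p, p, c, c⟩

/-- The configuration seen in a global state. -/
def St.config {n : ℕ} (s : St n) : Config n := ⟨fun i => (s i).pos, fun i => (s i).light⟩

/-- No light is set to `leader`. -/
def Config.Dark {n : ℕ} (C : Config n) : Prop := ∀ i, C.light i ≠ Light.leader

section System

variable {n : ℕ} (A : Snapshot → Action) (F : Fin n → Frame)

/-- The decision of the robot `i` in the configuration `C`: the new light, and the destination in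
global coordinates. -/
def decision (C : Config n) (i : Fin n) : Light × (ℝ × ℝ) :=
  ((A (C.snapshot (F i) i)).light, (F i).toPlane (C.pos i) (A (C.snapshot (F i) i)).dest)

/-- The state of a robot that has just taken a snapshot and has decided on `d`. -/
def Rob.plan (a : Rob) (d : Light × (ℝ × ℝ)) : Rob := ⟨a.pos, d.2, a.pos, a.light, d.1⟩

/-- The robot `i` takes a snapshot. The system is only considered as long as no light is
`leader`. -/
def Look (i : Fin n) (s s' : St n) : Prop :=
  (s i).pos = (s i).tgt ∧ (s i).light = (s i).nl ∧ s.config.Dark ∧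
    s' = Function.update s i ((s i).plan (decision A F s.config i))

/-- A step of the robot `i` that is not a snapshot: it sets its light to the colour decided on, or
it covers a part of the way to its destination, which requires that its light has been set. -/
inductive Act : Rob → Rob → Prop
  | color (a : Rob) : Act a { a with light := a.nl }
  | move (a : Rob) (p : ℝ × ℝ) (h : a.light = a.nl) (hp : p ∈ segment ℝ a.pos a.tgt) :
      Act a { a with pos := p }

/-- One robot takes a snapshot, sets its light, or moves on. -/
def Step (s s' : St n) : Prop :=
  ∃ i, Look A F i s s' ∨ ∃ a, Act (s i) a ∧ s' = Function.update s i a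

/-- The leader configuration, all robots being at rest without pending actions. -/
def Lead (s : St n) : Prop :=
  ∃ l, (∃ p, s l = Rob.idle p Light.leader) ∧ ∀ j, j ≠ l → (∃ q, s j = Rob.idle q Light.off) ∧
    (s l).pos.1 < (s j).pos.1 ∧ 0 < (F l).up * ((s j).pos.2 - (s l).pos.2)

/-- The states from which a fair scheduler cannot avoid a leader configuration: the least class
that contains the leader configurations and every stage `P` which can only be left towards the
class, and which some robot `i` leaves whenever it takes a snapshot. -/
inductive Win : St n → Prop
  | lead (s : St n) (h : Lead F s) : Win s
  | stage (s : St n) (P : St n → Prop) (i : Fin n) (hs : P s) (hd : ∀ s, P s → s.config.Dark)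
      (hstep : ∀ s s', P s → Step A F s s' → ¬ P s' → Win s')
      (hlook : ∀ s s', P s → Look A F i s s' → Win s') : Win s

variable {A F}

theorem idle_act {p : ℝ × ℝ} {c : Light} {a : Rob} (h : Act (Rob.idle p c) a) :
    a = Rob.idle p c := by
  cases h with
  | color => rfl
  | move p h hp =>
    simp only [Rob.idle, segment_same, Set.mem_singleton_iff] at hp ⊢
    rw [hp]

theorem Lead.not_dark {s : St n} (h : Lead F s) : ¬ s.config.Dark := by
  obtain ⟨l, ⟨p, hp⟩, -⟩ := h
  intro hd
  exact hd l (by simp [St.config, hp, Rob.idle])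

theorem Lead.step {s s' : St n} (h : Lead F s) (hs : Step A F s s') : Lead F s' := by
  obtain ⟨i, hi | ⟨a, ha, rfl⟩⟩ := hs
  · exact absurd hi.2.2.1 h.not_dark
  · obtain ⟨l, ⟨p, hp⟩, hl⟩ := id h
    have : a = s i := by
      by_cases hil : i = l
      · subst hil; rw [hp] at ha ⊢; exact idle_act ha
      · obtain ⟨⟨q, hq⟩, -⟩ := hl i hil
        rw [hq] at ha ⊢; exact idle_act ha
    rw [this, Function.update_eq_self]; exact h

theorem Win.step {s s' : St n} (h : Win A F s) (hs : Step A F s s') : Win A F s' := by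
  cases h with
  | lead _ h => exact Win.lead _ (h.step hs)
  | stage _ P i hP hd hstep hlook =>
    by_cases hP' : P s'
    · exact Win.stage _ P i hP' hd hstep hlook
    · exact hstep _ _ hP hs hP'

theorem Win.dark_or_lead {s : St n} (h : Win A F s) : s.config.Dark ∨ Lead F s := by
  cases h with
  | lead _ h => exact Or.inr h
  | stage _ P i hP hd hstep hlook => exact Or.inl (hd _ hP)

/-- Sequences of steps. -/
abbrev Steps (A : Snapshot → Action) (F : Fin n → Frame) : St n → St n → Prop :=
  Relation.ReflTransGen (Step A F)

theorem Win.steps {s s' : St n} (h : Win A F s) (hs : Steps A F s s') : Win A F s' := by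
  induction hs with
  | refl => exact h
  | tail _ h2 ih => exact ih.step h2

theorem Lead.steps {s s' : St n} (h : Lead F s) (hs : Steps A F s s') : Lead F s' := by
  induction hs with
  | refl => exact h
  | tail _ h2 ih => exact ih.step h2

end System

/-! ### From executions to the transition system -/

theorem lineMap_mem_segment {p q : ℝ × ℝ} {a b : ℝ} (hab : a ≤ b) (hb : b ≤ 1) :
    AffineMap.lineMap p q b ∈ segment ℝ (AffineMap.lineMap p q a) q := by
  rw [segment_eq_image_lineMap]
  rcases eq_or_lt_of_le (hab.trans hb) with h | h
  · subst h
    exact ⟨0, by simp, by simp [le_antisymm hb hab]⟩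
  · refine ⟨(b - a) / (1 - a), ⟨by apply div_nonneg <;> linarith,
      by rw [div_le_one] <;> linarith⟩, ?_⟩
    have : (1 - a) ≠ 0 := by linarith
    ext <;> simp [AffineMap.lineMap_apply] <;> field_simp <;> ring

namespace Execution

variable {n : ℕ} {A : Snapshot → Action} (E : Execution n A)

theorem look_lt_depart (i : Fin n) (k : ℕ) : E.look i k < E.depart i k :=
  (E.look_lt_compute i k).trans (E.compute_lt_depart i k)

theorem look_lt_arrive (i : Fin n) (k : ℕ) : E.look i k < E.arrive i k :=
  (E.look_lt_depart i k).trans (E.depart_lt_arrive i k)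

theorem look_strictMono (i : Fin n) : StrictMono (E.look i) :=
  strictMono_nat_of_lt_succ fun k => (E.look_lt_arrive i k).trans_le (E.arrive_le_look i k)

theorem exists_le_look (i : Fin n) (t : ℝ) : ∃ k, t ≤ E.look i k :=
  ((E.look_tendsto i).eventually_ge_atTop t).exists

/-- The number of snapshots taken by the robot `i` before time `t`. -/
def count (t : ℝ) (i : Fin n) : ℕ := Nat.find (E.exists_le_look i t)

theorem le_look_count (t : ℝ) (i : Fin n) : t ≤ E.look i (E.count t i) :=
  Nat.find_spec (E.exists_le_look i t)

theorem look_lt_of_lt_count {t : ℝ} {i : Fin n} {k : ℕ} (h : k < E.count t i) :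
    E.look i k < t := not_le.1 (Nat.find_min (E.exists_le_look i t) h)

theorem count_le {t : ℝ} {i : Fin n} {k : ℕ} (h : t ≤ E.look i k) : E.count t i ≤ k :=
  Nat.find_min' _ h

theorem lt_count {t : ℝ} {i : Fin n} {k : ℕ} (h : E.look i k < t) : k < E.count t i := by
  by_contra hk
  exact absurd (E.le_look_count t i)
    (not_le.2 (((E.look_strictMono i).monotone (not_lt.1 hk)).trans_lt h))

theorem count_mono {t t' : ℝ} (h : t ≤ t') (i : Fin n) : E.count t i ≤ E.count t' i :=
  E.count_le (h.trans (E.le_look_count t' i))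

/-- The state of the robot `i` at time `t`, when it has taken `m` snapshots. -/
def rob (i : Fin n) (t : ℝ) : ℕ → Rob
  | 0 => Rob.idle ((E.config t).pos i) ((E.config t).light i)
  | k + 1 => ⟨(E.config (E.look i k)).pos i,
      (E.frame i).toPlane ((E.config (E.look i k)).pos i) (E.action i k).dest,
      (E.config t).pos i, (E.config t).light i, (E.action i k).light⟩

/-- The global state at time `t`, when the robot `i` has taken `m i` snapshots. -/
def state (t : ℝ) (m : Fin n → ℕ) : St n := fun i => E.rob i t (m i)

theorem config_state (t : ℝ) (m : Fin n → ℕ) : (E.state t m).config = E.config t := by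
  have : ∀ i, (E.rob i t (m i)).pos = (E.config t).pos i ∧
      (E.rob i t (m i)).light = (E.config t).light i := by
    intro i
    cases m i <;> simp [rob, Rob.idle]
  cases hC : E.config t
  simp [St.config, state, this, hC]

theorem light_before (i : Fin n) (k : ℕ) {t : ℝ} (h1 : E.look i k ≤ t) (h2 : t < E.compute i k) :
    (E.config t).light i = (E.config (E.look i k)).light i := by
  cases k with
  | zero =>
    rw [E.light_start i t ((E.look_zero i).trans h1) h2,
      E.light_start i _ (E.look_zero i) (E.look_lt_compute i 0)]
  | succ k =>
    have h3 : E.compute i k ≤ E.look i (k + 1) :=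
      ((E.compute_lt_depart i k).trans (E.depart_lt_arrive i k)).le.trans (E.arrive_le_look i k)
    rw [E.light_cycle i k t (h3.trans h1) h2,
      E.light_cycle i k _ h3 (E.look_lt_compute i _)]

theorem light_after (i : Fin n) (k : ℕ) {t : ℝ} (h1 : E.compute i k ≤ t)
    (h2 : t ≤ E.look i (k + 1)) : (E.config t).light i = (E.action i k).light :=
  E.light_cycle i k t h1 (h2.trans_lt (E.look_lt_compute i _))

theorem pos_before (i : Fin n) (k : ℕ) {t : ℝ} (h1 : E.look i k ≤ t) (h2 : t ≤ E.depart i k) :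
    (E.config t).pos i = (E.config (E.look i k)).pos i := by
  cases k with
  | zero =>
    rw [E.pos_start i t ((E.look_zero i).trans h1) h2,
      E.pos_start i _ (E.look_zero i) (E.look_lt_depart i 0).le]
  | succ k =>
    rw [E.pos_rest i k t ((E.arrive_le_look i k).trans h1) h2,
      E.pos_rest i k _ (E.arrive_le_look i k) (E.look_lt_depart i _).le]

/-- The destination of the `k`-th cycle of the robot `i`. -/
def goal (i : Fin n) (k : ℕ) : ℝ × ℝ :=
  (E.frame i).toPlane ((E.config (E.look i k)).pos i) (E.action i k).dest

theorem pos_after (i : Fin n) (k : ℕ) {t : ℝ} (h1 : E.arrive i k ≤ t)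
    (h2 : t ≤ E.look i (k + 1)) : (E.config t).pos i = E.goal i k := by
  rw [E.pos_rest i k t h1 (h2.trans (E.look_lt_depart i _).le),
    E.pos_move i k _ (E.depart_lt_arrive i k).le le_rfl, E.progress_arrive]
  simp [goal]

/-- Within a cycle, the robot only advances on the segment to its destination. -/
theorem exists_frac (i : Fin n) (k : ℕ) {t t' : ℝ} (h0 : E.look i k ≤ t) (h1 : t ≤ t')
    (h2 : t' ≤ E.look i (k + 1)) : ∃ a b : ℝ, a ≤ b ∧ b ≤ 1 ∧
      (E.config t).pos i =
        AffineMap.lineMap ((E.config (E.look i k)).pos i) (E.goal i k) a ∧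
      (E.config t').pos i =
        AffineMap.lineMap ((E.config (E.look i k)).pos i) (E.goal i k) b := by
  have hda := (E.depart_lt_arrive i k).le
  have hm : ∀ t, E.depart i k ≤ t → t ≤ E.arrive i k →
      0 ≤ E.progress i k t ∧ E.progress i k t ≤ 1 := by
    intro t ht1 ht2
    rw [← E.progress_depart i k]
    conv_rhs => rw [← E.progress_arrive i k]
    exact ⟨E.progress_monotone i k ⟨le_rfl, hda⟩ ⟨ht1, ht2⟩ ht1,
      E.progress_monotone i k ⟨ht1, ht2⟩ ⟨hda, le_rfl⟩ ht2⟩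
  rcases le_total t' (E.depart i k) with h3 | h3
  · exact ⟨0, 0, le_rfl, zero_le_one, by simp [E.pos_before i k h0 (h1.trans h3)],
      by simp [E.pos_before i k (h0.trans h1) h3]⟩
  rcases le_total t' (E.arrive i k) with h4 | h4
  · rcases le_total t (E.depart i k) with h5 | h5
    · exact ⟨0, E.progress i k t', (hm t' h3 h4).1, (hm t' h3 h4).2,
        by simp [E.pos_before i k h0 h5], E.pos_move i k t' h3 h4⟩
    · exact ⟨E.progress i k t, E.progress i k t',
        E.progress_monotone i k ⟨h5, h1.trans h4⟩ ⟨h3, h4⟩ h1, (hm t' h3 h4).2,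
        E.pos_move i k t h5 (h1.trans h4), E.pos_move i k t' h3 h4⟩
  · rcases le_total t (E.depart i k) with h5 | h5
    · exact ⟨0, 1, zero_le_one, le_rfl,
        by simp [E.pos_before i k h0 h5], by simp [E.pos_after i k h4 h2]⟩
    rcases le_total t (E.arrive i k) with h6 | h6
    · exact ⟨E.progress i k t, 1, (hm t h5 h6).2, le_rfl,
        E.pos_move i k t h5 h6, by simp [E.pos_after i k h4 h2]⟩
    · exact ⟨1, 1, le_rfl, le_rfl, by simp [E.pos_after i k h6 (h1.trans h2)],
        by simp [E.pos_after i k h4 h2]⟩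

theorem rob_act (i : Fin n) (m : ℕ) {t t' : ℝ} (h0 : 0 ≤ t) (hm : ∀ k, m = k + 1 → E.look i k ≤ t)
    (htt : t ≤ t') (ht' : t' ≤ E.look i m) :
    Relation.ReflTransGen Act (E.rob i t m) (E.rob i t' m) := by
  cases m with
  | zero =>
    have h1 := ht'.trans_lt (E.look_lt_compute i 0)
    have h2 := ht'.trans (E.look_lt_depart i 0).le
    have : E.rob i t 0 = E.rob i t' 0 := by
      simp only [rob]
      rw [E.light_start i t h0 (htt.trans_lt h1), E.light_start i t' (h0.trans htt) h1,
        E.pos_start i t h0 (htt.trans h2), E.pos_start i t' (h0.trans htt) h2]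
    rw [this]
  | succ k =>
    have h1 := hm k rfl
    rcases lt_or_ge t' (E.compute i k) with h | h
    · have : E.rob i t (k + 1) = E.rob i t' (k + 1) := by
        have h2 := h.le.trans (E.compute_lt_depart i k).le
        simp only [rob]
        rw [E.light_before i k h1 (htt.trans_lt h), E.light_before i k (h1.trans htt) h,
          E.pos_before i k h1 (htt.trans h2), E.pos_before i k (h1.trans htt) h2]
      rw [this]
    · obtain ⟨a, b, hab, hb, ha', hb'⟩ := E.exists_frac i k h1 htt ht'
      refine (Relation.ReflTransGen.single (Act.color _)).tail ?_
      have key := Act.move { E.rob i t (k + 1) with light := (E.rob i t (k + 1)).nl }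
        ((E.config t').pos i) rfl (by
          change _ ∈ segment ℝ ((E.config t).pos i) (E.goal i k)
          rw [ha', hb']; exact lineMap_mem_segment hab hb)
      convert key using 1
      simp only [rob]
      rw [E.light_after i k h ht']

theorem steps_of_act {F : Fin n → Frame} {i : Fin n} {s : St n} {a b : Rob} (ha : s i = a)
    (h : Relation.ReflTransGen Act a b) : Steps A F s (Function.update s i b) := by
  induction h with
  | refl => rw [← ha, Function.update_eq_self]
  | @tail b c _ h2 ih =>
    refine ih.tail ⟨i, Or.inr ⟨c, by simpa using h2, by simp⟩⟩

/-- Between snapshots the global state evolves by setting lights and by moving. -/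
theorem steps_evolve {m : Fin n → ℕ} {t t' : ℝ} (h0 : 0 ≤ t)
    (hm : ∀ i k, m i = k + 1 → E.look i k ≤ t) (htt : t ≤ t')
    (ht' : ∀ i, t' ≤ E.look i (m i)) : Steps A E.frame (E.state t m) (E.state t' m) := by
  have key : ∀ S : Finset (Fin n), Steps A E.frame (E.state t m)
      (fun i => if i ∈ S then E.state t' m i else E.state t m i) := by
    intro S
    induction S using Finset.induction_on with
    | empty => simpa using Relation.ReflTransGen.refl
    | @insert i S hi ih =>
      refine ih.trans ?_
      convert steps_of_act (A := A) (F := E.frame) (i := i)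
        (s := fun i => if i ∈ S then E.state t' m i else E.state t m i)
        (a := E.rob i t (m i)) (by simp [hi, state])
        (E.rob_act i (m i) h0 (hm i) htt (ht' i)) using 1
      ext j
      by_cases hj : j = i
      · subst hj; simp [state]
      · simp [hj]
  simpa using key Finset.univ

theorem rob_at_look (i : Fin n) (m : ℕ) : (E.rob i (E.look i m) m).pos =
    (E.rob i (E.look i m) m).tgt ∧
    (E.rob i (E.look i m) m).light = (E.rob i (E.look i m) m).nl := by
  cases m with
  | zero => simp [rob, Rob.idle]
  | succ k =>
    refine ⟨E.pos_after i k (E.arrive_le_look i k) le_rfl, E.light_after i k ?_ le_rfl⟩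
    exact ((E.compute_lt_depart i k).trans (E.depart_lt_arrive i k)).le.trans
      (E.arrive_le_look i k)

theorem look_state {m : Fin n → ℕ} {t : ℝ} {i : Fin n} (ht : E.look i (m i) = t)
    (hd : (E.config t).Dark) :
    Look A E.frame i (E.state t m) (E.state t (Function.update m i (m i + 1))) := by
  subst ht
  refine ⟨(E.rob_at_look i (m i)).1, (E.rob_at_look i (m i)).2, by rwa [config_state], ?_⟩
  ext1 j
  by_cases hj : j = i
  · subst hj
    have hc := E.config_state (E.look j (m j)) m
    have h1 : (E.rob j (E.look j (m j)) (m j)).pos = (E.config (E.look j (m j))).pos j := by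
      rw [← hc]; rfl
    have h2 : (E.rob j (E.look j (m j)) (m j)).light = (E.config (E.look j (m j))).light j := by
      rw [← hc]; rfl
    rw [Function.update_self, hc]
    change E.rob j _ _ = (E.rob j _ (m j)).plan _
    rw [Function.update_self, Rob.plan, h1, h2]
    simp only [rob, decision, E.action_eq]
  · simp [state, hj]

/-- The snapshots taken at the same instant can be executed in any order. -/
theorem steps_looks {m m' : Fin n → ℕ} {t : ℝ} (hd : (E.config t).Dark)
    (h : ∀ i, m' i = m i ∨ (m' i = m i + 1 ∧ E.look i (m i) = t)) :
    Steps A E.frame (E.state t m) (E.state t m') := by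
  have key : ∀ S : Finset (Fin n), Steps A E.frame (E.state t m)
      (E.state t (fun i => if i ∈ S then m' i else m i)) := by
    intro S
    induction S using Finset.induction_on with
    | empty => simpa using Relation.ReflTransGen.refl
    | @insert i S hi ih =>
      refine ih.trans ?_
      rcases h i with h | ⟨h, hl⟩
      · convert Relation.ReflTransGen.refl using 3 with j
        by_cases hj : j = i
        · subst hj; simp [hi, h]
        · simp [hj]
      · refine Relation.ReflTransGen.single ⟨i, Or.inl ?_⟩
        convert E.look_state (m := fun i => if i ∈ S then m' i else m i) (i := i)
          (by simpa [hi] using hl) hd using 2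
        ext j
        by_cases hj : j = i
        · subst hj; simp [h, hi]
        · simp [hj]
  simpa using key Finset.univ

/-- The number of snapshots taken by the robot `i` up to time `t`. -/
def countLe (t : ℝ) (i : Fin n) : ℕ :=
  if E.look i (E.count t i) = t then E.count t i + 1 else E.count t i

theorem look_countLe (t : ℝ) (i : Fin n) : t < E.look i (E.countLe t i) := by
  unfold countLe
  split_ifs with h
  · conv_lhs => rw [← h]
    exact E.look_strictMono i (Nat.lt_succ_self _)
  · exact lt_of_le_of_ne (E.le_look_count t i) (Ne.symm h)

theorem look_le_of_countLe {t : ℝ} {i : Fin n} {k : ℕ} (h : E.countLe t i = k + 1) :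
    E.look i k ≤ t := by
  unfold countLe at h
  split_ifs at h with h1
  · rw [show k = E.count t i by omega]; exact h1.le
  · exact (E.look_lt_of_lt_count (by omega)).le

theorem count_eq_countLe {e t : ℝ} {i : Fin n} (h : e < t)
    (h' : ∀ k, E.look i k < t → E.look i k ≤ e) : E.count t i = E.countLe e i := by
  refine le_antisymm (E.count_le ?_) ?_
  · by_contra hlt
    exact absurd (h' _ (not_le.1 hlt)) (not_le.2 (E.look_countLe e i))
  · cases hk : E.countLe e i with
    | zero => exact Nat.zero_le _
    | succ k => exact E.lt_count ((E.look_le_of_countLe hk).trans_lt h)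

theorem steps_to {e t : ℝ} (h0 : 0 ≤ e) (h : e < t) (hd : (E.config e).Dark)
    (h' : ∀ i k, E.look i k < t → E.look i k ≤ e) {m : Fin n → ℕ}
    (hm : ∀ i, m i = E.count e i ∨ m i = E.countLe e i) :
    Steps A E.frame (E.state e m) (E.state t (E.count t)) := by
  have h1 : E.count t = E.countLe e := funext fun i => E.count_eq_countLe h (h' i)
  rw [h1]
  refine (E.steps_looks hd (m' := E.countLe e) ?_).trans
    (E.steps_evolve h0 (fun i k hk => E.look_le_of_countLe hk) h.le ?_)
  · intro i
    rcases hm i with h | h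
    · rw [h]
      unfold countLe
      split_ifs with h2
      · exact Or.inr ⟨rfl, h2⟩
      · exact Or.inl rfl
    · exact Or.inl h.symm
  · intro i
    rw [← E.count_eq_countLe h (h' i)]
    exact E.le_look_count t i

/-- The global state at time `t`. -/
abbrev at' (t : ℝ) : St n := E.state t (E.count t)

/-- If no leader configuration ever occurs, the states of an execution that starts in a winning
state are related by steps of the transition system. -/
theorem steps_between (hno : ∀ t, 0 ≤ t → ¬ Lead E.frame (E.at' t))
    (hwin : Win A E.frame (E.at' 0)) : ∀ t' t, 0 ≤ t → t ≤ t' →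
      Steps A E.frame (E.at' t) (E.at' t') := by
  have key : ∀ N : ℕ, ∀ t', ∑ i, E.count t' i = N → ∀ t, 0 ≤ t → t ≤ t' →
      Steps A E.frame (E.at' t) (E.at' t') := by
    intro N
    induction N using Nat.strong_induction_on with
    | _ N ih =>
      intro t' hN t ht htt
      by_cases hex : ∃ i k, t ≤ E.look i k ∧ E.look i k < t'
      · -- the last instant before `t'` at which a snapshot is taken
        let S : Finset ℝ := (Finset.univ.sigma fun i : Fin n => Finset.range (E.count t' i)).image
          fun x => E.look x.1 x.2
        have hS : ∀ i k, E.look i k < t' → E.look i k ∈ S := fun i k hk =>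
          Finset.mem_image.2 ⟨⟨i, k⟩, by simpa using E.lt_count hk, rfl⟩
        obtain ⟨i, k, h1, h2⟩ := hex
        have hne : S.Nonempty := ⟨_, hS i k h2⟩
        obtain ⟨⟨i0, k0⟩, hik, he⟩ := Finset.mem_image.1 (S.max'_mem hne)
        set e := S.max' hne with he_def
        have hmax : ∀ i k, E.look i k < t' → E.look i k ≤ e := fun i k hk =>
          S.le_max' _ (hS i k hk)
        have hek : k0 < E.count t' i0 := by simpa using hik
        have het : e < t' := by rw [← he]; exact E.look_lt_of_lt_count hek
        have hte : t ≤ e := h1.trans (hmax i k h2)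
        have hlt : ∑ i, E.count e i < N := by
          rw [← hN]
          refine Finset.sum_lt_sum (fun i _ => E.count_mono het.le i) ⟨i0, Finset.mem_univ _, ?_⟩
          exact (E.count_le he.ge).trans_lt hek
        have hd : (E.config e).Dark := by
          have := (hwin.steps (ih _ hlt e rfl 0 le_rfl (ht.trans hte))).dark_or_lead
          rw [config_state] at this
          exact this.resolve_right (hno e (ht.trans hte))
        exact (ih _ hlt e rfl t ht hte).trans
          (E.steps_to (ht.trans hte) het hd hmax fun i => Or.inl rfl)
      · push Not at hex
        have hc : E.count t' = E.count t := by
          funext i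
          exact le_antisymm (E.count_le (hex i _ (E.le_look_count t i))) (E.count_mono htt i)
        rw [at', at', hc]
        refine E.steps_evolve ht (fun i k hk => (E.look_lt_of_lt_count (by omega)).le) htt
          fun i => ?_
        rw [← hc]; exact E.le_look_count t' i
  exact fun t' t ht htt => key _ t' rfl t ht htt

/-- Every robot takes another snapshot. Where it takes it together with other robots, its snapshot
is put first. -/
theorem exists_look (hno : ∀ t, 0 ≤ t → ¬ Lead E.frame (E.at' t))
    (hwin : Win A E.frame (E.at' 0)) (i : Fin n) {t : ℝ} (ht : 0 ≤ t) :
    ∃ s₁ s₂ t', 0 ≤ t' ∧ Steps A E.frame (E.at' t) s₁ ∧ Look A E.frame i s₁ s₂ ∧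
      Steps A E.frame s₂ (E.at' t') := by
  set e := E.look i (E.count t i) with he
  have hte : t ≤ e := E.le_look_count t i
  have h0 := ht.trans hte
  have hd : (E.config e).Dark := by
    have := (hwin.steps (E.steps_between hno hwin e 0 le_rfl h0)).dark_or_lead
    rw [config_state] at this
    exact this.resolve_right (hno e h0)
  have hce : E.look i (E.count e i) = e :=
    le_antisymm ((E.look_strictMono i).monotone (E.count_le he.ge)) (E.le_look_count e i)
  have hne : (Finset.univ : Finset (Fin n)).Nonempty := ⟨i, Finset.mem_univ _⟩
  set t' := Finset.univ.inf' hne (fun j => E.look j (E.countLe e j)) with ht'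
  have het : e < t' := by
    rw [ht', Finset.lt_inf'_iff]
    exact fun j _ => E.look_countLe e j
  have hmax : ∀ j k, E.look j k < t' → E.look j k ≤ e := by
    intro j k hk
    have h1 : t' ≤ E.look j (E.countLe e j) := Finset.inf'_le _ (Finset.mem_univ j)
    have h2 : k < E.countLe e j := (E.look_strictMono j).lt_iff_lt.1 (hk.trans_le h1)
    cases hc : E.countLe e j with
    | zero => omega
    | succ l =>
      exact ((E.look_strictMono j).monotone (by omega)).trans (E.look_le_of_countLe hc)
  refine ⟨_, _, t', h0.trans het.le, E.steps_between hno hwin e t ht hte, E.look_state hce hd,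
    E.steps_to h0 het hd hmax fun j => ?_⟩
  by_cases hj : j = i
  · subst hj
    right
    simp [countLe, hce]
  · left; simp [hj]

theorem exists_lead (hwin : Win A E.frame (E.at' 0)) :
    ∃ t, 0 ≤ t ∧ Lead E.frame (E.at' t) := by
  by_contra hno
  push Not at hno
  have key : ∀ s, Win A E.frame s → ∀ t, 0 ≤ t → ¬ Steps A E.frame s (E.at' t) := by
    intro s hs
    induction hs with
    | lead s h => exact fun t ht hst => hno t ht (h.steps hst)
    | stage s P i hP hd hstep hlook ih1 ih2 =>
      -- a run that leaves the stage enters an already treated state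
      have path : ∀ s s', Steps A E.frame s s' → P s → P s' ∨ ∃ s₁,
          (∀ t, 0 ≤ t → ¬ Steps A E.frame s₁ (E.at' t)) ∧ Steps A E.frame s₁ s' := by
        intro s s' hst hs
        induction hst with
        | refl => exact Or.inl hs
        | @tail b c _ hbc ih =>
          rcases ih with ih | ⟨s₁, h1, h2⟩
          · by_cases hc : P c
            · exact Or.inl hc
            · exact Or.inr ⟨c, ih1 b c ih hbc hc, Relation.ReflTransGen.refl⟩
          · exact Or.inr ⟨s₁, h1, h2.tail hbc⟩
      intro t ht hst
      obtain ⟨s₁, s₂, t', ht', h1, h2, h3⟩ := E.exists_look hno hwin i ht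
      rcases path s s₁ (hst.trans h1) hP with h | ⟨s₃, h4, h5⟩
      · exact ih2 s₁ s₂ h h2 t' ht' h3
      · exact h4 t' ht' ((h5.tail ⟨i, Or.inl h2⟩).trans h3)
  exact key _ hwin 0 le_rfl Relation.ReflTransGen.refl

theorem stable_of_idle {t : ℝ} {i : Fin n} {p : ℝ × ℝ} {c : Light}
    (h : E.at' t i = Rob.idle p c) : E.StableAt i t := by
  have hk : ∀ k, E.look i k < t → t ≤ E.look i (k + 1) → E.count t i = k + 1 := fun k h1 h2 =>
    le_antisymm (E.count_le h2) (E.lt_count h1)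
  have hmv : ∀ k, E.look i k < t → t ≤ E.look i (k + 1) → ¬ E.Moves i k := by
    intro k h1 h2 hm
    have h3 := h
    simp only [state, hk k h1 h2, rob, Rob.idle, Rob.mk.injEq] at h3
    obtain ⟨h4, h5, -⟩ := h3
    refine hm ?_
    rw [← h4] at h5
    simp only [Frame.toPlane, Prod.ext_iff] at h5
    have hu := (E.frame i).unit_pos.ne'
    have hup : (E.frame i).up ≠ 0 := by
      rcases (E.frame i).up_eq with h | h <;> rw [h] <;> norm_num
    ext
    · simpa [hu] using h5.1
    · simpa [hu, hup] using h5.2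
  constructor
  · rintro ⟨k, hm, h1, h2⟩
    exact hmv k ((E.look_lt_depart i k).trans h1) (h2.le.trans (E.arrive_le_look i k)) hm
  · rintro ⟨k, ⟨hr, -, h1, h2⟩ | ⟨hm, h1, h2⟩⟩
    · have h3 : t ≤ E.look i (k + 1) := (h2.trans ((E.compute_lt_depart i k).trans
        (E.depart_lt_arrive i k))).le.trans (E.arrive_le_look i k)
      have h4 := h
      simp only [state, hk k h1 h3, rob, Rob.idle, Rob.mk.injEq] at h4
      obtain ⟨-, -, -, h5, h6⟩ := h4
      exact hr (by rw [h6, ← h5, E.light_before i k h1.le h2])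
    · exact hmv k h1 ((h2.trans (E.depart_lt_arrive i k).le).trans (E.arrive_le_look i k)) hm

theorem isLeaderConfiguration_of_lead {t : ℝ} (h : Lead E.frame (E.at' t)) :
    E.IsLeaderConfiguration t := by
  obtain ⟨l, ⟨p, hp⟩, hl⟩ := h
  have hpos : ∀ i, (E.at' t i).pos = (E.config t).pos i := fun i => by
    rw [← E.config_state t (E.count t)]; rfl
  have hlight : ∀ i, (E.at' t i).light = (E.config t).light i := fun i => by
    rw [← E.config_state t (E.count t)]; rfl
  have hoff : ∀ i, i ≠ l → (E.config t).light i = Light.off := fun i hi => by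
    obtain ⟨⟨q, hq⟩, -⟩ := hl i hi
    rw [← hlight, hq]; rfl
  refine ⟨fun i => ?_, l, ⟨?_, hoff, fun i hi => ?_⟩, fun l' hl' => ?_⟩
  · by_cases hi : i = l
    · subst hi; exact E.stable_of_idle hp
    · obtain ⟨⟨q, hq⟩, -⟩ := hl i hi
      exact E.stable_of_idle hq
  · rw [← hlight, hp]; rfl
  · have := (hl i hi).2
    rwa [hpos, hpos] at this
  · by_contra hne
    have := hoff l' hne
    rw [hl'.1] at this
    exact Light.noConfusion this

/-- A fair scheduler reaches a leader configuration from every winning initial state. -/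
theorem exists_isLeaderConfiguration (hinit : (E.config 0).IsInitial)
    (hwin : Win A E.frame (fun i => Rob.idle ((E.config 0).pos i) Light.off)) :
    ∃ T : ℝ, 0 < T ∧ E.IsLeaderConfiguration T := by
  have h0 : E.at' 0 = fun i => Rob.idle ((E.config 0).pos i) Light.off := by
    funext i
    have : E.count 0 i = 0 := Nat.le_zero.1 (E.count_le (E.look_zero i))
    simp [state, this, rob, hinit.2 i]
  obtain ⟨t, ht, hl⟩ := E.exists_lead (by rw [h0]; exact hwin)
  refine ⟨t, lt_of_le_of_ne ht ?_, E.isLeaderConfiguration_of_lead hl⟩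
  rintro rfl
  rw [h0] at hl
  obtain ⟨l, ⟨p, hp⟩, -⟩ := hl
  simp [Rob.idle] at hp

end Execution

/-! ### Visibility -/

theorem exists_of_mem_segment {p q r : ℝ × ℝ} (h : r ∈ segment ℝ p q) :
    ∃ θ : ℝ, 0 ≤ θ ∧ θ ≤ 1 ∧ r.1 = p.1 + θ * (q.1 - p.1) ∧ r.2 = p.2 + θ * (q.2 - p.2) := by
  rw [segment_eq_image_lineMap] at h
  obtain ⟨θ, ⟨h0, h1⟩, rfl⟩ := h
  refine ⟨θ, h0, h1, ?_, ?_⟩ <;> simp [AffineMap.lineMap_apply] <;> ring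

namespace Config

variable {n : ℕ} {C : Config n}

theorem Visible.symm {i j : Fin n} (h : C.Visible i j) : C.Visible j i :=
  ⟨h.1.symm, fun k h1 h2 => by rw [segment_symm]; exact h.2 k h2 h1⟩

/-- The nearest robot on a segment that starts at the observer is visible. -/
theorem exists_visible_mem_segment (hC : Function.Injective C.pos) {i j : Fin n} (hij : j ≠ i) :
    ∃ k, C.Visible i k ∧ C.pos k ∈ segment ℝ (C.pos i) (C.pos j) := by
  obtain ⟨k, hk, hmin⟩ := Finset.exists_min_image
    (Finset.univ.filter fun k => k ≠ i ∧ C.pos k ∈ segment ℝ (C.pos i) (C.pos j))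
    (fun k => dist (C.pos k) (C.pos i))
    ⟨j, by simpa [hij] using right_mem_segment ℝ (C.pos i) (C.pos j)⟩
  simp only [Finset.mem_filter, Finset.mem_univ, true_and] at hk hmin
  refine ⟨k, ⟨hk.1, fun l hl hlk hls => ?_⟩, hk.2⟩
  have h1 := hmin l ⟨hl, (convex_segment _ _).segment_subset (left_mem_segment ℝ _ _) hk.2 hls⟩
  rw [segment_eq_image_lineMap] at hls
  obtain ⟨θ, ⟨h0, hθ⟩, hl'⟩ := hls
  rw [← hl', dist_lineMap_left, dist_comm (C.pos i), Real.norm_of_nonneg h0] at h1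
  have hpos : 0 < dist (C.pos k) (C.pos i) := dist_pos.2 (hC.ne hk.1)
  have : θ = 1 := by nlinarith
  subst this
  exact hlk (hC (by simpa using hl'.symm))

theorem visible_of_lt (hC : Function.Injective C.pos) {i j : Fin n}
    (hij : (C.pos i).1 < (C.pos j).1)
    (h : ∀ k, k ≠ i → k ≠ j → (C.pos k).1 ≤ (C.pos i).1 ∨ (C.pos j).1 ≤ (C.pos k).1) :
    C.Visible i j := by
  refine ⟨fun h => by simp [h] at hij, fun k hki hkj hks => ?_⟩
  obtain ⟨θ, h0, h1, hx, hy⟩ := exists_of_mem_segment hks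
  rcases h k hki hkj with hk | hk
  · have : θ = 0 := by nlinarith
    subst this
    exact hki (hC (Prod.ext (by simpa using hx) (by simpa using hy)))
  · have : θ = 1 := by nlinarith
    subst this
    exact hkj (hC (Prod.ext (by simpa using hx) (by simpa using hy)))

theorem visible_of_column {i j : Fin n} (hne : j ≠ i) (hij : (C.pos i).1 = (C.pos j).1)
    (h : ∀ k, k ≠ i → k ≠ j → (C.pos k).1 ≠ (C.pos i).1) : C.Visible i j := by
  refine ⟨hne, fun k hki hkj hks => ?_⟩
  obtain ⟨θ, -, -, hx, -⟩ := exists_of_mem_segment hks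
  exact h k hki hkj (by rw [hx, hij]; ring)

theorem exists_visible_left (hC : Function.Injective C.pos) {i j : Fin n}
    (h : (C.pos j).1 < (C.pos i).1) : ∃ k, C.Visible i k ∧ (C.pos k).1 < (C.pos i).1 ∧
      C.pos k ∈ segment ℝ (C.pos i) (C.pos j) := by
  obtain ⟨k, hk, hs⟩ := exists_visible_mem_segment hC (i := i) (j := j)
    (fun h' => by simp [h'] at h)
  refine ⟨k, hk, ?_, hs⟩
  obtain ⟨θ, h0, h1, hx, hy⟩ := exists_of_mem_segment hs
  by_contra hlt
  have : θ = 0 := by nlinarith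
  subst this
  exact hk.1 (hC (Prod.ext (by simpa using hx) (by simpa using hy)))

/-! ### Snapshots -/

variable {F : Frame}

theorem mem_others {i : Fin n} {q : Sighting} :
    q ∈ (C.snapshot F i).others ↔ ∃ j, C.Visible i j ∧ C.sighting F i j = q := by
  simp [snapshot]

theorem mem_all {i : Fin n} {q : Sighting} :
    q ∈ (C.snapshot F i).all ↔ ∃ j, (j = i ∨ C.Visible i j) ∧ C.sighting F i j = q := by
  have h0 : C.sighting F i i = ⟨0, 0, C.light i⟩ := by simp [sighting]
  rw [Snapshot.all, Finset.mem_insert, mem_others]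
  constructor
  · rintro (rfl | ⟨j, hj, rfl⟩)
    · exact ⟨i, Or.inl rfl, h0⟩
    · exact ⟨j, Or.inr hj, rfl⟩
  · rintro ⟨j, rfl | hj, rfl⟩
    · exact Or.inl h0
    · exact Or.inr ⟨j, hj, rfl⟩

theorem sighting_inj (hC : Function.Injective C.pos) {i j k : Fin n}
    (h : C.sighting F i j = C.sighting F i k) : j = k := by
  have hu := F.unit_pos.ne'
  have hup : F.up ≠ 0 := by rcases F.up_eq with h | h <;> rw [h] <;> norm_num
  simp only [sighting, Sighting.mk.injEq] at h
  refine hC (Prod.ext ?_ ?_)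
  · have := h.1; field_simp at this; linarith
  · have := h.2.1
    field_simp at this
    linarith

theorem sighting_x_pos {i j : Fin n} :
    0 < (C.sighting F i j).x ↔ (C.pos i).1 < (C.pos j).1 := by
  simp [sighting, div_pos_iff_of_pos_right F.unit_pos]

theorem sighting_x_neg {i j : Fin n} :
    (C.sighting F i j).x < 0 ↔ (C.pos j).1 < (C.pos i).1 := by
  simp [sighting, div_neg_iff, F.unit_pos, F.unit_pos.le]

theorem sighting_x_zero {i j : Fin n} :
    (C.sighting F i j).x = 0 ↔ (C.pos j).1 = (C.pos i).1 := by
  simp [sighting, F.unit_pos.ne', sub_eq_zero]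

theorem sighting_y_pos {i j : Fin n} :
    0 < (C.sighting F i j).y ↔ 0 < F.up * ((C.pos j).2 - (C.pos i).2) := by
  simp [sighting, div_pos_iff_of_pos_right F.unit_pos]

theorem sighting_y_neg {i j : Fin n} :
    (C.sighting F i j).y < 0 ↔ F.up * ((C.pos j).2 - (C.pos i).2) < 0 := by
  simp [sighting, div_neg_iff, F.unit_pos, F.unit_pos.le]

theorem sighting_y_zero {i j : Fin n} :
    (C.sighting F i j).y = 0 ↔ (C.pos j).2 = (C.pos i).2 := by
  have hup : F.up ≠ 0 := by rcases F.up_eq with h | h <;> rw [h] <;> norm_num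
  simp [sighting, F.unit_pos.ne', sub_eq_zero, hup]

@[simp] theorem sighting_light {i j : Fin n} : (C.sighting F i j).light = C.light j := rfl

@[simp] theorem snapshot_light {i : Fin n} : (C.snapshot F i).light = C.light i := rfl

theorem noneAbove_iff (hC : Function.Injective C.pos) {i : Fin n} :
    (C.snapshot F i).NoneAbove ↔
      ∀ k, (C.pos k).1 = (C.pos i).1 → F.up * ((C.pos k).2 - (C.pos i).2) ≤ 0 := by
  constructor
  · intro h k hk
    by_cases hki : k = i
    · simp [hki]
    obtain ⟨l, hl, hs⟩ := exists_visible_mem_segment hC hki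
    obtain ⟨θ, h0, h1, hx, hy⟩ := exists_of_mem_segment hs
    have := h _ (mem_others.2 ⟨l, hl, rfl⟩) (sighting_x_zero.2 (by rw [hx, hk]; ring))
    rw [sighting_y_pos, hy] at this
    by_contra hlt
    push Not at hlt
    have h2 : θ * (F.up * ((C.pos k).2 - (C.pos i).2)) ≤ 0 := by linarith
    have : θ = 0 := by nlinarith
    subst this
    exact hl.1 (hC (Prod.ext (by simpa using hx) (by simpa using hy)))
  · intro h q hq hx hy
    obtain ⟨j, hj, rfl⟩ := mem_others.1 hq
    rw [sighting_x_zero] at hx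
    rw [sighting_y_pos] at hy
    linarith [h j hx]

theorem noneBelow_iff (hC : Function.Injective C.pos) {i : Fin n} :
    (C.snapshot F i).NoneBelow ↔
      ∀ k, (C.pos k).1 = (C.pos i).1 → 0 ≤ F.up * ((C.pos k).2 - (C.pos i).2) := by
  constructor
  · intro h k hk
    by_cases hki : k = i
    · simp [hki]
    obtain ⟨l, hl, hs⟩ := exists_visible_mem_segment hC hki
    obtain ⟨θ, h0, h1, hx, hy⟩ := exists_of_mem_segment hs
    have := h _ (mem_others.2 ⟨l, hl, rfl⟩) (sighting_x_zero.2 (by rw [hx, hk]; ring))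
    rw [sighting_y_neg, hy] at this
    by_contra hlt
    push Not at hlt
    have h2 : 0 ≤ θ * (F.up * ((C.pos k).2 - (C.pos i).2)) := by linarith
    have : θ = 0 := by nlinarith
    subst this
    exact hl.1 (hC (Prod.ext (by simpa using hx) (by simpa using hy)))
  · intro h q hq hx hy
    obtain ⟨j, hj, rfl⟩ := mem_others.1 hq
    rw [sighting_x_zero] at hx
    rw [sighting_y_neg] at hy
    linarith [h j hx]

/-! ### Terminal robots of the leftmost column -/

/-- The robot `i` is the topmost one of its column. -/
def IsTop (C : Config n) (i : Fin n) : Prop :=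
  ∀ k, (C.pos k).1 = (C.pos i).1 → (C.pos k).2 ≤ (C.pos i).2

/-- The robot `i` is the bottommost one of its column. -/
def IsBottom (C : Config n) (i : Fin n) : Prop :=
  ∀ k, (C.pos k).1 = (C.pos i).1 → (C.pos i).2 ≤ (C.pos k).2

theorem leftMostTerminal_iff_of_forall_le (hC : Function.Injective C.pos) {i : Fin n}
    (h : ∀ j, (C.pos i).1 ≤ (C.pos j).1) :
    LeftMostTerminal (C.snapshot F i) ↔ C.IsTop i ∨ C.IsBottom i := by
  rw [LeftMostTerminal, if_pos, noneBelow_iff hC, noneAbove_iff hC]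
  · rcases F.up_eq with hu | hu <;> simp only [hu, IsTop, IsBottom, one_mul, neg_mul,
      Left.nonneg_neg_iff, Left.neg_nonpos_iff, sub_nonneg, sub_nonpos]
    exact or_comm
  · intro q hq
    obtain ⟨j, hj, rfl⟩ := mem_others.1 hq
    rw [sighting_x_neg, not_lt]
    exact h j

/-- With robots to its left, a robot may leave only if a single robot, with light `candidate`,
hides all others from it on that side. -/
theorem leftMostTerminal_iff_of_lt (hC : Function.Injective C.pos) {i j : Fin n}
    (h : (C.pos j).1 < (C.pos i).1) :
    LeftMostTerminal (C.snapshot F i) ↔ ∃ k, C.Visible i k ∧ (C.pos k).1 < (C.pos i).1 ∧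
      C.light k = Light.candidate ∧
      (∀ l, (C.pos l).1 < (C.pos i).1 → C.pos k ∈ segment ℝ (C.pos i) (C.pos l)) ∧
      ((C.pos i).2 ≤ (C.pos k).2 ∧ C.IsBottom i ∨ (C.pos k).2 ≤ (C.pos i).2 ∧ C.IsTop i) := by
  have hor : ∀ k, ((¬ (C.sighting F i k).y < 0 ∧ (C.snapshot F i).NoneBelow) ∨
      (¬ 0 < (C.sighting F i k).y ∧ (C.snapshot F i).NoneAbove)) ↔
      ((C.pos i).2 ≤ (C.pos k).2 ∧ C.IsBottom i ∨ (C.pos k).2 ≤ (C.pos i).2 ∧ C.IsTop i) := by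
    intro k
    rw [noneBelow_iff hC, noneAbove_iff hC, sighting_y_pos, sighting_y_neg]
    rcases F.up_eq with hu | hu <;> simp only [hu, IsTop, IsBottom, one_mul, neg_mul,
      Left.nonneg_neg_iff, Left.neg_nonpos_iff, sub_nonneg, sub_nonpos, not_lt]
    exact or_comm
  obtain ⟨l0, hl0, hlx0, -⟩ := exists_visible_left hC h
  rw [LeftMostTerminal, if_neg]
  · constructor
    · rintro ⟨r, hr, hc, hy⟩
      obtain ⟨hr1, hr2⟩ := Finset.mem_filter.1 (hr ▸ Finset.mem_singleton_self r)
      obtain ⟨k, hk, rfl⟩ := mem_others.1 hr1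
      refine ⟨k, hk, sighting_x_neg.1 hr2, hc, fun l hl => ?_, (hor k).1 hy⟩
      obtain ⟨m, hm, hmx, hms⟩ := exists_visible_left hC hl
      have : C.sighting F i m ∈ ({C.sighting F i k} : Finset Sighting) := by
        rw [← hr]
        exact Finset.mem_filter.2 ⟨mem_others.2 ⟨m, hm, rfl⟩, sighting_x_neg.2 hmx⟩
      rw [← sighting_inj hC (Finset.mem_singleton.1 this)]
      exact hms
    · rintro ⟨k, hk, hkx, hc, hl, hy⟩
      refine ⟨C.sighting F i k, ?_, hc, (hor k).2 hy⟩
      ext q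
      rw [Finset.mem_filter, Finset.mem_singleton]
      constructor
      · rintro ⟨hq, hqx⟩
        obtain ⟨m, hm, rfl⟩ := mem_others.1 hq
        by_contra hne
        refine hm.2 k hk.1 (fun h => hne (by rw [h])) (hl m (sighting_x_neg.1 hqx))
      · rintro rfl
        exact ⟨mem_others.2 ⟨k, hk, rfl⟩, sighting_x_neg.2 hkx⟩
  · intro hall
    exact hall _ (mem_others.2 ⟨l0, hl0, rfl⟩) (sighting_x_neg.2 hlx0)

end Config

/-! ### Decisions in the first phase -/

section Decisions

variable {n : ℕ} {stage2 : Snapshot → Action} {F : Fin n → Frame} {C : Config n} {i : Fin n}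

/-- The decisions of the leader election algorithm. -/
abbrev dec (stage2 : Snapshot → Action) (F : Fin n → Frame) (C : Config n) (i : Fin n) :
    Light × (ℝ × ℝ) := decision (algorithm n stage2) F C i

theorem Frame.toPlane_zero (F : Frame) (p : ℝ × ℝ) : F.toPlane p (0, 0) = p := by
  simp [Frame.toPlane]

theorem algorithm_of_dark (hd : C.Dark) (F : Frame) :
    algorithm n stage2 (C.snapshot F i) =
      if (∃ p ∈ (C.snapshot F i).all, ∃ q ∈ (C.snapshot F i).all, p ≠ q ∧ p.x = q.x ∧
        p.light = Light.candidate ∧ q.light = Light.candidate) ∨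
      (∃ q ∈ (C.snapshot F i).all, q.light = Light.symmetry) then phase2 n (C.snapshot F i)
      else phase1 (C.snapshot F i) := by
  rw [algorithm, if_neg]
  rintro ⟨q, hq, hl⟩
  obtain ⟨j, -, rfl⟩ := Config.mem_all.1 hq
  exact hd j hl

theorem algorithm_phase1 (hd : C.Dark) (hs : ∀ j, C.light j ≠ Light.symmetry)
    (hc : ∀ j k, j ≠ k → (C.pos j).1 = (C.pos k).1 → C.light j = Light.candidate →
      C.light k ≠ Light.candidate) (F : Frame) :
    algorithm n stage2 (C.snapshot F i) = phase1 (C.snapshot F i) := by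
  rw [algorithm_of_dark hd, if_neg]
  rintro (⟨p, hp, q, hq, hpq, hx, h1, h2⟩ | ⟨q, hq, hl⟩)
  · obtain ⟨j, -, rfl⟩ := Config.mem_all.1 hp
    obtain ⟨k, -, rfl⟩ := Config.mem_all.1 hq
    refine hc j k (fun h => hpq (by rw [h])) ?_ h1 h2
    simp only [Config.sighting] at hx
    have := F.unit_pos.ne'
    field_simp at hx
    linarith
  · obtain ⟨j, -, rfl⟩ := Config.mem_all.1 hq
    exact hs j hl

theorem phase1_off {S : Snapshot} (h : S.light = Light.off) : phase1 S =
    if S.UniqueLeftmost then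
        if ∀ q ∈ S.all, q.light = Light.off then becomeLeader S else S.stay
      else if LeftMostTerminal S then ⟨Light.terminal, computeDestination S⟩
      else S.stay := by
  rw [phase1, h]

theorem phase2_off {S : Snapshot} (h : S.light = Light.off) : phase2 n S =
    if h : ∃ p, S.IsSymmetryPair p then
        if (h.choose.1.y + h.choose.2.y) / 2 = 0 ∧ ∀ q ∈ S.others, q.y = 0 → 0 < q.x then
          S.moveTo (-(|h.choose.1.x| + 1), 0)
        else S.stay
      else S.stay := by
  rw [phase2, h]

theorem dec_of_stay (h : algorithm n stage2 (C.snapshot (F i) i) = (C.snapshot (F i) i).stay) :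
    dec stage2 F C i = (C.light i, C.pos i) := by
  simp only [dec, decision, h, Snapshot.stay, Frame.toPlane_zero]
  rfl

theorem dec_of_setLight {c : Light}
    (h : algorithm n stage2 (C.snapshot (F i) i) = setLight c) :
    dec stage2 F C i = (c, C.pos i) := by
  simp only [dec, decision, h, setLight, Frame.toPlane_zero]

theorem not_uniqueLeftmost (hC : Function.Injective C.pos) {F : Frame} {j : Fin n} (hj : j ≠ i)
    (h : (C.pos j).1 ≤ (C.pos i).1) : ¬ (C.snapshot F i).UniqueLeftmost := by
  intro hu
  obtain ⟨k, hk, hs⟩ := Config.exists_visible_mem_segment hC hj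
  have := hu _ (Config.mem_others.2 ⟨k, hk, rfl⟩)
  rw [Config.sighting_x_pos] at this
  obtain ⟨θ, h0, h1, hx, hy⟩ := exists_of_mem_segment hs
  nlinarith

/-- A robot with light `off` that is not a unique leftmost robot, cannot leave a leftmost column
and need not break a symmetry does nothing. -/
theorem dec_off_stay (hC : Function.Injective C.pos) (hd : C.Dark) (hi : C.light i = Light.off)
    {j : Fin n} (hj : j ≠ i) (hji : (C.pos j).1 ≤ (C.pos i).1)
    (hterm : ¬ LeftMostTerminal (C.snapshot (F i) i))
    (hpair : ∀ k l, C.Visible i k → C.Visible i l → k ≠ l → (C.pos k).1 < (C.pos i).1 →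
      (C.pos k).1 = (C.pos l).1 → C.light k = Light.symmetry → C.light l = Light.symmetry →
      ((C.pos k).2 + (C.pos l).2) / 2 = (C.pos i).2 →
      ∃ m, m ≠ i ∧ (C.pos m).2 = (C.pos i).2 ∧ (C.pos m).1 ≤ (C.pos i).1) :
    dec stage2 F C i = (Light.off, C.pos i) := by
  rw [← hi]
  apply dec_of_stay
  rw [algorithm_of_dark hd]
  split_ifs with hcond
  · rw [phase2_off (by exact hi)]
    split_ifs with h h2
    · exfalso
      have hch := h.choose_spec
      set p := h.choose
      obtain ⟨h3, h4, h5, h6, h7, h8, h9⟩ := hch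
      obtain ⟨k, hk, hkp⟩ := Config.mem_others.1 h3
      obtain ⟨l, hl, hlp⟩ := Config.mem_others.1 h4
      rw [← hkp, ← hlp] at h2 h5 h7
      rw [← hkp] at h6 h8
      rw [← hlp] at h9
      have hu := (F i).unit_pos.ne'
      have hup : (F i).up ≠ 0 := by rcases (F i).up_eq with h | h <;> rw [h] <;> norm_num
      obtain ⟨m, hm, hmy, hmx⟩ := hpair k l hk hl (fun h => h5 (by rw [h]))
        (Config.sighting_x_neg.1 h6)
        (by simp only [Config.sighting] at h7; field_simp at h7; linarith) h8 h9
        (by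
          have := h2.1
          simp only [Config.sighting] at this
          field_simp at this
          have h10 : (F i).up * ((C.pos k).2 - (C.pos i).2 + ((C.pos l).2 - (C.pos i).2)) = 0 := by
            linarith
          rcases mul_eq_zero.1 h10 with h | h
          · exact absurd h hup
          · linarith)
      obtain ⟨m', hm', hs⟩ := Config.exists_visible_mem_segment hC hm
      obtain ⟨θ, h0, h1, hx, hy⟩ := exists_of_mem_segment hs
      have := h2.2 _ (Config.mem_others.2 ⟨m', hm', rfl⟩)
        (Config.sighting_y_zero.2 (by rw [hy, hmy]; ring))
      rw [Config.sighting_x_pos] at this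
      nlinarith
    · rfl
    · rfl
  · rw [phase1_off (by exact hi), if_neg (not_uniqueLeftmost hC hj hji), if_neg hterm]

theorem dec_terminal (hd : C.Dark) (hs : ∀ j, C.light j ≠ Light.symmetry)
    (hc : ∀ j k, j ≠ k → (C.pos j).1 = (C.pos k).1 → C.light j = Light.candidate →
      C.light k ≠ Light.candidate) (hi : C.light i = Light.terminal) :
    dec stage2 F C i = (Light.candidate, C.pos i) := by
  apply dec_of_setLight
  rw [algorithm_phase1 hd hs hc, phase1]
  simp only [Config.snapshot_light, hi]

theorem dec_candidate_of_visible_right (hd : C.Dark) (hs : ∀ j, C.light j ≠ Light.symmetry)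
    (hc : ∀ j k, j ≠ k → (C.pos j).1 = (C.pos k).1 → C.light j = Light.candidate →
      C.light k ≠ Light.candidate) (hi : C.light i = Light.candidate) {j : Fin n}
    (hj : C.Visible i j) (hjx : (C.pos i).1 < (C.pos j).1) (hjc : C.light j = Light.candidate) :
    dec stage2 F C i = (Light.off, C.pos i) := by
  apply dec_of_setLight
  rw [algorithm_phase1 hd hs hc, phase1]
  simp only [Config.snapshot_light, hi]
  rw [if_pos ⟨_, Config.mem_others.2 ⟨j, hj, rfl⟩, Config.sighting_x_pos.2 hjx, hjc⟩]

theorem dec_candidate_of_visible_left (hd : C.Dark) (hs : ∀ j, C.light j ≠ Light.symmetry)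
    (hc : ∀ j k, j ≠ k → (C.pos j).1 = (C.pos k).1 → C.light j = Light.candidate →
      C.light k ≠ Light.candidate) (hi : C.light i = Light.candidate) {j : Fin n}
    (hj : C.Visible i j) (hjx : (C.pos j).1 < (C.pos i).1) (hjc : C.light j = Light.off) :
    dec stage2 F C i = (Light.off, C.pos i) := by
  apply dec_of_setLight
  rw [algorithm_phase1 hd hs hc, phase1]
  simp only [Config.snapshot_light, hi]
  rw [if_pos (c := ∃ q ∈ (C.snapshot (F i) i).others, q.x < 0 ∧ q.light = Light.off)
    ⟨_, Config.mem_others.2 ⟨j, hj, rfl⟩, Config.sighting_x_neg.2 hjx, hjc⟩, ite_self]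

theorem dec_candidate_stay (hd : C.Dark) (hs : ∀ j, C.light j ≠ Light.symmetry)
    (hc : ∀ j k, j ≠ k → (C.pos j).1 = (C.pos k).1 → C.light j = Light.candidate →
      C.light k ≠ Light.candidate) (hi : C.light i = Light.candidate)
    (hr : ∀ j, (C.pos i).1 < (C.pos j).1 → C.light j ≠ Light.candidate)
    (hl : ∀ j, (C.pos j).1 < (C.pos i).1 → C.light j ≠ Light.off) :
    dec stage2 F C i = (Light.candidate, C.pos i) := by
  rw [← hi]
  apply dec_of_stay
  rw [algorithm_phase1 hd hs hc, phase1]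
  simp only [Config.snapshot_light, hi]
  rw [if_neg, if_neg]
  · rintro ⟨q, hq, hx, h⟩
    obtain ⟨j, hj, rfl⟩ := Config.mem_others.1 hq
    exact hl j (Config.sighting_x_neg.1 hx) h
  · rintro ⟨q, hq, hx, h⟩
    obtain ⟨j, hj, rfl⟩ := Config.mem_others.1 hq
    exact hr j (Config.sighting_x_pos.1 hx) h

end Decisions

/-! ### Steps of the active robots -/

section Stages

variable {n : ℕ} {stage2 : Snapshot → Action} {F : Fin n → Frame}

/-- Outside of a set of active robots nothing happens, if all other robots are idle and decide to
stay. -/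
theorem Step.active {A : Snapshot → Action} {s s' : St n} (h : Step A F s s') (S : Set (Fin n))
    (hby : ∀ j, j ∉ S → ∃ p c, s j = Rob.idle p c ∧
      (s.config.Dark → decision A F s.config j = (c, p))) :
    s' = s ∨ ∃ i ∈ S, Look A F i s s' ∨ ∃ a, Act (s i) a ∧ s' = Function.update s i a := by
  obtain ⟨i, hi⟩ := h
  by_cases hS : i ∈ S
  · exact Or.inr ⟨i, hS, hi⟩
  · left
    obtain ⟨p, c, hp, hdec⟩ := hby i hS
    rcases hi with ⟨-, -, hd, rfl⟩ | ⟨a, ha, rfl⟩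
    · rw [hdec hd]
      conv_rhs => rw [← Function.update_eq_self i s]
      rw [hp]; rfl
    · rw [hp] at ha
      rw [idle_act ha, ← hp, Function.update_eq_self]

theorem not_leftMostTerminal_of_no_candidate {C : Config n} (hC : Function.Injective C.pos)
    {i j : Fin n} (h : (C.pos j).1 < (C.pos i).1) (hc : ∀ k, C.light k ≠ Light.candidate)
    (F : Frame) : ¬ LeftMostTerminal (C.snapshot F i) := by
  rw [Config.leftMostTerminal_iff_of_lt hC h]
  rintro ⟨k, -, -, hk, -⟩
  exact hc k hk

theorem fst_lt_of_mem_segment {p q r : ℝ × ℝ} (h : r ∈ segment ℝ p q) {c : ℝ} (hp : p.1 < c)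
    (hq : q.1 < c) : r.1 < c := by
  obtain ⟨θ, h0, h1, hx, -⟩ := exists_of_mem_segment h
  rcases le_total p.1 q.1 with h | h <;> nlinarith

/-! ### A single leftmost robot -/

/-- A robot `l` without light, to the left of all others, that has decided to become leader. -/
theorem win_of_elected {l : Fin n} {q : Fin n → ℝ × ℝ}
    (hq : ∀ j k, j ≠ l → k ≠ l → q j = q k → j = k) {s : St n}
    (hs : ∀ j, j ≠ l → s j = Rob.idle (q j) Light.off) {p : ℝ × ℝ}
    (hl : s l = ⟨p, p, p, Light.off, Light.leader⟩)
    (hlow : ∀ j, j ≠ l → p.1 < (q j).1 ∧ 0 < (F l).up * ((q j).2 - p.2)) :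
    Win (algorithm n stage2) F s := by
  refine Win.stage s (fun s => (∀ j, j ≠ l → s j = Rob.idle (q j) Light.off) ∧
    s l = ⟨p, p, p, Light.off, Light.leader⟩) l ⟨hs, hl⟩ ?_ ?_ ?_
  · rintro s ⟨hs, hl⟩ i
    by_cases hi : i = l
    · subst hi; simp [St.config, hl]
    · simp [St.config, hs i hi, Rob.idle]
  · rintro s s' ⟨hs, hl⟩ hstep hP
    have hoff : ∀ i, s.config.light i = Light.off := by
      intro i
      by_cases hi : i = l
      · subst hi; simp [St.config, hl]
      · simp [St.config, hs i hi, Rob.idle]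
    have hpl : s.config.pos l = p := by simp [St.config, hl]
    have hpj : ∀ j, j ≠ l → s.config.pos j = q j := fun j hj => by
      simp [St.config, hs j hj, Rob.idle]
    have hinj : Function.Injective s.config.pos := by
      intro j k hjk
      by_cases hj : j = l <;> by_cases hk : k = l
      · rw [hj, hk]
      · subst hj
        rw [hpl, hpj k hk] at hjk
        have := (hlow k hk).1
        rw [hjk] at this
        exact absurd this (lt_irrefl _)
      · subst hk
        rw [hpl, hpj j hj] at hjk
        have := (hlow j hj).1
        rw [hjk] at this
        exact absurd this (lt_irrefl _)
      · rw [hpj j hj, hpj k hk] at hjk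
        exact hq j k hj hk hjk
    have hby : ∀ j, j ∉ ({l} : Set (Fin n)) → ∃ p c, s j = Rob.idle p c ∧ (s.config.Dark →
        decision (algorithm n stage2) F s.config j = (c, p)) := by
      refine fun j hj => ⟨q j, Light.off, hs j hj, fun hd => ?_⟩
      have hj' : j ≠ l := hj
      have hlt : (s.config.pos l).1 < (s.config.pos j).1 := by
        rw [hpl, hpj j hj']; exact (hlow j hj').1
      have := dec_off_stay (stage2 := stage2) (F := F) hinj hd (hoff j) (Ne.symm hj') hlt.le
        (not_leftMostTerminal_of_no_candidate hinj hlt (fun k => by simp [hoff]) _)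
        (fun k l _ _ _ _ _ h => by simp [hoff] at h)
      exact this.trans (by rw [hpj j hj'])
    rcases hstep.active {l} hby with rfl | ⟨i, rfl, hlook | ⟨a, ha, rfl⟩⟩
    · exact absurd ⟨hs, hl⟩ hP
    · have := hlook.2.1
      rw [hl] at this
      exact Light.noConfusion this
    · rw [hl] at ha
      cases ha with
      | color =>
        refine Win.lead _ ⟨i, ⟨p, by simp [Rob.idle]⟩, fun j hj => ⟨⟨q j, by simp [hj, hs j hj]⟩, ?_⟩⟩
        simpa [hj, hs j hj, Rob.idle] using hlow j hj
      | move p' h => exact Light.noConfusion h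
  · rintro s s' ⟨hs, hl⟩ hlook
    have := hlook.2.1
    rw [hl] at this
    exact Light.noConfusion this

theorem dec_becomeLeader {C : Config n} {l : Fin n} (hd : C.Dark)
    (hoff : ∀ j, C.light j = Light.off) (hl : ∀ j, j ≠ l → (C.pos l).1 < (C.pos j).1) :
    algorithm n stage2 (C.snapshot (F l) l) = becomeLeader (C.snapshot (F l) l) := by
  rw [algorithm_phase1 hd (fun j => by simp [hoff]) (fun j k _ _ h => by simp [hoff] at h),
    phase1_off (by exact hoff l), if_pos, if_pos]
  · intro q hq
    obtain ⟨j, -, rfl⟩ := Config.mem_all.1 hq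
    exact hoff j
  · intro q hq
    obtain ⟨j, hj, rfl⟩ := Config.mem_others.1 hq
    exact Config.sighting_x_pos.2 (hl j hj.1)

/-- The stage of a unique leftmost robot: all lights are off, and all other robots are idle. Every
further move takes the leftmost robot down by at least one unit, until it is below all others. -/
theorem win_of_leftmost {l : Fin n} {q : Fin n → ℝ × ℝ}
    (hq : ∀ j k, j ≠ l → k ≠ l → q j = q k → j = k) {s : St n}
    (hs : ∀ j, j ≠ l → s j = Rob.idle (q j) Light.off)
    (hl : (s l).light = Light.off) (hnl : (s l).nl = Light.off)
    (hlow : ∀ j, j ≠ l → (s l).pos.1 < (q j).1 ∧ (s l).tgt.1 < (q j).1) :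
    Win (algorithm n stage2) F s := by
  obtain ⟨k, hk⟩ : ∃ k : ℕ, ∀ j, j ≠ l →
      (F l).up * ((s l).tgt.2 - (q j).2) < k * (F l).unit := by
    obtain ⟨B, hB⟩ := (Set.finite_range
      (fun j => (F l).up * ((s l).tgt.2 - (q j).2) / (F l).unit)).bddAbove
    obtain ⟨k, hk⟩ := exists_nat_gt B
    refine ⟨k, fun j _ => ?_⟩
    have := (hB ⟨j, rfl⟩).trans_lt hk
    rwa [div_lt_iff₀ (F l).unit_pos] at this
  induction k using Nat.strong_induction_on generalizing s with
  | _ k ih =>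
  let P : St n → Prop := fun s => (∀ j, j ≠ l → s j = Rob.idle (q j) Light.off) ∧
    (s l).light = Light.off ∧ (s l).nl = Light.off ∧
    (∀ j, j ≠ l → (s l).pos.1 < (q j).1 ∧ (s l).tgt.1 < (q j).1) ∧
    ∀ j, j ≠ l → (F l).up * ((s l).tgt.2 - (q j).2) < k * (F l).unit
  have hoff : ∀ s, P s → ∀ i, s.config.light i = Light.off := by
    rintro s ⟨hs, hl, -⟩ i
    by_cases hi : i = l
    · subst hi; exact hl
    · simp [St.config, hs i hi, Rob.idle]
  have hpj : ∀ s, P s → ∀ j, j ≠ l → s.config.pos j = q j := fun s hs j hj => by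
    simp [St.config, hs.1 j hj, Rob.idle]
  have hlt : ∀ s, P s → ∀ j, j ≠ l → (s.config.pos l).1 < (s.config.pos j).1 := by
    intro s hs j hj
    rw [hpj s hs j hj]
    exact (hs.2.2.2.1 j hj).1
  have hinj : ∀ s, P s → Function.Injective s.config.pos := by
    intro s hs j m hjk
    by_cases hj : j = l <;> by_cases hm : m = l
    · rw [hj, hm]
    · have := hlt s hs m hm
      rw [← hjk, hj] at this
      exact absurd this (lt_irrefl _)
    · have := hlt s hs j hj
      rw [hjk, hm] at this
      exact absurd this (lt_irrefl _)
    · rw [hpj s hs j hj, hpj s hs m hm] at hjk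
      exact hq j m hj hm hjk
  have hdark : ∀ s, P s → s.config.Dark := fun s hs i => by simp [hoff s hs i]
  have hlook : ∀ s s', P s → Look (algorithm n stage2) F l s s' →
      Win (algorithm n stage2) F s' := by
    rintro s s' hPs ⟨hpt, -, hd, rfl⟩
    obtain ⟨hs, hl, hnl, hlow, hk⟩ := id hPs
    have hdec := dec_becomeLeader (stage2 := stage2) (F := F) hd (hoff s hPs) (hlt s hPs)
    unfold becomeLeader at hdec
    split_ifs at hdec with habove
    · have habove' : ∀ j, j ≠ l → 0 < (F l).up * ((q j).2 - (s l).pos.2) := by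
        intro j hj
        obtain ⟨m, hm, hms⟩ := Config.exists_visible_mem_segment (hinj s hPs) hj
        have h1 := Config.sighting_y_pos.1 (habove _ (Config.mem_others.2 ⟨m, hm, rfl⟩))
        obtain ⟨θ, h0, -, -, hy⟩ := exists_of_mem_segment hms
        rw [hy, hpj s hPs j hj] at h1
        have h2 : 0 < θ * ((F l).up * ((q j).2 - (s l).pos.2)) := by
          have : (s.config.pos l) = (s l).pos := rfl
          rw [this] at h1
          linarith
        exact pos_of_mul_pos_right h2 h0
      refine win_of_elected (l := l) (q := q) (p := (s l).pos) hq
        (fun j hj => by simp [hj, hs j hj]) ?_ (fun j hj => ⟨(hlow j hj).1, habove' j hj⟩)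
      rw [decision, hdec]
      simp only [Function.update_self, Rob.plan, setLight, Frame.toPlane_zero, hl]
      rfl
    · have hk0 : k ≠ 0 := by
        rintro rfl
        refine habove fun r hr => ?_
        obtain ⟨m, hm, rfl⟩ := Config.mem_others.1 hr
        rw [Config.sighting_y_pos, hpj s hPs m hm.1]
        have h1 := hk m hm.1
        rw [← hpt] at h1
        have : s.config.pos l = (s l).pos := rfl
        rw [this]
        simp only [Nat.cast_zero, zero_mul] at h1
        linarith
      obtain ⟨k, rfl⟩ := Nat.exists_eq_succ_of_ne_zero hk0
      rw [decision, hdec]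
      set y := (s.config.snapshot (F l) l).all.inf' (Finset.insert_nonempty _ _) Sighting.y
      refine ih k (Nat.lt_succ_self k) (fun j hj => by simp [hj, hs j hj]) ?_ ?_ ?_ ?_
      · simpa [Rob.plan] using hl
      · simp only [Function.update_self, Rob.plan, Snapshot.moveTo, Config.snapshot_light]
        exact hoff s hPs l
      · intro j hj
        simp only [Function.update_self, Rob.plan, Snapshot.moveTo, Frame.toPlane, mul_zero,
          add_zero]
        exact ⟨(hlow j hj).1, (hlow j hj).1⟩
      · intro j hj
        have h1 := hk j hj
        rw [← hpt] at h1
        simp only [Function.update_self, Rob.plan, Snapshot.moveTo, Frame.toPlane]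
        have : s.config.pos l = (s l).pos := rfl
        rw [this]
        have h2 : (F l).up * (F l).up = 1 := by
          rcases (F l).up_eq with h | h <;> rw [h] <;> norm_num
        have h3 : 0 ≤ (F l).unit * |y| := mul_nonneg (F l).unit_pos.le (abs_nonneg y)
        push_cast at h1
        have h4 : (F l).up * ((s l).pos.2 + (F l).unit * ((F l).up * -(|y| + 1)) - (q j).2) =
            (F l).up * ((s l).pos.2 - (q j).2) -
              ((F l).up * (F l).up) * ((F l).unit * |y| + (F l).unit) := by ring
        rw [h4, h2]
        linarith
  refine Win.stage s P l ⟨hs, hl, hnl, hlow, hk⟩ hdark ?_ hlook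
  intro s s' hPs hstep hP'
  have hby : ∀ j, j ∉ ({l} : Set (Fin n)) → ∃ p c, s j = Rob.idle p c ∧ (s.config.Dark →
      decision (algorithm n stage2) F s.config j = (c, p)) := by
    refine fun j hj => ⟨q j, Light.off, hPs.1 j hj, fun hd => ?_⟩
    have hj' : j ≠ l := hj
    have h1 := hlt s hPs j hj'
    have := dec_off_stay (stage2 := stage2) (F := F) (hinj s hPs) hd (hoff s hPs j)
      (Ne.symm hj') h1.le
      (not_leftMostTerminal_of_no_candidate (hinj s hPs) h1 (fun k => by simp [hoff s hPs]) _)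
      (fun k l _ _ _ _ _ h => by simp [hoff s hPs] at h)
    exact this.trans (by rw [hpj s hPs j hj'])
  rcases hstep.active {l} hby with rfl | ⟨i, rfl, hlk | ⟨a, ha, rfl⟩⟩
  · exact absurd hPs hP'
  · exact hlook _ _ hPs hlk
  · obtain ⟨hs, hl, hnl, hlow, hk⟩ := id hPs
    refine absurd ⟨fun j hj => by simp [hj, hs j hj], ?_⟩ hP'
    cases ha with
    | color => simpa [hl, hnl] using ⟨hlow, hk⟩
    | move p h hp =>
      refine ⟨by simpa using hl, by simpa using hnl, fun j hj => ?_, by simpa using hk⟩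
      simpa using ⟨fst_lt_of_mem_segment hp (hlow j hj).1 (hlow j hj).2, (hlow j hj).2⟩

end Stages

/-! ### Two active robots -/

section Duo

variable {n : ℕ} {stage2 : Snapshot → Action} {F : Fin n → Frame}
  {p : Fin n → ℝ × ℝ} {r r' : Fin n} {X : ℝ}

/-- The state in which the robots `r` and `r'` are in the states `a` and `b`, while every other
robot is idle at its place in `p`, with light `off`. -/
def duo (p : Fin n → ℝ × ℝ) (r r' : Fin n) (a b : Rob) : St n :=
  fun j => if j = r then a else if j = r' then b else Rob.idle (p j) Light.off

/-- The configuration with `r` and `r'` at the given places and with the given lights, and all other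
robots at their places in `p`, with light `off`. -/
def duoConfig (p : Fin n → ℝ × ℝ) (r r' : Fin n) (P Q : ℝ × ℝ) (c c' : Light) : Config n :=
  ⟨fun j => if j = r then P else if j = r' then Q else p j,
    fun j => if j = r then c else if j = r' then c' else Light.off⟩

theorem config_duo (a b : Rob) :
    (duo p r r' a b).config = duoConfig p r r' a.pos b.pos a.light b.light := by
  simp only [St.config, duo, duoConfig, Config.mk.injEq]
  constructor <;> funext j <;> split_ifs <;> rfl

theorem duo_swap (h : r ≠ r') (a b : Rob) : duo p r r' a b = duo p r' r b a := by
  funext j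
  simp only [duo]
  split_ifs with h1 h2
  · exact absurd (h1.symm.trans h2) h
  all_goals rfl

theorem duoConfig_swap (h : r ≠ r') (P Q : ℝ × ℝ) (c c' : Light) :
    duoConfig p r r' P Q c c' = duoConfig p r' r Q P c' c := by
  simp only [duoConfig, Config.mk.injEq]
  constructor <;>
  · funext j
    split_ifs with h1 h2
    · exact absurd (h1.symm.trans h2) h
    all_goals rfl

@[simp] theorem duo_left (a b : Rob) : duo p r r' a b r = a := by simp [duo]

theorem duo_right (h : r ≠ r') (a b : Rob) : duo p r r' a b r' = b := by simp [duo, h.symm]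

theorem duo_other {j : Fin n} (h : j ≠ r) (h' : j ≠ r') (a b : Rob) :
    duo p r r' a b j = Rob.idle (p j) Light.off := by simp [duo, h, h']

theorem update_duo_left (a b a' : Rob) :
    Function.update (duo p r r' a b) r a' = duo p r r' a' b := by
  funext j
  by_cases h : j = r
  · subst h; simp
  · simp [duo, h]

theorem update_duo_right (h : r ≠ r') (a b b' : Rob) :
    Function.update (duo p r r' a b) r' b' = duo p r r' a b' := by
  rw [duo_swap h, update_duo_left, duo_swap h.symm]

/-- The terrain on which two robots `r` and `r'` act: the leftmost column of the other robots has
abscissa `X`. -/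
structure Terrain (p : Fin n → ℝ × ℝ) (r r' : Fin n) (X : ℝ) : Prop where
  ne : r ≠ r'
  inj : ∀ j k, j ≠ r → j ≠ r' → k ≠ r → k ≠ r' → p j = p k → j = k
  le : ∀ j, j ≠ r → j ≠ r' → X ≤ (p j).1
  ex : ∃ j, j ≠ r ∧ j ≠ r' ∧ (p j).1 = X

theorem Terrain.symm (T : Terrain p r r' X) : Terrain p r' r X where
  ne := T.ne.symm
  inj j k h1 h2 h3 h4 := T.inj j k h2 h1 h4 h3
  le j h1 h2 := T.le j h2 h1
  ex := by obtain ⟨j, h1, h2, h3⟩ := T.ex; exact ⟨j, h2, h1, h3⟩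

section Config

variable {P Q : ℝ × ℝ} {c c' : Light}

@[simp] theorem duoConfig_pos_left : (duoConfig p r r' P Q c c').pos r = P := by simp [duoConfig]

@[simp] theorem duoConfig_light_left : (duoConfig p r r' P Q c c').light r = c := by
  simp [duoConfig]

theorem duoConfig_pos_right (h : r ≠ r') : (duoConfig p r r' P Q c c').pos r' = Q := by
  simp [duoConfig, h.symm]

theorem duoConfig_light_right (h : r ≠ r') : (duoConfig p r r' P Q c c').light r' = c' := by
  simp [duoConfig, h.symm]

theorem duoConfig_pos_other {j : Fin n} (h : j ≠ r) (h' : j ≠ r') :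
    (duoConfig p r r' P Q c c').pos j = p j := by simp [duoConfig, h, h']

theorem duoConfig_light_other {j : Fin n} (h : j ≠ r) (h' : j ≠ r') :
    (duoConfig p r r' P Q c c').light j = Light.off := by simp [duoConfig, h, h']

theorem Terrain.injective (T : Terrain p r r' X) (hP : P.1 < X) (hQ : Q.1 < X) (hPQ : P ≠ Q) :
    Function.Injective (duoConfig p r r' P Q c c').pos := by
  intro j k h
  have h1 := T.le j
  have h2 := T.le k
  have h3 := T.inj j k
  simp only [duoConfig] at h
  split_ifs at h with h4 h5 h6 h7 h8 h9
  all_goals first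
    | (subst_vars; rfl)
    | (exact absurd h hPQ)
    | (exact absurd h.symm hPQ)
    | (subst h; exact absurd hP (not_lt.2 (by tauto)))
    | (subst h; exact absurd hQ (not_lt.2 (by tauto)))
    | (exact h3 (by tauto) (by tauto) (by tauto) (by tauto) h)

/-- The positions and lights of two active robots leave all other robots at rest. -/
structure Calm (p : Fin n → ℝ × ℝ) (r r' : Fin n) (X : ℝ) (P Q : ℝ × ℝ) (c c' : Light) :
    Prop where
  left : P.1 < X
  right : Q.1 < X
  ne : P ≠ Q
  hide : ∀ j, j ≠ r → j ≠ r' → (p j).1 = X → P ∉ segment ℝ (p j) Q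
  hide' : ∀ j, j ≠ r → j ≠ r' → (p j).1 = X → Q ∉ segment ℝ (p j) P
  light : c ≠ Light.leader
  light' : c' ≠ Light.leader
  sym : c = Light.symmetry → c' ≠ Light.symmetry

theorem Calm.symm (h : Calm p r r' X P Q c c') : Calm p r' r X Q P c' c where
  left := h.right
  right := h.left
  ne := h.ne.symm
  hide j h1 h2 := h.hide' j h2 h1
  hide' j h1 h2 := h.hide j h2 h1
  light := h.light'
  light' := h.light
  sym h1 h2 := h.sym h2 h1

theorem Calm.dark (h : Calm p r r' X P Q c c') : (duoConfig p r r' P Q c c').Dark := by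
  intro j
  simp only [duoConfig]
  split_ifs
  · exact h.light
  · exact h.light'
  · exact Light.noConfusion

/-- No other robot acts, because a candidate does not hide the other active robot and the robots of
the first column from any of them. -/
theorem Calm.dec_other (T : Terrain p r r' X) (h : Calm p r r' X P Q c c') {j : Fin n}
    (hj : j ≠ r) (hj' : j ≠ r') :
    dec stage2 F (duoConfig p r r' P Q c c') j = (Light.off, p j) := by
  have hC := T.injective (c := c) (c' := c') h.left h.right h.ne
  have hpj : (duoConfig p r r' P Q c c').pos j = p j := duoConfig_pos_other hj hj'
  have hlt : ((duoConfig p r r' P Q c c').pos r).1 < ((duoConfig p r r' P Q c c').pos j).1 := by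
    rw [hpj, duoConfig_pos_left]; exact h.left.trans_le (T.le j hj hj')
  have hlt' : ((duoConfig p r r' P Q c c').pos r').1 < ((duoConfig p r r' P Q c c').pos j).1 := by
    rw [hpj, duoConfig_pos_right T.ne]; exact h.right.trans_le (T.le j hj hj')
  have key := dec_off_stay (stage2 := stage2) (F := F) hC h.dark
    (duoConfig_light_other hj hj') hj.symm hlt.le ?_ ?_
  · rw [key, hpj]
  · rw [Config.leftMostTerminal_iff_of_lt hC hlt]
    rintro ⟨k, hk, hkx, hkc, hseg, -⟩
    -- the robot that hides all others cannot have a robot of the first column behind it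
    have hcol : ∀ R : ℝ × ℝ, R.1 < X → (∀ l, ((duoConfig p r r' P Q c c').pos l).1 <
        ((duoConfig p r r' P Q c c').pos j).1 →
        R ∈ segment ℝ ((duoConfig p r r' P Q c c').pos j) ((duoConfig p r r' P Q c c').pos l)) →
        (p j).1 = X := by
      intro R hR hall
      by_contra hne
      obtain ⟨t, ht, ht', htX⟩ := T.ex
      have h1 := T.le j hj hj'
      have h2 : X < (p j).1 := lt_of_le_of_ne h1 (Ne.symm hne)
      have h3 := hall t (by rwa [hpj, duoConfig_pos_other ht ht', htX])
      rw [hpj, duoConfig_pos_other ht ht'] at h3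
      obtain ⟨θ, h4, h5, hx, -⟩ := exists_of_mem_segment h3
      rw [htX] at hx
      nlinarith
    by_cases hkr : k = r
    · subst hkr
      rw [duoConfig_pos_left] at hseg
      have h1 := hcol P h.left hseg
      have h2 := hseg r' hlt'
      rw [hpj, duoConfig_pos_right T.ne] at h2
      exact h.hide j hj hj' h1 h2
    by_cases hkr' : k = r'
    · subst hkr'
      rw [duoConfig_pos_right T.ne] at hseg
      have h1 := hcol Q h.right hseg
      have h2 := hseg r hlt
      rw [hpj, duoConfig_pos_left] at h2
      exact h.hide' j hj hj' h1 h2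
    · rw [duoConfig_light_other hkr hkr'] at hkc
      exact Light.noConfusion hkc
  · intro k l _ _ hkl _ _ hk hl
    exfalso
    have h0 : ∀ m, (duoConfig p r r' P Q c c').light m = Light.symmetry → m = r ∨ m = r' := by
      intro m hm
      by_contra hne
      push Not at hne
      rw [duoConfig_light_other hne.1 hne.2] at hm
      exact Light.noConfusion hm
    have hr := T.ne
    rcases h0 k hk with rfl | rfl <;> rcases h0 l hl with rfl | rfl
    · exact hkl rfl
    · rw [duoConfig_light_left] at hk
      rw [duoConfig_light_right hr] at hl
      exact h.sym hk hl
    · rw [duoConfig_light_left] at hl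
      rw [duoConfig_light_right hr] at hk
      exact h.sym hl hk
    · exact hkl rfl

end Config

/-- A stage with two active robots, which the first of them leaves by its next snapshot. -/
theorem win_duo (T : Terrain p r r' X) (R : Rob → Rob → Prop)
    (hcalm : ∀ a b, R a b → Calm p r r' X a.pos b.pos a.light b.light)
    (hact : ∀ a b a', R a b → Act a a' → ¬ R a' b →
      Win (algorithm n stage2) F (duo p r r' a' b))
    (hact' : ∀ a b b', R a b → Act b b' → ¬ R a b' →
      Win (algorithm n stage2) F (duo p r r' a b'))
    (hlook : ∀ a b, R a b → a.pos = a.tgt → a.light = a.nl →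
      Win (algorithm n stage2) F (duo p r r'
        (a.plan (dec stage2 F (duoConfig p r r' a.pos b.pos a.light b.light) r)) b))
    (hlook' : ∀ a b, R a b → b.pos = b.tgt → b.light = b.nl →
      ¬ R a (b.plan (dec stage2 F (duoConfig p r r' a.pos b.pos a.light b.light) r')) →
      Win (algorithm n stage2) F (duo p r r' a
        (b.plan (dec stage2 F (duoConfig p r r' a.pos b.pos a.light b.light) r'))))
    {a b : Rob} (h : R a b) : Win (algorithm n stage2) F (duo p r r' a b) := by
  have hlk : ∀ a b s', R a b → Look (algorithm n stage2) F r (duo p r r' a b) s' →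
      Win (algorithm n stage2) F s' := by
    rintro a b s' hR ⟨h1, h2, -, rfl⟩
    rw [duo_left] at h1 h2
    rw [config_duo, duo_left, update_duo_left]
    exact hlook a b hR h1 h2
  refine Win.stage _ (fun s => ∃ a b, s = duo p r r' a b ∧ R a b) r ⟨a, b, rfl, h⟩ ?_ ?_ ?_
  · rintro s ⟨a, b, rfl, hR⟩
    rw [config_duo]
    exact (hcalm a b hR).dark
  · rintro s s' ⟨a, b, rfl, hR⟩ hstep hnot
    have hby : ∀ j, j ∉ ({r, r'} : Set (Fin n)) → ∃ q c, duo p r r' a b j = Rob.idle q c ∧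
        ((duo p r r' a b).config.Dark →
          decision (algorithm n stage2) F (duo p r r' a b).config j = (c, q)) := by
      intro j hj
      simp only [Set.mem_insert_iff, Set.mem_singleton_iff, not_or] at hj
      refine ⟨p j, Light.off, duo_other hj.1 hj.2 a b, fun _ => ?_⟩
      rw [config_duo]
      exact (hcalm a b hR).dec_other T hj.1 hj.2
    rcases hstep.active {r, r'} hby with rfl | ⟨i, hi, hlook1 | ⟨a', ha, rfl⟩⟩
    · exact absurd ⟨a, b, rfl, hR⟩ hnot
    · rcases hi with rfl | hi
      · exact hlk a b s' hR hlook1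
      · rw [Set.mem_singleton_iff] at hi
        subst hi
        obtain ⟨h1, h2, -, rfl⟩ := hlook1
        rw [duo_right T.ne] at h1 h2
        rw [config_duo, duo_right T.ne, update_duo_right T.ne] at hnot ⊢
        exact hlook' a b hR h1 h2 fun h => hnot ⟨_, _, rfl, h⟩
    · rcases hi with rfl | hi
      · rw [duo_left] at ha
        rw [update_duo_left] at hnot ⊢
        exact hact a b a' hR ha fun h => hnot ⟨_, _, rfl, h⟩
      · rw [Set.mem_singleton_iff] at hi
        subst hi
        rw [duo_right T.ne] at ha
        rw [update_duo_right T.ne] at hnot ⊢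
        exact hact' a b a' hR ha fun h => hnot ⟨_, _, rfl, h⟩
  · rintro s s' ⟨a, b, rfl, hR⟩ hlook1
    exact hlk a b s' hR hlook1

/-- A stage with two active robots, which the second of them leaves by its next snapshot. -/
theorem win_duo_right (T : Terrain p r r' X) (R : Rob → Rob → Prop)
    (hcalm : ∀ a b, R a b → Calm p r r' X a.pos b.pos a.light b.light)
    (hact : ∀ a b a', R a b → Act a a' → ¬ R a' b →
      Win (algorithm n stage2) F (duo p r r' a' b))
    (hact' : ∀ a b b', R a b → Act b b' → ¬ R a b' →
      Win (algorithm n stage2) F (duo p r r' a b'))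
    (hlook' : ∀ a b, R a b → b.pos = b.tgt → b.light = b.nl →
      Win (algorithm n stage2) F (duo p r r' a
        (b.plan (dec stage2 F (duoConfig p r r' a.pos b.pos a.light b.light) r'))))
    (hlook : ∀ a b, R a b → a.pos = a.tgt → a.light = a.nl →
      ¬ R (a.plan (dec stage2 F (duoConfig p r r' a.pos b.pos a.light b.light) r)) b →
      Win (algorithm n stage2) F (duo p r r'
        (a.plan (dec stage2 F (duoConfig p r r' a.pos b.pos a.light b.light) r)) b))
    {a b : Rob} (h : R a b) : Win (algorithm n stage2) F (duo p r r' a b) := by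
  rw [duo_swap T.ne]
  refine win_duo T.symm (fun b a => R a b) (fun b a h => (hcalm a b h).symm) ?_ ?_ ?_ ?_ h
  · intro b a b' h1 h2 h3
    rw [duo_swap T.symm.ne]
    exact hact' a b b' h1 h2 h3
  · intro b a a' h1 h2 h3
    rw [duo_swap T.symm.ne]
    exact hact a b a' h1 h2 h3
  · intro b a h1 h2 h3
    rw [duo_swap T.symm.ne, duoConfig_swap T.symm.ne]
    exact hlook' a b h1 h2 h3
  · intro b a h1 h2 h3 h4
    rw [duoConfig_swap T.symm.ne] at h4 ⊢
    rw [duo_swap T.symm.ne]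
    exact hlook a b h1 h2 h3 h4

/-! ### Two candidates at different abscissas -/

/-- The robot `r` heads to the left and downwards, `r'` heads to the right and upwards (`τ = ± 1`
orients the vertical axis). The last condition prevents `r'` from hiding `r` from the robots of
the first column; as it involves the abscissas of the destinations, but the present ordinates,
it persists when the robots move on. -/
structure Apart (p : Fin n → ℝ × ℝ) (r r' : Fin n) (X τ : ℝ) (a b : Rob) : Prop where
  le : a.pos.1 ≤ b.pos.1
  left : a.tgt.1 ≤ a.pos.1
  right : b.pos.1 ≤ b.tgt.1
  lt : b.tgt.1 < X
  down : τ * a.tgt.2 ≤ τ * a.pos.2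
  below : τ * a.pos.2 < τ * b.pos.2
  up : τ * b.pos.2 ≤ τ * b.tgt.2
  hide : ∀ j, j ≠ r → j ≠ r' → (p j).1 = X → (b.tgt.1 - a.tgt.1) * (τ * ((p j).2 - b.pos.2)) <
    (X - b.tgt.1) * (τ * (b.pos.2 - a.pos.2))

namespace Apart

variable {τ : ℝ} {a b a' b' : Rob}

theorem act_left (h : Apart p r r' X τ a b) (ha : Act a a') : Apart p r r' X τ a' b := by
  cases ha with
  | color => exact ⟨h.1, h.2, h.3, h.4, h.5, h.6, h.7, h.8⟩
  | move q hl hq =>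
    obtain ⟨θ, h0, h1, hx, hy⟩ := exists_of_mem_segment hq
    have h2 := h.left
    have h3 := h.down
    have h4 : q.1 ≤ a.pos.1 := by nlinarith
    have h5 : τ * q.2 = τ * a.pos.2 + θ * (τ * a.tgt.2 - τ * a.pos.2) := by rw [hy]; ring
    have h6 : τ * q.2 ≤ τ * a.pos.2 := by nlinarith
    refine ⟨h4.trans h.le, by simp only; nlinarith, h.right, h.lt, by simp only; nlinarith,
      h6.trans_lt h.below, h.up, fun j hj hj' hX => (h.hide j hj hj' hX).trans_le ?_⟩
    exact mul_le_mul_of_nonneg_left (by simp only; linarith) (by linarith [h.lt])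

theorem act_right (h : Apart p r r' X τ a b) (hb : Act b b') : Apart p r r' X τ a b' := by
  cases hb with
  | color => exact ⟨h.1, h.2, h.3, h.4, h.5, h.6, h.7, h.8⟩
  | move q hl hq =>
    obtain ⟨θ, h0, h1, hx, hy⟩ := exists_of_mem_segment hq
    have h2 := h.right
    have h3 := h.up
    have h4 : b.pos.1 ≤ q.1 := by nlinarith
    have h5 : τ * q.2 = τ * b.pos.2 + θ * (τ * b.tgt.2 - τ * b.pos.2) := by rw [hy]; ring
    have h6 : τ * b.pos.2 ≤ τ * q.2 := by nlinarith
    refine ⟨h.le.trans h4, h.left, by simp only; nlinarith, h.lt, h.down,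
      h.below.trans_le h6, by simp only; nlinarith, fun j hj hj' hX => ?_⟩
    refine lt_of_le_of_lt ?_ ((h.hide j hj hj' hX).trans_le ?_)
    · exact mul_le_mul_of_nonneg_left (by simp only; linarith)
        (by linarith [h.lt, h.le, h.left])
    · exact mul_le_mul_of_nonneg_left (by simp only; linarith) (by linarith [h.lt])

theorem calm (h : Apart p r r' X τ a b) (ha : a.light ≠ Light.leader) (hb : b.light ≠ Light.leader)
    (hs : a.light ≠ Light.symmetry) : Calm p r r' X a.pos b.pos a.light b.light where
  left := by linarith [h.le, h.right, h.lt]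
  right := by linarith [h.right, h.lt]
  ne heq := by have := h.below; rw [heq] at this; exact lt_irrefl _ this
  hide j hj hj' hX hseg := by
    obtain ⟨θ, h0, h1, hx, hy⟩ := exists_of_mem_segment hseg
    have h2 := h.below
    have h3 := h.le
    have h4 := h.right.trans_lt h.lt
    rw [hX] at hx
    have : θ = 1 := by nlinarith
    subst this
    rw [show a.pos.2 = b.pos.2 by linarith] at h2
    exact lt_irrefl _ h2
  hide' j hj hj' hX hseg := by
    obtain ⟨θ, h0, h1, hx, hy⟩ := exists_of_mem_segment hseg
    have h2 := h.hide j hj hj' hX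
    have h3 := h.below
    have h4 := h.right.trans_lt h.lt
    rw [hX] at hx
    have key : (b.pos.1 - a.pos.1) * (τ * ((p j).2 - b.pos.2)) =
        (X - b.pos.1) * (τ * (b.pos.2 - a.pos.2)) := by rw [hx, hy]; ring
    have h5 : 0 < τ * (b.pos.2 - a.pos.2) := by linarith
    rcases le_total (τ * ((p j).2 - b.pos.2)) 0 with h6 | h6
    · have h7 := mul_pos (sub_pos.2 h4) h5
      have h8 := mul_nonneg (sub_nonneg.2 h.le) (neg_nonneg.2 h6)
      linarith
    · have h7 : (b.pos.1 - a.pos.1) * (τ * ((p j).2 - b.pos.2)) ≤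
        (b.tgt.1 - a.tgt.1) * (τ * ((p j).2 - b.pos.2)) :=
        mul_le_mul_of_nonneg_right (by linarith [h.left, h.right]) h6
      have h8 : (X - b.tgt.1) * (τ * (b.pos.2 - a.pos.2)) ≤
        (X - b.pos.1) * (τ * (b.pos.2 - a.pos.2)) :=
        mul_le_mul_of_nonneg_right (by linarith [h.right]) h5.le
      linarith
  light := ha
  light' := hb
  sym hc := absurd hc hs

/-- A snapshot after which the right robot stays. -/
theorem plan_right (h : Apart p r r' X τ a b) (hb : b.pos = b.tgt) (c : Light) :
    Apart p r r' X τ a (b.plan (c, b.pos)) := by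
  refine ⟨h.le, h.left, le_rfl, ?_, h.down, h.below, le_rfl, ?_⟩
  · simp only [Rob.plan, hb]; exact h.lt
  · have := h.hide
    rw [← hb] at this
    exact this

end Apart

section Separate

variable {τ : ℝ} {a b : Rob}

/-- Two robots at different abscissas, none of them with light `symmetry`, do not start the second
phase. -/
theorem separate_lights {P Q : ℝ × ℝ} {c c' : Light} (hPQ : P.1 ≠ Q.1)
    (hs : c ≠ Light.symmetry) (hs' : c' ≠ Light.symmetry) (hne : r ≠ r') :
    (∀ j, (duoConfig p r r' P Q c c').light j ≠ Light.symmetry) ∧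
    (∀ j k, j ≠ k → ((duoConfig p r r' P Q c c').pos j).1 =
      ((duoConfig p r r' P Q c c').pos k).1 →
      (duoConfig p r r' P Q c c').light j = Light.candidate →
      (duoConfig p r r' P Q c c').light k ≠ Light.candidate) := by
  constructor
  · intro j
    simp only [duoConfig]
    split_ifs
    · exact hs
    · exact hs'
    · exact Light.noConfusion
  · intro j k hjk hx hj hk
    have h0 : ∀ m, (duoConfig p r r' P Q c c').light m = Light.candidate → m = r ∨ m = r' := by
      intro m hm
      by_contra hne
      push Not at hne
      rw [duoConfig_light_other hne.1 hne.2] at hm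
      exact Light.noConfusion hm
    rcases h0 j hj with rfl | rfl <;> rcases h0 k hk with rfl | rfl
    · exact hjk rfl
    · rw [duoConfig_pos_left, duoConfig_pos_right hne] at hx
      exact hPQ hx
    · rw [duoConfig_pos_left, duoConfig_pos_right hne] at hx
      exact hPQ hx.symm
    · exact hjk rfl

theorem duo_visible {P Q : ℝ × ℝ} {c c' : Light} (T : Terrain p r r' X)
    (hPQ : P.1 < Q.1) (hQ : Q.1 < X) : (duoConfig p r r' P Q c c').Visible r r' := by
  refine Config.visible_of_lt (T.injective (hPQ.trans hQ) hQ fun h => by simp [h] at hPQ) ?_ ?_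
  · rwa [duoConfig_pos_left, duoConfig_pos_right T.ne]
  · intro k hk hk'
    right
    rw [duoConfig_pos_right T.ne, duoConfig_pos_other hk hk']
    exact hQ.le.trans (T.le k hk hk')

/-- The left one of two separated robots, once its light is `off`, waits. -/
theorem dec_wait {P Q : ℝ × ℝ} (T : Terrain p r r' X) (hPQ : P.1 < Q.1) (hQ : Q.1 < X)
    (hd : (duoConfig p r r' P Q Light.off Light.candidate).Dark) :
    dec stage2 F (duoConfig p r r' P Q Light.off Light.candidate) r = (Light.off, P) := by
  have hsep := separate_lights (p := p) (c := Light.off) (c' := Light.candidate) hPQ.ne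
    Light.noConfusion Light.noConfusion T.ne
  have := dec_of_stay (stage2 := stage2) (F := F) (i := r)
    (C := duoConfig p r r' P Q Light.off Light.candidate) ?_
  · rw [this, duoConfig_pos_left, duoConfig_light_left]
  · have hl : (duoConfig p r r' P Q Light.off Light.candidate).light r = Light.off :=
      duoConfig_light_left
    rw [algorithm_phase1 hd hsep.1 hsep.2, phase1_off hl, if_pos, if_neg]
    · intro hall
      have := hall _ (Config.mem_all.2 ⟨r', Or.inr (duo_visible T hPQ hQ), rfl⟩)
      rw [Config.sighting_light, duoConfig_light_right T.ne] at this
      exact Light.noConfusion this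
    · intro q hq
      obtain ⟨j, hj, rfl⟩ := Config.mem_others.1 hq
      rw [Config.sighting_x_pos, duoConfig_pos_left]
      by_cases hj' : j = r'
      · subst hj'; rwa [duoConfig_pos_right T.ne]
      · rw [duoConfig_pos_other hj.1 hj']
        exact (hPQ.trans hQ).trans_le (T.le j hj.1 hj')

/-- The left robot is `off`, the right one has decided to switch off. -/
theorem win_of_switching (T : Terrain p r r' X) {P Q : ℝ × ℝ} (hPQ : P.1 < Q.1) (hQ : Q.1 < X)
    (hcalm : Calm p r r' X P Q Light.off Light.candidate) :
    Win (algorithm n stage2) F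
      (duo p r r' (Rob.idle P Light.off) ⟨Q, Q, Q, Light.candidate, Light.off⟩) := by
  refine win_duo_right T (fun a b => a = Rob.idle P Light.off ∧
    b = ⟨Q, Q, Q, Light.candidate, Light.off⟩) ?_ ?_ ?_ ?_ ?_ ⟨rfl, rfl⟩
  · rintro a b ⟨rfl, rfl⟩
    exact hcalm
  · rintro a b a' ⟨rfl, rfl⟩ hact hnot
    exact absurd ⟨idle_act hact, rfl⟩ hnot
  · rintro a b b' ⟨rfl, rfl⟩ hact -
    cases hact with
    | color =>
      refine win_of_leftmost (l := r) (q := fun j => if j = r' then Q else p j) ?_ ?_ ?_ ?_ ?_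
      · intro j k hj hk h
        have := @Terrain.injective _ _ _ _ _ P Q Light.off Light.off T (hPQ.trans hQ) hQ
          (fun h => by simp [h] at hPQ) j k
        simp only [duoConfig, if_neg hj, if_neg hk] at this
        exact this h
      · intro j hj
        simp only [duo, if_neg hj]
        split_ifs <;> rfl
      · rw [duo_left]; rfl
      · rw [duo_left]; rfl
      · intro j hj
        rw [duo_left]
        split_ifs with hj'
        · exact ⟨hPQ, hPQ⟩
        · exact ⟨(hPQ.trans hQ).trans_le (T.le j hj hj'), (hPQ.trans hQ).trans_le (T.le j hj hj')⟩
    | move q h => exact Light.noConfusion h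
  · rintro a b ⟨rfl, rfl⟩ - h
    exact Light.noConfusion h
  · rintro a b ⟨rfl, rfl⟩ - - hnot
    refine absurd ⟨?_, rfl⟩ hnot
    exact congrArg (Rob.plan _) (dec_wait T hPQ hQ hcalm.dark)

/-- The left robot is `off`, the right one is still a candidate. -/
theorem win_of_left_off (T : Terrain p r r' X) {P : ℝ × ℝ}
    (h : Apart p r r' X τ (Rob.idle P Light.off) b) (hlt : P.1 < b.pos.1)
    (hb : b.light = Light.candidate) (hb' : b.nl = Light.candidate) :
    Win (algorithm n stage2) F (duo p r r' (Rob.idle P Light.off) b) := by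
  have hcalm : ∀ b : Rob, Apart p r r' X τ (Rob.idle P Light.off) b →
      b.light = Light.candidate → Calm p r r' X P b.pos Light.off Light.candidate := by
    intro b h hb
    have := h.calm Light.noConfusion (by rw [hb]; exact Light.noConfusion) Light.noConfusion
    rw [hb] at this
    exact this
  refine win_duo_right T (fun a b => a = Rob.idle P Light.off ∧
    Apart p r r' X τ a b ∧ P.1 < b.pos.1 ∧ b.light = Light.candidate ∧ b.nl = Light.candidate)
    ?_ ?_ ?_ ?_ ?_ ⟨rfl, h, hlt, hb, hb'⟩
  · rintro a b ⟨rfl, h, hlt, hb, hb'⟩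
    rw [hb]
    exact hcalm b h hb
  · rintro a b a' ⟨rfl, h, hlt, hb, hb'⟩ hact hnot
    obtain rfl := idle_act hact
    exact absurd ⟨rfl, h, hlt, hb, hb'⟩ hnot
  · rintro a b b' ⟨rfl, h, hlt, hb, hb'⟩ hact hnot
    refine absurd ⟨rfl, h.act_right hact, ?_⟩ hnot
    cases hact with
    | color => exact ⟨hlt, hb', hb'⟩
    | move q h1 hq =>
      obtain ⟨θ, h0, h1, hx, -⟩ := exists_of_mem_segment hq
      have := h.right
      exact ⟨by simp only; nlinarith, hb, hb'⟩
  · rintro a b ⟨rfl, h, hlt, hb, hb'⟩ hpt -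
    have hQ : b.pos.1 < X := h.right.trans_lt h.lt
    have hc := hcalm b h hb
    have hsep := separate_lights (p := p) (c := Light.off) (c' := Light.candidate) hlt.ne
      Light.noConfusion Light.noConfusion T.ne
    have key := dec_candidate_of_visible_left (stage2 := stage2) (F := F) (i := r') (j := r)
      hc.dark hsep.1 hsep.2 (duoConfig_light_right T.ne) (duo_visible T hlt hQ).symm
      (by rwa [duoConfig_pos_left, duoConfig_pos_right T.ne]) duoConfig_light_left
    rw [duoConfig_pos_right T.ne, ← hb] at key
    rw [show dec stage2 F (duoConfig p r r' (Rob.idle P Light.off).pos b.pos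
      (Rob.idle P Light.off).light b.light) r' = (Light.off, b.pos) from key]
    simp only [Rob.plan, hb]
    exact win_of_switching T hlt hQ hc
  · rintro a b ⟨rfl, h, hlt, hb, hb'⟩ - - hnot
    have heq : (Rob.idle P Light.off).plan (dec stage2 F (duoConfig p r r'
        (Rob.idle P Light.off).pos b.pos (Rob.idle P Light.off).light b.light) r) =
        Rob.idle P Light.off := by
      rw [hb]
      exact congrArg (Rob.plan _) (dec_wait T hlt (h.right.trans_lt h.lt) (hcalm b h hb).dark)
    exact absurd ⟨heq, heq.symm ▸ h, hlt, hb, hb'⟩ hnot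

/-- The decision of the right one of two separated robots, as long as the left one is a
candidate. -/
theorem dec_right_stay (T : Terrain p r r' X) {P Q : ℝ × ℝ} (hPQ : P.1 < Q.1) (hQ : Q.1 < X)
    (hd : (duoConfig p r r' P Q Light.candidate Light.candidate).Dark) :
    dec stage2 F (duoConfig p r r' P Q Light.candidate Light.candidate) r' =
      (Light.candidate, Q) := by
  have hsep := separate_lights (p := p) (c := Light.candidate) (c' := Light.candidate) hPQ.ne
    Light.noConfusion Light.noConfusion T.ne
  have key := dec_candidate_stay (stage2 := stage2) (F := F) (i := r')
    hd hsep.1 hsep.2 (duoConfig_light_right T.ne) ?_ ?_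
  · rw [key, duoConfig_pos_right T.ne]
  · intro j hj hjc
    rw [duoConfig_pos_right T.ne] at hj
    by_cases hr : j = r
    · subst hr
      rw [duoConfig_pos_left] at hj
      exact lt_asymm hj hPQ
    by_cases hr' : j = r'
    · subst hr'
      rw [duoConfig_pos_right T.ne] at hj
      exact lt_irrefl _ hj
    rw [duoConfig_light_other hr hr'] at hjc
    exact Light.noConfusion hjc
  · intro j hj hjc
    rw [duoConfig_pos_right T.ne] at hj
    by_cases hr : j = r
    · subst hr
      rw [duoConfig_light_left] at hjc
      exact Light.noConfusion hjc
    by_cases hr' : j = r'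
    · subst hr'
      rw [duoConfig_pos_right T.ne] at hj
      exact lt_irrefl _ hj
    rw [duoConfig_pos_other hr hr'] at hj
    exact absurd hj (not_lt.2 (hQ.le.trans (T.le j hr hr')))

/-- The left robot has decided to switch off. -/
theorem win_of_left_switching (T : Terrain p r r' X) {P : ℝ × ℝ}
    (h : Apart p r r' X τ ⟨P, P, P, Light.candidate, Light.off⟩ b) (hlt : P.1 < b.pos.1)
    (hb : b.light = Light.candidate) (hb' : b.nl = Light.candidate) :
    Win (algorithm n stage2) F (duo p r r' ⟨P, P, P, Light.candidate, Light.off⟩ b) := by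
  have hcalm : ∀ b : Rob, Apart p r r' X τ ⟨P, P, P, Light.candidate, Light.off⟩ b →
      b.light = Light.candidate → Calm p r r' X P b.pos Light.candidate b.light := fun b h hb =>
    h.calm Light.noConfusion (by rw [hb]; exact Light.noConfusion) Light.noConfusion
  refine win_duo T (fun a b => a = ⟨P, P, P, Light.candidate, Light.off⟩ ∧
    Apart p r r' X τ a b ∧ P.1 < b.pos.1 ∧ b.light = Light.candidate ∧ b.nl = Light.candidate)
    ?_ ?_ ?_ ?_ ?_ ⟨rfl, h, hlt, hb, hb'⟩
  · rintro a b ⟨rfl, h, hlt, hb, hb'⟩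
    exact hcalm b h hb
  · rintro a b a' ⟨rfl, h, hlt, hb, hb'⟩ hact hnot
    cases hact with
    | color =>
      have := h.act_left (Act.color _)
      exact win_of_left_off T (P := P) ⟨this.1, this.2, this.3, this.4, this.5, this.6, this.7,
        this.8⟩ hlt hb hb'
    | move q h => exact Light.noConfusion h
  · rintro a b b' ⟨rfl, h, hlt, hb, hb'⟩ hact hnot
    refine absurd ⟨rfl, h.act_right hact, ?_⟩ hnot
    cases hact with
    | color => exact ⟨hlt, hb', hb'⟩
    | move q h1 hq =>
      obtain ⟨θ, h0, h1, hx, -⟩ := exists_of_mem_segment hq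
      have := h.right
      exact ⟨by simp only; nlinarith, hb, hb'⟩
  · rintro a b ⟨rfl, h, hlt, hb, hb'⟩ - hl
    exact Light.noConfusion hl
  · rintro a b ⟨rfl, h, hlt, hb, hb'⟩ hpt - hnot
    have hQ : b.pos.1 < X := h.right.trans_lt h.lt
    have hc := hcalm b h hb
    rw [hb] at hnot hc
    rw [dec_right_stay T hlt hQ hc.dark] at hnot
    exact absurd ⟨rfl, h.plan_right hpt _, hlt, hb, rfl⟩ hnot

/-- Two candidates at different abscissas. -/
theorem win_of_apart (T : Terrain p r r' X)
    (h : Apart p r r' X τ a b) (hlt : a.pos.1 < b.pos.1)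
    (ha : a.light = Light.candidate) (ha' : a.nl = Light.candidate)
    (hb : b.light = Light.candidate) (hb' : b.nl = Light.candidate) :
    Win (algorithm n stage2) F (duo p r r' a b) := by
  have hcalm : ∀ a b : Rob, Apart p r r' X τ a b → a.light = Light.candidate →
      b.light = Light.candidate → Calm p r r' X a.pos b.pos a.light b.light :=
    fun a b h ha hb => h.calm (by rw [ha]; exact Light.noConfusion)
      (by rw [hb]; exact Light.noConfusion) (by rw [ha]; exact Light.noConfusion)
  refine win_duo T (fun a b => Apart p r r' X τ a b ∧ a.pos.1 < b.pos.1 ∧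
    a.light = Light.candidate ∧ a.nl = Light.candidate ∧
    b.light = Light.candidate ∧ b.nl = Light.candidate)
    ?_ ?_ ?_ ?_ ?_ ⟨h, hlt, ha, ha', hb, hb'⟩
  · rintro a b ⟨h, hlt, ha, ha', hb, hb'⟩
    exact hcalm a b h ha hb
  · rintro a b a' ⟨h, hlt, ha, ha', hb, hb'⟩ hact hnot
    refine absurd ⟨h.act_left hact, ?_⟩ hnot
    cases hact with
    | color => exact ⟨hlt, ha', ha', hb, hb'⟩
    | move q h1 hq =>
      obtain ⟨θ, h0, h1, hx, -⟩ := exists_of_mem_segment hq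
      have := h.left
      exact ⟨by simp only; nlinarith, ha, ha', hb, hb'⟩
  · rintro a b b' ⟨h, hlt, ha, ha', hb, hb'⟩ hact hnot
    refine absurd ⟨h.act_right hact, ?_⟩ hnot
    cases hact with
    | color => exact ⟨hlt, ha, ha', hb', hb'⟩
    | move q h1 hq =>
      obtain ⟨θ, h0, h1, hx, -⟩ := exists_of_mem_segment hq
      have := h.right
      exact ⟨by simp only; nlinarith, ha, ha', hb, hb'⟩
  · rintro a b ⟨h, hlt, ha, ha', hb, hb'⟩ hpt -
    have hQ : b.pos.1 < X := h.right.trans_lt h.lt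
    have hc := hcalm a b h ha hb
    rw [ha, hb] at hc ⊢
    have hsep := separate_lights (p := p) (c := Light.candidate) (c' := Light.candidate) hlt.ne
      Light.noConfusion Light.noConfusion T.ne
    have key := dec_candidate_of_visible_right (stage2 := stage2) (F := F) (i := r) (j := r')
      hc.dark hsep.1 hsep.2 duoConfig_light_left (duo_visible T hlt hQ)
      (by rwa [duoConfig_pos_left, duoConfig_pos_right T.ne]) (duoConfig_light_right T.ne)
    rw [duoConfig_pos_left] at key
    rw [key]
    simp only [Rob.plan, ha]
    have h8 := h.hide
    refine win_of_left_switching (τ := τ) T ⟨h.le, le_rfl, h.right, h.lt, le_rfl, h.below, h.up,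
      ?_⟩ hlt hb hb'
    rw [← hpt] at h8
    exact h8
  · rintro a b ⟨h, hlt, ha, ha', hb, hb'⟩ hpt - hnot
    have hQ : b.pos.1 < X := h.right.trans_lt h.lt
    have hc := hcalm a b h ha hb
    rw [ha, hb] at hnot hc
    rw [dec_right_stay T hlt hQ hc.dark] at hnot
    exact absurd ⟨h.plan_right hpt _, hlt, rfl, ha', hb, rfl⟩ hnot

end Separate

end Duo

/-! ### The lexicographic comparison -/

theorem Prec.irrefl {l : List (ℝ ×ₗ ℝ)} : ¬ Prec l l := lt_irrefl _

theorem Prec.asymm {l l' : List (ℝ ×ₗ ℝ)} (h : Prec l l') : ¬ Prec l' l := by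
  unfold Prec at h ⊢
  rw [max_comm]
  exact lt_asymm h

theorem pad_eq (m : ℕ) (l : List (ℝ ×ₗ ℝ)) : pad m l =
    l.map (WithTop.some : ℝ ×ₗ ℝ → WithTop (ℝ ×ₗ ℝ)) ++ List.replicate (m - l.length) ⊤ := by
  unfold pad
  rw [List.map_id', List.map_eq_flatMap]
  rfl

theorem filterMap_pad (m : ℕ) (l : List (ℝ ×ₗ ℝ)) :
    (pad m l).filterMap (fun x : WithTop (ℝ ×ₗ ℝ) =>
      WithTop.recTopCoe (C := fun _ => Option (ℝ ×ₗ ℝ)) none some x) = l := by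
  rw [pad_eq, List.filterMap_append, List.filterMap_map]
  have h1 : (fun x : WithTop (ℝ ×ₗ ℝ) =>
      WithTop.recTopCoe (C := fun _ => Option (ℝ ×ₗ ℝ)) none some x) ∘
      (WithTop.some : ℝ ×ₗ ℝ → WithTop (ℝ ×ₗ ℝ)) = some := rfl
  have h2 : ∀ k : ℕ, (List.replicate k (⊤ : WithTop (ℝ ×ₗ ℝ))).filterMap (fun x =>
      WithTop.recTopCoe (C := fun _ => Option (ℝ ×ₗ ℝ)) none some x) = [] := by
    intro k
    induction k with
    | zero => rfl
    | succ k ih => rw [List.replicate_succ, List.filterMap_cons]; exact ih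
  rw [h1, h2, List.filterMap_some, List.append_nil]

theorem prec_trichotomy (l l' : List (ℝ ×ₗ ℝ)) : Prec l l' ∨ l = l' ∨ Prec l' l := by
  unfold Prec
  rcases lt_trichotomy (pad (max l.length l'.length) l) (pad (max l.length l'.length) l') with
    h | h | h
  · exact Or.inl h
  · refine Or.inr (Or.inl ?_)
    rw [← filterMap_pad (max l.length l'.length) l, h, filterMap_pad]
  · rw [max_comm l'.length]
    exact Or.inr (Or.inr h)

theorem list_map_lt_map {α β : Type*} [LinearOrder α] [LinearOrder β] {f : α → β}
    (hf : StrictMono f) (l l' : List α) : l.map f < l'.map f ↔ l < l' := by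
  induction l generalizing l' with
  | nil => cases l' <;> simp
  | cons a l ih =>
    cases l' with
    | nil => simp
    | cons b l' => simp [List.cons_lt_cons_iff, ih, hf.lt_iff_lt, hf.injective.eq_iff]

theorem prec_map {f : ℝ ×ₗ ℝ → ℝ ×ₗ ℝ} (hf : StrictMono f) (l l' : List (ℝ ×ₗ ℝ)) :
    Prec (l.map f) (l'.map f) ↔ Prec l l' := by
  have hpad : ∀ (m : ℕ) l, pad m (l.map f) = (pad m l).map (WithTop.map f) := by
    intro m l
    rw [pad_eq, pad_eq, List.map_append, List.map_map, List.map_map, List.map_replicate, List.length_map]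
    rfl
  unfold Prec
  rw [List.length_map, List.length_map, hpad, hpad]
  exact list_map_lt_map (WithTop.strictMono_map_iff.2 hf) _ _

/-- Rescaling of both coordinates. -/
def rescale (u : ℝ) (a : ℝ ×ₗ ℝ) : ℝ ×ₗ ℝ := toLex ((ofLex a).1 / u, (ofLex a).2 / u)

theorem rescale_strictMono {u : ℝ} (hu : 0 < u) : StrictMono (rescale u) := by
  intro a b h
  rw [Prod.Lex.lt_iff] at h
  rw [rescale, rescale, Prod.Lex.toLex_lt_toLex]
  rcases h with h | ⟨h1, h2⟩
  · exact Or.inl (div_lt_div_of_pos_right h hu)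
  · exact Or.inr ⟨by rw [h1], div_lt_div_of_pos_right h2 hu⟩

theorem sort_image_rescale {u : ℝ} (hu : 0 < u) (S : Finset (ℝ ×ₗ ℝ)) :
    (S.image (rescale u)).sort (· ≤ ·) = (S.sort (· ≤ ·)).map (rescale u) := by
  have h1 := (S.sortedLT_sort).pairwise
  refine List.Pairwise.eq_of_mem_iff (r := (· < ·)) ?_ ?_ ?_
  · exact ((S.image (rescale u)).sortedLT_sort).pairwise
  · exact h1.map _ fun a b h => rescale_strictMono hu h
  · intro a
    simp

theorem firstColumn_sort (S : Finset (ℝ ×ₗ ℝ)) :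
    firstColumn (S.sort (· ≤ ·)) = (S.filter fun a => (ofLex a).1 = 0).sort (· ≤ ·) := by
  refine List.Pairwise.eq_of_mem_iff (r := (· < ·)) ?_ ?_ ?_
  · exact (S.sortedLT_sort).pairwise.filter _
  · exact ((S.filter fun a => (ofLex a).1 = 0).sortedLT_sort).pairwise
  · intro a
    simp [firstColumn]

theorem firstColumn_map_rescale {u : ℝ} (hu : 0 < u) (l : List (ℝ ×ₗ ℝ)) :
    firstColumn (l.map (rescale u)) = (firstColumn l).map (rescale u) := by
  unfold firstColumn
  rw [List.filter_map]
  congr 1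
  refine List.filter_congr fun a _ => ?_
  simp [rescale, hu.ne']

/-! ### Decisions of the candidates in the second phase -/

/-- The coordinate system with the unit of `f` and the orientation `τ` of the vertical axis. -/
def Frame.orient (f : Frame) (τ : ℝ) (hτ : τ = 1 ∨ τ = -1) : Frame := ⟨f.unit, f.unit_pos, τ, hτ⟩

section Terrain

variable {n : ℕ} (p : Fin n → ℝ × ℝ) (r r' : Fin n) (X : ℝ)

/-- The robots of the leftmost column besides `r` and `r'`. -/
def column : Finset (Fin n) := Finset.univ.filter fun j => (j ≠ r ∧ j ≠ r') ∧ (p j).1 = X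

/-- The mean ordinate of the leftmost column. -/
def midline : ℝ := (∑ j ∈ column p r r' X, (p j).2) / ((column p r r' X).card : ℝ)

/-- The positions on the side `ε = ± 1` of the midline. -/
def sideSet (ε : ℝ) : Finset (ℝ ×ₗ ℝ) :=
  (Finset.univ.filter fun j => (j ≠ r ∧ j ≠ r') ∧ 0 < ε * ((p j).2 - midline p r r' X)).image
    fun j => toLex ((p j).1 - X, |(p j).2 - midline p r r' X|)

/-- The sorted list of the positions on the side `ε = ± 1` of the midline. -/
def sideList (ε : ℝ) : List (ℝ ×ₗ ℝ) := (sideSet p r r' X ε).sort (· ≤ ·)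

theorem column_swap : column p r' r X = column p r r' X := by
  ext j; simp [column, and_comm]

theorem midline_swap : midline p r' r X = midline p r r' X := by
  rw [midline, midline, column_swap]

theorem sideList_swap (ε : ℝ) : sideList p r' r X ε = sideList p r r' X ε := by
  have : sideSet p r' r X ε = sideSet p r r' X ε := by
    rw [sideSet, sideSet, midline_swap]
    congr 1
    ext j; simp [and_comm]
  rw [sideList, this, sideList]

/-- At height `h` on the vertical line of abscissa `x₀`, a robot sees all robots (other than the
two on this line), and none of them is beyond it in the direction `-τ`. -/
def Exposed (x₀ τ h : ℝ) : Prop :=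
  (∀ j, j ≠ r → j ≠ r' → ∀ k, k ≠ r → k ≠ r' → k ≠ j → p k ∉ segment ℝ (x₀, h) (p j)) ∧
    ∀ j, j ≠ r → j ≠ r' → 0 ≤ τ * ((p j).2 - h)

end Terrain

theorem exposed_swap {n : ℕ} {p : Fin n → ℝ × ℝ} {r r' : Fin n} {x₀ τ h : ℝ} :
    Exposed p r' r x₀ τ h ↔ Exposed p r r' x₀ τ h := by
  unfold Exposed
  constructor <;> exact fun H => ⟨fun j h1 h2 k h3 h4 => H.1 j h2 h1 k h4 h3,
    fun j h1 h2 => H.2 j h2 h1⟩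

section Rule

variable {n : ℕ} {stage2 : Snapshot → Action} {F : Fin n → Frame}
  {p : Fin n → ℝ × ℝ} {r r' : Fin n} {X x₀ h h' τ : ℝ} {c' : Light}

/-- The two robots on a common vertical line, the first being a candidate. -/
abbrev pairConfig (p : Fin n → ℝ × ℝ) (r r' : Fin n) (x₀ h h' : ℝ) (c' : Light) : Config n :=
  duoConfig p r r' (x₀, h) (x₀, h') Light.candidate c'

theorem pair_injective (T : Terrain p r r' X) (hx : x₀ < X) (hh : 0 < τ * (h' - h)) :
    Function.Injective (pairConfig p r r' x₀ h h' c').pos :=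
  T.injective hx hx fun heq => by
    rw [Prod.mk.injEq] at heq
    rw [heq.2] at hh
    simp at hh

theorem pair_visible (T : Terrain p r r' X) (hx : x₀ < X) :
    (pairConfig p r r' x₀ h h' c').Visible r r' := by
  refine Config.visible_of_column T.ne.symm ?_ ?_
  · rw [duoConfig_pos_left, duoConfig_pos_right T.ne]
  · intro k hk hk'
    rw [duoConfig_pos_left, duoConfig_pos_other hk hk']
    exact (hx.trans_le (T.le k hk hk')).ne'

theorem pair_visible_column (T : Terrain p r r' X) (hx : x₀ < X) (hh : 0 < τ * (h' - h))
    {j : Fin n} (hj : j ≠ r) (hj' : j ≠ r') (hX : (p j).1 = X) :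
    (pairConfig p r r' x₀ h h' c').Visible r j := by
  refine Config.visible_of_lt (pair_injective T hx hh) ?_ ?_
  · rw [duoConfig_pos_left, duoConfig_pos_other hj hj', hX]; exact hx
  · intro k hk _
    by_cases hk' : k = r'
    · left; rw [hk', duoConfig_pos_left, duoConfig_pos_right T.ne]
    · right; rw [duoConfig_pos_other hj hj', duoConfig_pos_other hk hk', hX]; exact T.le k hk hk'

theorem snapshot_flip (C : Config n) (f : Frame) (i : Fin n) (τ : ℝ) (hτ : τ = 1 ∨ τ = -1)
    (hf : τ = -f.up) : (C.snapshot f i).flip = C.snapshot (f.orient τ hτ) i := by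
  simp only [Config.snapshot, Snapshot.flip, Snapshot.mk.injEq, true_and, Finset.image_image]
  refine Finset.image_congr fun j _ => ?_
  simp only [Config.sighting, Sighting.flip, Function.comp_apply, Frame.orient, Sighting.mk.injEq,
    true_and, and_true, hf]
  ring

/-- In the second phase a candidate orients its vertical axis towards its partner. -/
theorem dec_pair (T : Terrain p r r' X) (hx : x₀ < X) (hτ : τ = 1 ∨ τ = -1)
    (hh : 0 < τ * (h' - h)) (hc' : c' = Light.candidate ∨ c' = Light.symmetry) :
    dec stage2 F (pairConfig p r r' x₀ h h' c') r =
      ((phase2Candidate n ((pairConfig p r r' x₀ h h' c').snapshot ((F r).orient τ hτ) r)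
        ((pairConfig p r r' x₀ h h' c').sighting ((F r).orient τ hτ) r r')).light,
      ((F r).orient τ hτ).toPlane (x₀, h)
        (phase2Candidate n ((pairConfig p r r' x₀ h h' c').snapshot ((F r).orient τ hτ) r)
        ((pairConfig p r r' x₀ h h' c').sighting ((F r).orient τ hτ) r r')).dest) := by
  set C := pairConfig p r r' x₀ h h' c' with hC
  have hinj : Function.Injective C.pos := pair_injective T hx hh
  have hvis : C.Visible r r' := pair_visible T hx
  have hPr : C.pos r = (x₀, h) := duoConfig_pos_left
  have hPr' : C.pos r' = (x₀, h') := duoConfig_pos_right T.ne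
  have hLr : C.light r = Light.candidate := duoConfig_light_left
  have hLr' : C.light r' = c' := duoConfig_light_right T.ne
  have hdark : C.Dark := by
    intro j
    simp only [hC, duoConfig]
    split_ifs
    · exact Light.noConfusion
    · rcases hc' with rfl | rfl <;> exact Light.noConfusion
    · exact Light.noConfusion
  have hpart : (C.snapshot (F r) r).IsPartner (C.sighting (F r) r r') := by
    refine ⟨Config.mem_others.2 ⟨r', hvis, rfl⟩, Config.sighting_x_zero.2 (by rw [hPr, hPr']), ?_⟩
    rw [Config.sighting_light, hLr']
    exact hc'
  have huniq : ∀ q, (C.snapshot (F r) r).IsPartner q → q = C.sighting (F r) r r' := by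
    rintro q ⟨hq, hqx, -⟩
    obtain ⟨j, hj, rfl⟩ := Config.mem_others.1 hq
    rw [Config.sighting_x_zero, hPr] at hqx
    by_cases hj' : j = r'
    · rw [hj']
    · rw [hC, duoConfig_pos_other hj.1 hj'] at hqx
      exact absurd hqx (hx.trans_le (T.le j hj.1 hj')).ne'
  have halg : algorithm n stage2 (C.snapshot (F r) r) =
      if 0 < (C.sighting (F r) r r').y then
        phase2Candidate n (C.snapshot (F r) r) (C.sighting (F r) r r')
      else (phase2Candidate n (C.snapshot (F r) r).flip (C.sighting (F r) r r').flip).flip := by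
    have hex : ∃ q, (C.snapshot (F r) r).IsPartner q := ⟨_, hpart⟩
    rw [algorithm_of_dark hdark, if_pos, phase2]
    · simp only [Config.snapshot_light, hLr]
      rw [dif_pos hex, huniq _ hex.choose_spec]
    · rcases hc' with hc | hc
      · left
        refine ⟨_, Config.mem_all.2 ⟨r, Or.inl rfl, rfl⟩, _,
          Config.mem_all.2 ⟨r', Or.inr hvis, rfl⟩, fun heq => T.ne (Config.sighting_inj hinj heq),
          ?_, hLr, by rw [Config.sighting_light, hLr', hc]⟩
        simp [Config.sighting, hPr, hPr']
      · right
        exact ⟨_, Config.mem_all.2 ⟨r', Or.inr hvis, rfl⟩, by rw [Config.sighting_light, hLr', hc]⟩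
  have hy : 0 < (C.sighting (F r) r r').y ↔ (F r).up = τ := by
    rw [Config.sighting_y_pos, hPr, hPr']
    simp only
    rcases hτ with rfl | rfl <;> rcases (F r).up_eq with hu | hu <;> rw [hu] <;>
      norm_num at hh ⊢ <;> linarith
  rw [dec, decision, halg]
  by_cases hup : (F r).up = τ
  · have hF : (F r).orient τ hτ = F r := by
      simp only [Frame.orient]
      cases hFr : F r
      rw [hFr] at hup
      simp only at hup
      simp [hup]
    rw [if_pos (hy.2 hup), hF, hPr]
  · have hup' : τ = -(F r).up := by
      rcases hτ with h1 | h1 <;> rcases (F r).up_eq with hu | hu <;> rw [h1, hu] at hup <;>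
        rw [h1, hu] <;> first | exact absurd rfl hup | norm_num
    have h1 : (C.sighting (F r) r r').flip = C.sighting ((F r).orient τ hτ) r r' := by
      simp only [Config.sighting, Sighting.flip, Frame.orient, Sighting.mk.injEq, true_and,
        and_true, hup']
      ring
    rw [if_neg (fun h => hup (hy.1 h)), snapshot_flip C (F r) r τ hτ hup', h1, hPr]
    simp only [Action.flip, Frame.toPlane, Frame.orient, hup', Prod.mk.injEq, true_and]
    ring

/-- Comparisons of ordinates in the local coordinate system. -/
theorem orient_y (f : Frame) (hτ : τ = 1 ∨ τ = -1) (C : Config n) (i j : Fin n) :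
    (C.sighting (f.orient τ hτ) i j).y = τ * ((C.pos j).2 - (C.pos i).2) / f.unit := rfl

theorem pair_gap (T : Terrain p r r' X) (hx : x₀ < X) (hh : 0 < τ * (h' - h)) (f : Frame) :
    ((pairConfig p r r' x₀ h h' c').snapshot f r).gap = (X - x₀) / f.unit := by
  obtain ⟨t, ht, ht', htX⟩ := T.ex
  have htm : (pairConfig p r r' x₀ h h' c').sighting f r t ∈
      ((pairConfig p r r' x₀ h h' c').snapshot f r).right := by
    refine Finset.mem_filter.2 ⟨Config.mem_others.2
      ⟨t, pair_visible_column T hx hh ht ht' htX, rfl⟩, ?_⟩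
    rw [Config.sighting_x_pos, duoConfig_pos_left, duoConfig_pos_other ht ht', htX]
    exact hx
  rw [Snapshot.gap, dif_pos ⟨_, htm⟩]
  refine le_antisymm ?_ ?_
  · refine (Finset.inf'_le _ htm).trans ?_
    simp only [Config.sighting]
    rw [duoConfig_pos_left, duoConfig_pos_other ht ht', htX]
  · refine Finset.le_inf' _ _ fun q hq => ?_
    obtain ⟨hq1, hq2⟩ := Finset.mem_filter.1 hq
    obtain ⟨j, hj, rfl⟩ := Config.mem_others.1 hq1
    rw [Config.sighting_x_pos, duoConfig_pos_left] at hq2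
    by_cases hj' : j = r'
    · rw [hj', duoConfig_pos_right T.ne] at hq2
      exact absurd hq2 (lt_irrefl _)
    · simp only [Config.sighting]
      rw [duoConfig_pos_left, duoConfig_pos_other hj.1 hj']
      exact div_le_div_of_nonneg_right (by linarith [T.le j hj.1 hj']) f.unit_pos.le

theorem pair_nextColumn (T : Terrain p r r' X) (hx : x₀ < X) (hh : 0 < τ * (h' - h)) (f : Frame) :
    ((pairConfig p r r' x₀ h h' c').snapshot f r).nextColumn =
      (column p r r' X).image ((pairConfig p r r' x₀ h h' c').sighting f r) := by
  have hu := f.unit_pos.ne'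
  ext q
  rw [Snapshot.nextColumn, Finset.mem_filter, pair_gap T hx hh, Finset.mem_image]
  constructor
  · rintro ⟨hq, hqx⟩
    obtain ⟨j, hj, rfl⟩ := Config.mem_others.1 hq
    refine ⟨j, ?_, rfl⟩
    simp only [Config.sighting] at hqx
    rw [duoConfig_pos_left] at hqx
    by_cases hj' : j = r'
    · rw [hj', duoConfig_pos_right T.ne] at hqx
      field_simp at hqx
      linarith
    · rw [duoConfig_pos_other hj.1 hj'] at hqx
      field_simp at hqx
      simp only [column, Finset.mem_filter, Finset.mem_univ, true_and]
      exact ⟨⟨hj.1, hj'⟩, by linarith⟩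
  · rintro ⟨j, hj, rfl⟩
    simp only [column, Finset.mem_filter, Finset.mem_univ, true_and] at hj
    obtain ⟨⟨h1, h2⟩, h3⟩ := hj
    refine ⟨Config.mem_others.2 ⟨j, pair_visible_column T hx hh h1 h2 h3, rfl⟩, ?_⟩
    simp only [Config.sighting]
    rw [duoConfig_pos_left, duoConfig_pos_other h1 h2, h3]

theorem column_nonempty (T : Terrain p r r' X) : (column p r r' X).Nonempty := by
  obtain ⟨t, ht, ht', htX⟩ := T.ex
  exact ⟨t, by simp [column, ht, ht', htX]⟩

theorem pair_axis (T : Terrain p r r' X) (hx : x₀ < X) (hh : 0 < τ * (h' - h)) (f : Frame)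
    (hτ : τ = 1 ∨ τ = -1) :
    ((pairConfig p r r' x₀ h h' c').snapshot (f.orient τ hτ) r).axis =
      τ * (midline p r r' X - h) / f.unit := by
  have hinj := pair_injective (c' := c') T hx hh
  have hu := f.unit_pos.ne'
  rw [Snapshot.axis, pair_nextColumn T hx hh, Finset.sum_image
    (fun i _ j _ h => Config.sighting_inj hinj h), Finset.card_image_of_injective _
    (fun i j h => Config.sighting_inj hinj h)]
  have hcard : ((column p r r' X).card : ℝ) ≠ 0 :=
    Nat.cast_ne_zero.2 (Finset.card_pos.2 (column_nonempty T)).ne'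
  have : ∀ j ∈ column p r r' X, ((pairConfig p r r' x₀ h h' c').sighting (f.orient τ hτ) r j).y =
      (τ / f.unit) * (p j).2 - (τ / f.unit) * h := by
    intro j hj
    simp only [column, Finset.mem_filter, Finset.mem_univ, true_and] at hj
    rw [orient_y, duoConfig_pos_left, duoConfig_pos_other hj.1.1 hj.1.2]
    ring
  rw [Finset.sum_congr rfl this, Finset.sum_sub_distrib, ← Finset.mul_sum, Finset.sum_const,
    midline, nsmul_eq_mul]
  field_simp

/-- The list of the robots on one side of the midline, as the robot `r` computes it, agrees up to
scale with the global one, if all robots are visible; its first column always does. -/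
theorem pair_string (T : Terrain p r r' X) (hx : x₀ < X) (hh : 0 < τ * (h' - h)) (f : Frame)
    (hτ : τ = 1 ∨ τ = -1) (ε : ℝ) (H : Finset Sighting)
    (hH : ∀ q, q ∈ H ↔ ∃ j, (pairConfig p r r' x₀ h h' c').Visible r j ∧ j ≠ r' ∧
      0 < ε * ((p j).2 - midline p r r' X) ∧
      (pairConfig p r r' x₀ h h' c').sighting (f.orient τ hτ) r j = q) :
    firstColumn (((pairConfig p r r' x₀ h h' c').snapshot (f.orient τ hτ) r).string H) =
      (firstColumn (sideList p r r' X ε)).map (rescale f.unit) ∧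
    ((∀ j, j ≠ r → (pairConfig p r r' x₀ h h' c').Visible r j) →
      ((pairConfig p r r' x₀ h h' c').snapshot (f.orient τ hτ) r).string H =
        (sideList p r r' X ε).map (rescale f.unit)) := by
  have hu := f.unit_pos
  set C := pairConfig p r r' x₀ h h' c' with hC
  set S := (Finset.univ.filter fun j => (j ≠ r ∧ j ≠ r') ∧
    0 < ε * ((p j).2 - midline p r r' X) ∧ C.Visible r j).image
    (fun j => toLex ((p j).1 - X, |(p j).2 - midline p r r' X|)) with hS
  have hstr : (C.snapshot (f.orient τ hτ) r).string H =
      (S.sort (· ≤ ·)).map (rescale f.unit) := by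
    rw [← sort_image_rescale hu, Snapshot.string]
    congr 1
    rw [pair_gap T hx hh, pair_axis T hx hh f hτ]
    have hq : ∀ j, j ≠ r → j ≠ r' →
        toLex ((C.sighting (f.orient τ hτ) r j).x - (X - x₀) / (f.orient τ hτ).unit,
          |(C.sighting (f.orient τ hτ) r j).y - τ * (midline p r r' X - h) / f.unit|) =
        rescale f.unit (toLex ((p j).1 - X, |(p j).2 - midline p r r' X|)) := by
      intro j hj hj'
      have h1 : |τ| = 1 := by rcases hτ with rfl | rfl <;> norm_num
      rw [rescale, orient_y]
      simp only [Config.sighting, hC]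
      rw [duoConfig_pos_left, duoConfig_pos_other hj hj']
      simp only [Frame.orient, ofLex_toLex]
      congr 2
      · field_simp; ring
      · rw [← sub_div, ← mul_sub, abs_div, abs_mul, h1, one_mul, abs_of_pos hu]
        congr 2
        ring
    ext a
    simp only [hS, Finset.mem_image, Finset.mem_filter, Finset.mem_univ, true_and]
    constructor
    · rintro ⟨q, hqH, rfl⟩
      obtain ⟨j, hj, hj', hε, rfl⟩ := (hH q).1 hqH
      exact ⟨_, ⟨j, ⟨⟨hj.1, hj'⟩, hε, hj⟩, rfl⟩, (hq j hj.1 hj').symm⟩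
    · rintro ⟨_, ⟨j, ⟨⟨hj, hj'⟩, hε, hv⟩, rfl⟩, rfl⟩
      exact ⟨_, (hH _).2 ⟨j, hv, hj', hε, rfl⟩, hq j hj hj'⟩
  constructor
  · rw [hstr, firstColumn_map_rescale hu, sideList, firstColumn_sort, firstColumn_sort]
    congr 2
    ext a
    simp only [hS, sideSet, Finset.mem_image, Finset.mem_filter, Finset.mem_univ, true_and]
    constructor
    · rintro ⟨⟨j, ⟨hj, hε, -⟩, rfl⟩, h0⟩
      exact ⟨⟨j, ⟨hj, hε⟩, rfl⟩, h0⟩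
    · rintro ⟨⟨j, ⟨hj, hε⟩, rfl⟩, h0⟩
      refine ⟨⟨j, ⟨hj, hε, pair_visible_column T hx hh hj.1 hj.2 ?_⟩, rfl⟩, h0⟩
      simp only [ofLex_toLex] at h0
      linarith
  · intro hall
    rw [hstr, sideList]
    congr 2
    ext a
    simp only [hS, sideSet, Finset.mem_image, Finset.mem_filter, Finset.mem_univ, true_and]
    constructor
    · rintro ⟨j, ⟨hj, hε, -⟩, rfl⟩
      exact ⟨j, ⟨hj, hε⟩, rfl⟩
    · rintro ⟨j, ⟨hj, hε⟩, rfl⟩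
      exact ⟨j, ⟨hj, hε, hall j hj.1⟩, rfl⟩

/-- The robot `r` keeps its light and goes to the left, but not so far that it could be hidden
from a robot of the first column by its partner. -/
def GoesLeft (p : Fin n → ℝ × ℝ) (r r' : Fin n) (X x₀ τ h h' : ℝ) (d : Light × (ℝ × ℝ)) : Prop :=
  ∃ b, 0 < b ∧ d = (Light.candidate, (x₀ - b, h)) ∧ ∀ j, j ≠ r → j ≠ r' → (p j).1 = X →
    b * (τ * ((p j).2 - h')) < (X - x₀) * (τ * (h' - h))

theorem goesLeft_computeDestination2 (T : Terrain p r r' X) (hx : x₀ < X) (hτ : τ = 1 ∨ τ = -1)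
    (hh : 0 < τ * (h' - h)) (f : Frame) :
    GoesLeft p r r' X x₀ τ h h' (Light.candidate, (f.orient τ hτ).toPlane (x₀, h)
      (computeDestination2 ((pairConfig p r r' x₀ h h' c').snapshot (f.orient τ hτ) r)
        ((pairConfig p r r' x₀ h h' c').sighting (f.orient τ hτ) r r'))) := by
  set C := pairConfig p r r' x₀ h h' c' with hC
  have hu := f.unit_pos
  have hy' : (C.sighting (f.orient τ hτ) r r').y = τ * (h' - h) / f.unit := by
    rw [orient_y, hC, duoConfig_pos_left, duoConfig_pos_right T.ne]
  have hyj : ∀ j, j ≠ r → j ≠ r' →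
      (C.sighting (f.orient τ hτ) r j).y = τ * ((p j).2 - h) / f.unit := by
    intro j hj hj'
    rw [orient_y, hC, duoConfig_pos_left, duoConfig_pos_other hj hj']
  have hcol : ∀ j, j ≠ r → j ≠ r' → (p j).1 = X → C.sighting (f.orient τ hτ) r j ∈
      (C.snapshot (f.orient τ hτ) r).nextColumn := by
    intro j hj hj' hX
    rw [hC, pair_nextColumn T hx hh]
    exact Finset.mem_image_of_mem _ (by simp [column, hj, hj', hX])
  unfold computeDestination2
  split_ifs with hne
  · set m := ((C.snapshot (f.orient τ hτ) r).nextColumn.filter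
      (fun q => (C.sighting (f.orient τ hτ) r r').y < q.y)).sup' hne Sighting.y with hm
    have hmy : (C.sighting (f.orient τ hτ) r r').y < m := by
      obtain ⟨q, hq⟩ := hne
      exact (Finset.mem_filter.1 hq).2.trans_le (Finset.le_sup' Sighting.y hq)
    rw [hy'] at hmy
    have hg : (C.snapshot (f.orient τ hτ) r).gap = (X - x₀) / f.unit := pair_gap T hx hh _
    rw [hg, hy']
    have hpos : 0 < m - τ * (h' - h) / f.unit := by linarith
    have hratio : 0 < τ * (h' - h) / f.unit / (m - τ * (h' - h) / f.unit) :=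
      div_pos (div_pos hh hu) hpos
    refine ⟨f.unit * (1 / 2 * ((X - x₀) / f.unit) *
      (τ * (h' - h) / f.unit / (m - τ * (h' - h) / f.unit))), ?_, ?_, ?_⟩
    · exact mul_pos hu (mul_pos (mul_pos (by norm_num) (div_pos (by linarith) hu)) hratio)
    · simp only [Frame.toPlane, Frame.orient, mul_zero, add_zero, mul_neg, ← sub_eq_add_neg]
    · intro j hj hj' hX
      have h1 : f.unit * (1 / 2 * ((X - x₀) / f.unit) *
          (τ * (h' - h) / f.unit / (m - τ * (h' - h) / f.unit))) =
          1 / 2 * (X - x₀) * (τ * (h' - h) / f.unit / (m - τ * (h' - h) / f.unit)) := by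
        field_simp
      rw [h1]
      have h2 : 0 < (X - x₀) * (τ * (h' - h)) := mul_pos (by linarith) hh
      rcases le_or_gt (τ * ((p j).2 - h')) 0 with h3 | h3
      · refine lt_of_le_of_lt (mul_nonpos_of_nonneg_of_nonpos ?_ h3) h2
        exact (mul_pos (mul_pos (by norm_num) (by linarith)) hratio).le
      · have h4 : τ * ((p j).2 - h) / f.unit ≤ m := by
          rw [← hyj j hj hj']
          refine Finset.le_sup' Sighting.y (Finset.mem_filter.2 ⟨hcol j hj hj' hX, ?_⟩)
          rw [hy', hyj j hj hj']
          exact div_lt_div_of_pos_right (by linarith) hu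
        have h5 : τ * ((p j).2 - h') ≤ f.unit * (m - τ * (h' - h) / f.unit) := by
          rw [div_le_iff₀ hu] at h4
          have h6 : f.unit * (m - τ * (h' - h) / f.unit) = m * f.unit - τ * (h' - h) := by
            field_simp
          rw [h6]
          linarith
        calc 1 / 2 * (X - x₀) * (τ * (h' - h) / f.unit / (m - τ * (h' - h) / f.unit)) *
              (τ * ((p j).2 - h'))
            ≤ 1 / 2 * (X - x₀) * (τ * (h' - h) / f.unit / (m - τ * (h' - h) / f.unit)) *
              (f.unit * (m - τ * (h' - h) / f.unit)) :=
              mul_le_mul_of_nonneg_left h5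
                (mul_pos (mul_pos (by norm_num) (by linarith)) hratio).le
          _ = 1 / 2 * ((X - x₀) * (τ * (h' - h))) := by
              have := hu.ne'
              have := hpos.ne'
              generalize m - τ * (h' - h) / f.unit = z at *
              field_simp
          _ < _ := by linarith
  · refine ⟨f.unit, hu, ?_, fun j hj hj' hX => ?_⟩
    · simp [Frame.toPlane, Frame.orient, sub_eq_add_neg]
    · have h2 : 0 < (X - x₀) * (τ * (h' - h)) := mul_pos (by linarith) hh
      refine lt_of_le_of_lt (mul_nonpos_of_nonneg_of_nonpos hu.le ?_) h2
      by_contra h3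
      push Not at h3
      refine hne ⟨_, Finset.mem_filter.2 ⟨hcol j hj hj' hX, ?_⟩⟩
      rw [hy', hyj j hj hj']
      exact div_lt_div_of_pos_right (by linarith) hu

end Rule

section Rule

variable {n : ℕ} {stage2 : Snapshot → Action} {F : Fin n → Frame}
  {p : Fin n → ℝ × ℝ} {r r' : Fin n} {X x₀ h h' τ : ℝ} {c' : Light}

theorem pair_card_all (T : Terrain p r r' X) (hx : x₀ < X) (hh : 0 < τ * (h' - h)) (f : Frame) :
    ((pairConfig p r r' x₀ h h' c').snapshot f r).all.card = n ↔
      ∀ j, j ≠ r → (pairConfig p r r' x₀ h h' c').Visible r j := by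
  have hinj := pair_injective (c' := c') T hx hh
  set C := pairConfig p r r' x₀ h h' c'
  have hall : (C.snapshot f r).all =
      (Finset.univ.filter fun j => j = r ∨ C.Visible r j).image (C.sighting f r) := by
    ext q
    simp [Config.mem_all]
  rw [hall, Finset.card_image_of_injective _ fun i j h => Config.sighting_inj hinj h]
  conv_lhs => rhs; rw [← Fintype.card_fin n, ← Finset.card_univ]
  rw [Finset.card_filter_eq_iff]
  simp only [Finset.mem_univ, forall_const]
  exact forall_congr' fun j => by tauto

theorem pair_visible_iff (T : Terrain p r r' X) (hx : x₀ < X) (hh : 0 < τ * (h' - h)) {j : Fin n}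
    (hj : j ≠ r) (hj' : j ≠ r') : (pairConfig p r r' x₀ h h' c').Visible r j ↔
      ∀ k, k ≠ r → k ≠ r' → k ≠ j → p k ∉ segment ℝ (x₀, h) (p j) := by
  constructor
  · intro hv k hk hk' hkj
    have := hv.2 k hk hkj
    rwa [duoConfig_pos_left, duoConfig_pos_other hj hj', duoConfig_pos_other hk hk'] at this
  · refine fun H => ⟨hj, fun k hk hkj => ?_⟩
    rw [duoConfig_pos_left, duoConfig_pos_other hj hj']
    by_cases hk' : k = r'
    · subst hk'
      rw [duoConfig_pos_right T.ne]
      intro hs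
      obtain ⟨θ, h0, h1, hx', hy⟩ := exists_of_mem_segment hs
      have h2 := T.le j hj hj'
      simp only at hx' hy
      -- the segment leaves the vertical line, so only its starting point can be on it
      have h3 : θ = 0 := by
        have : θ * ((p j).1 - x₀) = 0 := by linarith
        exact (mul_eq_zero.1 this).resolve_right (by linarith)
      rw [h3] at hy
      rw [show h' = h by linarith] at hh
      simp at hh
    · rw [duoConfig_pos_other hk hk']
      exact H k hk hk' hkj


/-- The decision of a candidate, expressed in global coordinates except for the way to the left. -/
theorem phase2Candidate_eq (T : Terrain p r r' X) (hx : x₀ < X) (hτ : τ = 1 ∨ τ = -1)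
    (hh : 0 < τ * (h' - h)) (f : Frame) {C : Config n} (hC : C = pairConfig p r r' x₀ h h' c')
    {S : Snapshot} (hS : S = C.snapshot (f.orient τ hτ) r)
    {s' : Sighting} (hs' : s' = C.sighting (f.orient τ hτ) r r')
    {w : Action} (hw : w = S.moveTo (computeDestination2 S s'))
    {K : ℝ} (hKdef : K = midline p r r' X) {L : ℝ → List (ℝ ×ₗ ℝ)} (hL : L = sideList p r r' X) :
    phase2Candidate n S s' =
    if c' = Light.symmetry then
      if |h - K| < |h' - K| then S.moveTo (0, -((|h' - K| - |h - K|) / f.unit))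
      else if |h - K| = |h' - K| then setLight Light.symmetry
      else S.stay
    else if (0 ≤ τ * (K - h) ∧ τ * (h' - K) ≤ 0) ∨ (τ * (K - h) ≤ 0 ∧ 0 ≤ τ * (h' - K)) then
      if |h' - K| < |h - K| then w else S.stay
    else if Prec (firstColumn (L (-τ))) (firstColumn (L τ)) then w
    else if firstColumn (L (-τ)) = firstColumn (L τ) then
      if |h' - K| ≤ |h - K| then
        if Exposed p r r' x₀ τ h then
          if Prec (L (-τ)) (L τ) then w
          else if Prec (L τ) (L (-τ)) then S.moveTo ((X - x₀) / f.unit / 2, 0)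
          else if ∀ j, j ≠ r → j ≠ r' → (p j).2 ≠ K then w
          else setLight Light.symmetry
        else S.moveTo (0, -(|h - K| / f.unit))
      else S.stay
    else S.stay := by
  have hu := f.unit_pos
  have hinj : Function.Injective C.pos := hC ▸ pair_injective (c' := c') T hx hh
  have hax : S.axis = τ * (K - h) / f.unit := by rw [hS, hC, hKdef]; exact pair_axis T hx hh f hτ
  have hgap : S.gap = (X - x₀) / f.unit := by rw [hS, hC]; exact pair_gap T hx hh _
  have hy' : s'.y = τ * (h' - h) / f.unit := by
    rw [hs', orient_y, hC, duoConfig_pos_left, duoConfig_pos_right T.ne]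
  have hyj : ∀ j, j ≠ r → j ≠ r' →
      (C.sighting (f.orient τ hτ) r j).y = τ * ((p j).2 - h) / f.unit := by
    intro j hj hj'
    rw [orient_y, hC, duoConfig_pos_left, duoConfig_pos_other hj hj']
  have hl' : s'.light = c' := by
    rw [hs', Config.sighting_light, hC, duoConfig_light_right T.ne]
  have habs : |τ| = 1 := by rcases hτ with rfl | rfl <;> norm_num
  have hd : |S.axis| = |h - K| / f.unit := by
    rw [hax, abs_div, abs_mul, habs, one_mul, abs_of_pos hu, abs_sub_comm]
  have hd' : |s'.y - S.axis| = |h' - K| / f.unit := by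
    rw [hax, hy', ← sub_div, ← mul_sub, abs_div, abs_mul, habs, one_mul, abs_of_pos hu]
    congr 2; ring
  -- a robot of the snapshot other than `r'` on a given side of the midline
  have hside : ∀ ε (Q : Sighting → Prop) [DecidablePred Q],
      (∀ j, j ≠ r → j ≠ r' → (Q (C.sighting (f.orient τ hτ) r j) ↔ 0 < ε * ((p j).2 - K))) →
      ∀ q, q ∈ (S.others.erase s').filter Q ↔
        ∃ j, C.Visible r j ∧ j ≠ r' ∧ 0 < ε * ((p j).2 - K) ∧
          C.sighting (f.orient τ hτ) r j = q := by
    intro ε Q _ hQ q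
    rw [Finset.mem_filter, Finset.mem_erase, hS, Config.mem_others, hs']
    constructor
    · rintro ⟨⟨hne, j, hj, rfl⟩, hq⟩
      have hj' : j ≠ r' := fun h => hne (by rw [h])
      exact ⟨j, hj, hj', (hQ j hj.1 hj').1 hq, rfl⟩
    · rintro ⟨j, hj, hj', hε, rfl⟩
      exact ⟨⟨fun heq => hj' (Config.sighting_inj hinj heq), j, hj, rfl⟩, (hQ j hj.1 hj').2 hε⟩
  have hnn : ∀ a, 0 ≤ a / f.unit ↔ 0 ≤ a := fun a => by rw [le_div_iff₀ hu, zero_mul]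
  have hnp : ∀ a, a / f.unit ≤ 0 ↔ a ≤ 0 := fun a => by rw [div_le_iff₀ hu, zero_mul]
  have hstr := fun ε => pair_string (c' := c') T hx hh f hτ ε
  simp only [← hC, ← hS, ← hKdef, ← hL] at hstr
  obtain ⟨hs1, hs2⟩ := hstr (-τ) _ (hside (-τ) (fun q => q.y < S.axis)
    (fun j hj hj' => by
      rw [hyj j hj hj', hax, div_lt_div_iff_of_pos_right hu]
      constructor <;> intro h <;> linarith))
  obtain ⟨hs3, hs4⟩ := hstr τ _ (hside τ (fun q => S.axis < q.y)
    (fun j hj hj' => by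
      rw [hyj j hj hj', hax, div_lt_div_iff_of_pos_right hu]
      constructor <;> intro h <;> linarith))
  have hsc := rescale_strictMono hu
  have e1 : (|h - K| / f.unit < |h' - K| / f.unit) ↔ |h - K| < |h' - K| :=
    div_lt_div_iff_of_pos_right hu
  have e2 : (|h' - K| / f.unit < |h - K| / f.unit) ↔ |h' - K| < |h - K| :=
    div_lt_div_iff_of_pos_right hu
  have e3 : (|h' - K| / f.unit ≤ |h - K| / f.unit) ↔ |h' - K| ≤ |h - K| :=
    div_le_div_iff_of_pos_right hu
  have e4 : (|h - K| / f.unit = |h' - K| / f.unit) ↔ |h - K| = |h' - K| :=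
    div_left_inj' hu.ne'
  have e5 : ((0 ≤ S.axis ∧ s'.y ≤ S.axis) ∨
      (S.axis ≤ 0 ∧ S.axis ≤ s'.y)) ↔
      ((0 ≤ τ * (K - h) ∧ τ * (h' - K) ≤ 0) ∨ (τ * (K - h) ≤ 0 ∧ 0 ≤ τ * (h' - K))) := by
    rw [hax, hy', div_le_div_iff_of_pos_right hu, div_le_div_iff_of_pos_right hu,
      hnn, hnp]
    have h1 : τ * (h' - h) ≤ τ * (K - h) ↔ τ * (h' - K) ≤ 0 := by
      constructor <;> intro h <;> linarith
    have h2 : τ * (K - h) ≤ τ * (h' - h) ↔ 0 ≤ τ * (h' - K) := by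
      constructor <;> intro h <;> linarith
    rw [h1, h2]
  have e6 : (S.all.card = n ∧ ∀ q ∈ S.others, ¬ q.y < 0) ↔ Exposed p r r' x₀ τ h := by
    rw [hS, hC, pair_card_all T hx hh, ← hC, Exposed]
    constructor
    · rintro ⟨h1, h2⟩
      refine ⟨fun j hj hj' => (pair_visible_iff T hx hh hj hj').1 (hC ▸ h1 j hj), fun j hj hj' => ?_⟩
      have h3 := h2 (C.sighting (f.orient τ hτ) r j)
        (Config.mem_others.2 ⟨j, hC ▸ h1 j hj, rfl⟩)
      rwa [hyj j hj hj', not_lt, hnn] at h3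
    · rintro ⟨h1, h2⟩
      constructor
      · intro j hj
        rw [hC]
        by_cases hj' : j = r'
        · rw [hj']; exact pair_visible T hx
        · exact (pair_visible_iff T hx hh hj hj').2 (h1 j hj hj')
      · intro q hq
        obtain ⟨j, hj, rfl⟩ := Config.mem_others.1 hq
        rw [not_lt]
        by_cases hj' : j = r'
        · rw [hj', ← hs', hy']; exact (div_pos hh hu).le
        · rw [hyj j hj.1 hj', hnn]
          exact h2 j hj.1 hj'
  unfold phase2Candidate
  dsimp only
  rw [← hw]
  simp only [hd, hd', e1, e2, e3, e4, e5, e6, hl', hs1, hs3, prec_map hsc,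
    (List.map_injective_iff.2 hsc.injective).eq_iff]
  have hfin : Exposed p r r' x₀ τ h → ¬ ((0 ≤ τ * (K - h) ∧ τ * (h' - K) ≤ 0) ∨
      (τ * (K - h) ≤ 0 ∧ 0 ≤ τ * (h' - K))) →
      ((∀ q ∈ S.all, q.y ≠ S.axis) ↔ ∀ j, j ≠ r → j ≠ r' → (p j).2 ≠ K) := by
    intro hE hside'
    have hvis := (e6.2 hE).1
    rw [hS, hC, pair_card_all T hx hh, ← hC] at hvis
    have hτ0 : τ ≠ 0 := by rcases hτ with rfl | rfl <;> norm_num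
    constructor
    · intro hall j hj hj' hjK
      refine hall (C.sighting (f.orient τ hτ) r j) (hS ▸ Config.mem_all.2 ⟨j, Or.inr (hvis j hj), rfl⟩) ?_
      rw [hyj j hj hj', hax, hjK]
    · intro hall q hq
      rw [hS] at hq
      obtain ⟨j, -, rfl⟩ := Config.mem_all.1 hq
      rw [hax]
      intro heq
      by_cases hj : j = r
      · subst hj
        rw [orient_y, sub_self, mul_zero, zero_div, eq_comm, div_eq_zero_iff,
          or_iff_left hu.ne'] at heq
        refine absurd ?_ hside'
        rcases le_total 0 (τ * (h' - K)) with h | h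
        · exact Or.inr ⟨heq.le, h⟩
        · exact Or.inl ⟨heq.ge, h⟩
      by_cases hj' : j = r'
      · rw [hj', ← hs', hy', div_left_inj' hu.ne'] at heq
        refine hside' ?_
        rcases le_total 0 (τ * (K - h)) with h | h
        · exact Or.inl ⟨h, by linarith⟩
        · exact Or.inr ⟨h, by linarith⟩
      · rw [hyj j hj hj', div_left_inj' hu.ne'] at heq
        exact hall j hj hj' (by have := mul_left_cancel₀ hτ0 heq; linarith)
  by_cases hE : Exposed p r r' x₀ τ h
  · have hvis := (e6.2 hE).1
    rw [hS, hC, pair_card_all T hx hh, ← hC] at hvis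
    simp only [hs2 hvis, hs4 hvis, prec_map hsc]
    by_cases hsd : ((0 ≤ τ * (K - h) ∧ τ * (h' - K) ≤ 0) ∨ (τ * (K - h) ≤ 0 ∧ 0 ≤ τ * (h' - K)))
    · simp only [if_pos hsd, sub_div]
    · have := hfin hE hsd
      simp only [this, hgap, sub_div]
  · simp only [if_neg hE, sub_div]

theorem dec_catch_up (T : Terrain p r r' X) (hx : x₀ < X) (hτ : τ = 1 ∨ τ = -1)
    (hh : 0 < τ * (h' - h))
    (hd : |h - midline p r r' X| < |h' - midline p r r' X|) :
    dec stage2 F (pairConfig p r r' x₀ h h' Light.symmetry) r = (Light.candidate,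
      (x₀, h - τ * (|h' - midline p r r' X| - |h - midline p r r' X|))) := by
  rw [dec_pair T hx hτ hh (Or.inr rfl), phase2Candidate_eq T hx hτ hh _ rfl rfl rfl rfl rfl rfl]
  have := (F r).unit_pos.ne'
  simp only [if_true, if_pos hd, Snapshot.moveTo, Frame.toPlane, Frame.orient,
    Config.snapshot_light, duoConfig_light_left, Prod.mk.injEq, true_and]
  constructor
  · ring
  · field_simp; ring

theorem dec_join (T : Terrain p r r' X) (hx : x₀ < X) (hτ : τ = 1 ∨ τ = -1)
    (hh : 0 < τ * (h' - h))
    (hd : |h - midline p r r' X| = |h' - midline p r r' X|) :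
    dec stage2 F (pairConfig p r r' x₀ h h' Light.symmetry) r = (Light.symmetry, (x₀, h)) := by
  rw [dec_pair T hx hτ hh (Or.inr rfl), phase2Candidate_eq T hx hτ hh _ rfl rfl rfl rfl rfl rfl]
  simp only [if_true, hd, lt_irrefl, if_false, setLight, Frame.toPlane_zero]

theorem dec_same_side_stay (T : Terrain p r r' X) (hx : x₀ < X) (hτ : τ = 1 ∨ τ = -1)
    (hh : 0 < τ * (h' - h))
    (hs : 0 ≤ τ * (midline p r r' X - h) ∧ τ * (h' - midline p r r' X) ≤ 0 ∨
      τ * (midline p r r' X - h) ≤ 0 ∧ 0 ≤ τ * (h' - midline p r r' X))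
    (hd : |h - midline p r r' X| ≤ |h' - midline p r r' X|) :
    dec stage2 F (pairConfig p r r' x₀ h h' Light.candidate) r = (Light.candidate, (x₀, h)) := by
  rw [dec_pair T hx hτ hh (Or.inl rfl), phase2Candidate_eq T hx hτ hh _ rfl rfl rfl rfl rfl rfl]
  simp only [reduceCtorEq, if_false, if_pos hs, if_neg (not_lt.2 hd), Snapshot.stay,
    Frame.toPlane_zero]
  rw [Config.snapshot_light, duoConfig_light_left]

theorem dec_same_side_left (T : Terrain p r r' X) (hx : x₀ < X) (hτ : τ = 1 ∨ τ = -1)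
    (hh : 0 < τ * (h' - h))
    (hs : 0 ≤ τ * (midline p r r' X - h) ∧ τ * (h' - midline p r r' X) ≤ 0 ∨
      τ * (midline p r r' X - h) ≤ 0 ∧ 0 ≤ τ * (h' - midline p r r' X))
    (hd : |h' - midline p r r' X| < |h - midline p r r' X|) :
    GoesLeft p r r' X x₀ τ h h'
      (dec stage2 F (pairConfig p r r' x₀ h h' Light.candidate) r) := by
  rw [dec_pair T hx hτ hh (Or.inl rfl), phase2Candidate_eq T hx hτ hh _ rfl rfl rfl rfl rfl rfl]
  simp only [reduceCtorEq, if_false, if_pos hs, if_pos hd, Snapshot.moveTo]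
  rw [Config.snapshot_light, duoConfig_light_left]
  exact goesLeft_computeDestination2 T hx hτ hh _


theorem phase2Candidate_opposite (hK : 0 < τ * (midline p r r' X - h)) (hK' : 0 < τ * (h' - midline p r r' X)) :
    ¬ (0 ≤ τ * (midline p r r' X - h) ∧ τ * (h' - midline p r r' X) ≤ 0 ∨
      τ * (midline p r r' X - h) ≤ 0 ∧ 0 ≤ τ * (h' - midline p r r' X)) := by
  rintro (⟨-, h1⟩ | ⟨h1, -⟩) <;> linarith

theorem dec_column_prec_left (T : Terrain p r r' X) (hx : x₀ < X) (hτ : τ = 1 ∨ τ = -1)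
    (hh : 0 < τ * (h' - h))
    (hK : 0 < τ * (midline p r r' X - h)) (hK' : 0 < τ * (h' - midline p r r' X))
    (hl : Prec (firstColumn (sideList p r r' X (-τ)))
      (firstColumn (sideList p r r' X τ))) :
    GoesLeft p r r' X x₀ τ h h'
      (dec stage2 F (pairConfig p r r' x₀ h h' Light.candidate) r) := by
  rw [dec_pair T hx hτ hh (Or.inl rfl), phase2Candidate_eq T hx hτ hh _ rfl rfl rfl rfl rfl rfl]
  have hs := phase2Candidate_opposite hK hK'
  simp only [reduceCtorEq, if_false, if_neg hs, if_pos hl, Snapshot.moveTo, Snapshot.stay, setLight]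
  rw [Config.snapshot_light, duoConfig_light_left]
  exact goesLeft_computeDestination2 T hx hτ hh _

theorem dec_column_prec_stay (T : Terrain p r r' X) (hx : x₀ < X) (hτ : τ = 1 ∨ τ = -1)
    (hh : 0 < τ * (h' - h))
    (hK : 0 < τ * (midline p r r' X - h)) (hK' : 0 < τ * (h' - midline p r r' X))
    (hl : Prec (firstColumn (sideList p r r' X τ))
      (firstColumn (sideList p r r' X (-τ)))) :
    dec stage2 F (pairConfig p r r' x₀ h h' Light.candidate) r =
      (Light.candidate, (x₀, h)) := by
  rw [dec_pair T hx hτ hh (Or.inl rfl), phase2Candidate_eq T hx hτ hh _ rfl rfl rfl rfl rfl rfl]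
  have hs := phase2Candidate_opposite hK hK'
  have hne : firstColumn (sideList p r r' X (-τ)) ≠ firstColumn (sideList p r r' X τ) := by
    intro h
    rw [h] at hl
    exact Prec.irrefl hl
  simp only [reduceCtorEq, if_false, if_neg hs, if_neg (Prec.asymm hl), if_neg hne, Snapshot.moveTo, Snapshot.stay, setLight]
  rw [Config.snapshot_light, duoConfig_light_left, Frame.toPlane_zero]

theorem dec_nearer_stay (T : Terrain p r r' X) (hx : x₀ < X) (hτ : τ = 1 ∨ τ = -1)
    (hh : 0 < τ * (h' - h))
    (hK : 0 < τ * (midline p r r' X - h)) (hK' : 0 < τ * (h' - midline p r r' X))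
    (hl : firstColumn (sideList p r r' X (-τ)) =
      firstColumn (sideList p r r' X τ))
    (hd : |h - midline p r r' X| < |h' - midline p r r' X|) :
    dec stage2 F (pairConfig p r r' x₀ h h' Light.candidate) r =
      (Light.candidate, (x₀, h)) := by
  rw [dec_pair T hx hτ hh (Or.inl rfl), phase2Candidate_eq T hx hτ hh _ rfl rfl rfl rfl rfl rfl]
  have hs := phase2Candidate_opposite hK hK'
  simp only [reduceCtorEq, if_false, if_neg hs, hl, if_neg Prec.irrefl, if_true, if_neg (not_le.2 hd), Snapshot.moveTo, Snapshot.stay, setLight]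
  rw [Config.snapshot_light, duoConfig_light_left, Frame.toPlane_zero]

theorem dec_outward (T : Terrain p r r' X) (hx : x₀ < X) (hτ : τ = 1 ∨ τ = -1)
    (hh : 0 < τ * (h' - h))
    (hK : 0 < τ * (midline p r r' X - h)) (hK' : 0 < τ * (h' - midline p r r' X))
    (hl : firstColumn (sideList p r r' X (-τ)) =
      firstColumn (sideList p r r' X τ))
    (hd : |h' - midline p r r' X| ≤ |h - midline p r r' X|)
    (hE : ¬ Exposed p r r' x₀ τ h) :
    dec stage2 F (pairConfig p r r' x₀ h h' Light.candidate) r =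
      (Light.candidate, (x₀, h - τ * |h - midline p r r' X|)) := by
  rw [dec_pair T hx hτ hh (Or.inl rfl), phase2Candidate_eq T hx hτ hh _ rfl rfl rfl rfl rfl rfl]
  have hs := phase2Candidate_opposite hK hK'
  have hu := (F r).unit_pos.ne'
  simp only [reduceCtorEq, if_false, if_neg hs, hl, if_neg Prec.irrefl, if_true, if_pos hd, if_neg hE, Snapshot.moveTo, Snapshot.stay, setLight]
  simp only [Frame.toPlane, Frame.orient, Config.snapshot_light, duoConfig_light_left,
    Prod.mk.injEq, true_and]
  constructor
  · ring
  · field_simp; ring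

theorem dec_prec_left (T : Terrain p r r' X) (hx : x₀ < X) (hτ : τ = 1 ∨ τ = -1)
    (hh : 0 < τ * (h' - h))
    (hK : 0 < τ * (midline p r r' X - h)) (hK' : 0 < τ * (h' - midline p r r' X))
    (hl : firstColumn (sideList p r r' X (-τ)) =
      firstColumn (sideList p r r' X τ))
    (hd : |h' - midline p r r' X| ≤ |h - midline p r r' X|)
    (hE : Exposed p r r' x₀ τ h)
    (hp : Prec (sideList p r r' X (-τ)) (sideList p r r' X τ)) :
    GoesLeft p r r' X x₀ τ h h'
      (dec stage2 F (pairConfig p r r' x₀ h h' Light.candidate) r) := by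
  rw [dec_pair T hx hτ hh (Or.inl rfl), phase2Candidate_eq T hx hτ hh _ rfl rfl rfl rfl rfl rfl]
  have hs := phase2Candidate_opposite hK hK'
  simp only [reduceCtorEq, if_false, if_neg hs, hl, if_neg Prec.irrefl, if_true, if_pos hd, if_pos hE, if_pos hp, Snapshot.moveTo, Snapshot.stay, setLight]
  rw [Config.snapshot_light, duoConfig_light_left]
  exact goesLeft_computeDestination2 T hx hτ hh _

theorem dec_prec_right (T : Terrain p r r' X) (hx : x₀ < X) (hτ : τ = 1 ∨ τ = -1)
    (hh : 0 < τ * (h' - h))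
    (hK : 0 < τ * (midline p r r' X - h)) (hK' : 0 < τ * (h' - midline p r r' X))
    (hl : firstColumn (sideList p r r' X (-τ)) =
      firstColumn (sideList p r r' X τ))
    (hd : |h' - midline p r r' X| ≤ |h - midline p r r' X|)
    (hE : Exposed p r r' x₀ τ h)
    (hp : Prec (sideList p r r' X τ) (sideList p r r' X (-τ))) :
    dec stage2 F (pairConfig p r r' x₀ h h' Light.candidate) r =
      (Light.candidate, (x₀ + (X - x₀) / 2, h)) := by
  rw [dec_pair T hx hτ hh (Or.inl rfl), phase2Candidate_eq T hx hτ hh _ rfl rfl rfl rfl rfl rfl]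
  have hs := phase2Candidate_opposite hK hK'
  have hu := (F r).unit_pos.ne'
  simp only [reduceCtorEq, if_false, if_neg hs, hl, if_neg Prec.irrefl, if_true, if_pos hd, if_pos hE, if_neg (Prec.asymm hp), if_pos hp, Snapshot.moveTo, Snapshot.stay, setLight]
  simp only [Frame.toPlane, Frame.orient, Config.snapshot_light, duoConfig_light_left,
    Prod.mk.injEq, true_and]
  constructor
  · field_simp
  · ring

theorem dec_eq_left (T : Terrain p r r' X) (hx : x₀ < X) (hτ : τ = 1 ∨ τ = -1)
    (hh : 0 < τ * (h' - h))
    (hK : 0 < τ * (midline p r r' X - h)) (hK' : 0 < τ * (h' - midline p r r' X))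
    (hd : |h' - midline p r r' X| ≤ |h - midline p r r' X|)
    (hE : Exposed p r r' x₀ τ h)
    (hp : (sideList p r r' X (-τ)) = (sideList p r r' X τ))
    (hn : ∀ j, j ≠ r → j ≠ r' → (p j).2 ≠ midline p r r' X) :
    GoesLeft p r r' X x₀ τ h h'
      (dec stage2 F (pairConfig p r r' x₀ h h' Light.candidate) r) := by
  rw [dec_pair T hx hτ hh (Or.inl rfl), phase2Candidate_eq T hx hτ hh _ rfl rfl rfl rfl rfl rfl]
  have hs := phase2Candidate_opposite hK hK'
  simp only [reduceCtorEq, if_false, if_neg hs, if_neg Prec.irrefl, if_true, if_pos hd, if_pos hE, hp, if_pos hn, Snapshot.moveTo, Snapshot.stay, setLight]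
  rw [Config.snapshot_light, duoConfig_light_left]
  exact goesLeft_computeDestination2 T hx hτ hh _

theorem dec_eq_symmetry (T : Terrain p r r' X) (hx : x₀ < X) (hτ : τ = 1 ∨ τ = -1)
    (hh : 0 < τ * (h' - h))
    (hK : 0 < τ * (midline p r r' X - h)) (hK' : 0 < τ * (h' - midline p r r' X))
    (hd : |h' - midline p r r' X| ≤ |h - midline p r r' X|)
    (hE : Exposed p r r' x₀ τ h)
    (hp : (sideList p r r' X (-τ)) = (sideList p r r' X τ))
    (hn : ¬ ∀ j, j ≠ r → j ≠ r' → (p j).2 ≠ midline p r r' X) :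
    dec stage2 F (pairConfig p r r' x₀ h h' Light.candidate) r =
      (Light.symmetry, (x₀, h)) := by
  rw [dec_pair T hx hτ hh (Or.inl rfl), phase2Candidate_eq T hx hτ hh _ rfl rfl rfl rfl rfl rfl]
  have hs := phase2Candidate_opposite hK hK'
  simp only [reduceCtorEq, if_false, if_neg hs, if_neg Prec.irrefl, if_true, if_pos hd, if_pos hE, hp, if_neg hn, Snapshot.moveTo, Snapshot.stay, setLight]
  rw [Frame.toPlane_zero]

end Rule

/-! ### Two candidates of the same abscissa, one of which leaves the column -/

section Leaning

variable {n : ℕ} {stage2 : Snapshot → Action} {F : Fin n → Frame}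
  {p : Fin n → ℝ × ℝ} {r r' : Fin n} {X x₀ τ : ℝ} {I I' : Set ℝ} {ρ ρ' : ℝ → ℕ}

/-- The rules by which two candidates on the vertical line `x₀`, at heights in `I` and `I'`, act if
the tie between them is broken: `r` only goes outwards or to the left, `r'` only goes outwards or
halfway to the next column (the latter only if it is beyond all robots of that column). Outward
moves decrease the ranks `ρ` and `ρ'`. In every situation, one of the two has to act at its
destination, wherever on its way the other one is. -/
structure Leaning (stage2 : Snapshot → Action) (F : Fin n → Frame) (p : Fin n → ℝ × ℝ)
    (r r' : Fin n) (X x₀ τ : ℝ) (I I' : Set ℝ) (ρ ρ' : ℝ → ℕ) : Prop where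
  conn : I.OrdConnected
  conn' : I'.OrdConnected
  below : ∀ h ∈ I, ∀ h' ∈ I', 0 < τ * (h' - h)
  look : ∀ h ∈ I, ∀ h' ∈ I',
    dec stage2 F (pairConfig p r r' x₀ h h' Light.candidate) r = (Light.candidate, (x₀, h)) ∨
    (∃ h₁ ∈ I, τ * h₁ ≤ τ * h ∧ ρ h₁ < ρ h ∧
      dec stage2 F (pairConfig p r r' x₀ h h' Light.candidate) r = (Light.candidate, (x₀, h₁))) ∨
    GoesLeft p r r' X x₀ τ h h' (dec stage2 F (pairConfig p r r' x₀ h h' Light.candidate) r)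
  look' : ∀ h ∈ I, ∀ h' ∈ I',
    dec stage2 F (pairConfig p r r' x₀ h h' Light.candidate) r' = (Light.candidate, (x₀, h')) ∨
    (∃ h₁ ∈ I', τ * h' ≤ τ * h₁ ∧ ρ' h₁ < ρ' h' ∧
      dec stage2 F (pairConfig p r r' x₀ h h' Light.candidate) r' =
        (Light.candidate, (x₀, h₁))) ∨
    (dec stage2 F (pairConfig p r r' x₀ h h' Light.candidate) r' =
        (Light.candidate, (x₀ + (X - x₀) / 2, h')) ∧
      ∀ j, j ≠ r → j ≠ r' → (p j).1 = X → τ * (p j).2 ≤ τ * h')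
  act : ∀ h ∈ I, ∀ h' ∈ I',
    (∀ k' ∈ I', τ * k' ≤ τ * h' →
      dec stage2 F (pairConfig p r r' x₀ h k' Light.candidate) r ≠ (Light.candidate, (x₀, h))) ∨
    (∀ k ∈ I, τ * h ≤ τ * k →
      dec stage2 F (pairConfig p r r' x₀ k h' Light.candidate) r' ≠ (Light.candidate, (x₀, h')))

/-- The states reached while both candidates are on the vertical line `x₀`. -/
structure InColumn (p : Fin n → ℝ × ℝ) (r r' : Fin n) (X x₀ τ : ℝ) (I I' : Set ℝ) (a b : Rob) :
    Prop where
  apart : Apart p r r' X τ a b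
  left : a.pos.1 = x₀
  right : b.pos.1 = x₀
  height : a.pos.2 ∈ I
  height_tgt : a.tgt.2 ∈ I
  height' : b.pos.2 ∈ I'
  height_tgt' : b.tgt.2 ∈ I'
  extreme : b.tgt.1 = x₀ ∨ ∀ j, j ≠ r → j ≠ r' → (p j).1 = X → τ * (p j).2 ≤ τ * b.pos.2
  light : a.light = Light.candidate
  nl : a.nl = Light.candidate
  light' : b.light = Light.candidate
  nl' : b.nl = Light.candidate

theorem mem_of_mem_segment (hI : I.OrdConnected) {P Q R : ℝ × ℝ} (hP : P.2 ∈ I) (hQ : Q.2 ∈ I)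
    (hR : R ∈ segment ℝ P Q) : R.2 ∈ I := by
  obtain ⟨θ, h0, h1, -, hy⟩ := exists_of_mem_segment hR
  rw [hy]
  rcases le_total P.2 Q.2 with h | h
  · exact hI.out hP hQ ⟨by nlinarith, by nlinarith⟩
  · exact hI.out hQ hP ⟨by nlinarith, by nlinarith⟩

namespace InColumn

variable {a b a' b' : Rob}

theorem act_left (T : Terrain p r r' X) (hI : I.OrdConnected)
    (h : InColumn p r r' X x₀ τ I I' a b) (ha : Act a a') :
    (InColumn p r r' X x₀ τ I I' a' b ∧ a'.tgt = a.tgt) ∨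
      Win (algorithm n stage2) F (duo p r r' a' b) := by
  have h1 := h.apart.act_left ha
  have h2 := h.apart.left
  cases ha with
  | color => exact Or.inl ⟨⟨h1, h.2, h.3, h.4, h.5, h.6, h.7, h.8, h.nl, h.10, h.11, h.12⟩, rfl⟩
  | move q hl hq =>
    by_cases hx : q.1 = x₀
    · exact Or.inl ⟨⟨h1, hx, h.3, mem_of_mem_segment hI h.4 h.5 hq, h.5, h.6, h.7, h.8, h.9, h.10,
        h.11, h.12⟩, rfl⟩
    · right
      refine win_of_apart T h1 ?_ h.9 h.10 h.11 h.12
      have h3 := h1.le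
      rw [h.right] at h3 ⊢
      exact lt_of_le_of_ne h3 hx

theorem act_right (T : Terrain p r r' X) (hI' : I'.OrdConnected)
    (h : InColumn p r r' X x₀ τ I I' a b) (hb : Act b b') :
    (InColumn p r r' X x₀ τ I I' a b' ∧ b'.tgt = b.tgt) ∨
      Win (algorithm n stage2) F (duo p r r' a b') := by
  have h1 := h.apart.act_right hb
  cases hb with
  | color => exact Or.inl ⟨⟨h1, h.2, h.3, h.4, h.5, h.6, h.7, h.8, h.9, h.10, h.nl', h.12⟩, rfl⟩
  | move q hl hq =>
    by_cases hx : q.1 = x₀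
    · refine Or.inl ⟨⟨h1, h.2, hx, h.4, h.5, mem_of_mem_segment hI' h.6 h.7 hq, h.7, ?_, h.9, h.10,
        h.11, h.12⟩, rfl⟩
      refine h.extreme.imp id fun H j hj hj' hX => (H j hj hj' hX).trans ?_
      obtain ⟨θ, h0, h1, -, hy⟩ := exists_of_mem_segment hq
      have h2 := h.apart.up
      simp only [hy]
      nlinarith
    · right
      refine win_of_apart T h1 ?_ h.9 h.10 h.11 h.12
      have h3 := h1.le
      rw [h.left] at h3 ⊢
      exact lt_of_le_of_ne h3 (Ne.symm hx)

theorem calm (h : InColumn p r r' X x₀ τ I I' a b) :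
    Calm p r r' X a.pos b.pos a.light b.light :=
  h.apart.calm (by rw [h.light]; exact Light.noConfusion) (by rw [h.light']; exact Light.noConfusion)
    (by rw [h.light]; exact Light.noConfusion)

theorem config (h : InColumn p r r' X x₀ τ I I' a b) :
    duoConfig p r r' a.pos b.pos a.light b.light =
      pairConfig p r r' x₀ a.pos.2 b.pos.2 Light.candidate := by
  rw [h.light, h.light', pairConfig, ← h.left]
  congr 1
  ext
  · exact h.right.trans h.left.symm
  · rfl

end InColumn

/-- The number of actions that a robot of the column can still take. -/
def columnRank (x₀ : ℝ) (ρ : ℝ → ℕ) (a : Rob) : ℕ := if a.tgt.1 = x₀ then ρ a.tgt.2 + 1 else 0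

namespace Leaning

variable {a b : Rob}

theorem look_left (hx : x₀ < X)
    (L : Leaning stage2 F p r r' X x₀ τ I I' ρ ρ')
    (h : InColumn p r r' X x₀ τ I I' a b) (ha : a.pos = a.tgt) {d : Light × (ℝ × ℝ)}
    (hd : d = dec stage2 F (duoConfig p r r' a.pos b.pos a.light b.light) r) :
    d = (Light.candidate, a.pos) ∨ (InColumn p r r' X x₀ τ I I' (a.plan d) b ∧
      columnRank x₀ ρ (a.plan d) < columnRank x₀ ρ a) := by
  have h0 := h.config
  have hpos : a.pos = (x₀, a.pos.2) := by rw [← h.left]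
  have hb := h.apart.right
  have hr := h.right
  rw [hr] at hb
  have hbt := h.apart.lt
  have hbelow := L.below _ h.height _ h.height'
  have hrank : columnRank x₀ ρ a = ρ a.pos.2 + 1 := by
    rw [columnRank, ← ha, if_pos h.left]
  rw [h0] at hd
  -- the robots of the first column do not see `r'` in front of `r`
  have hhide : ∀ t ≤ x₀, (∀ j, j ≠ r → j ≠ r' → (p j).1 = X →
      (x₀ - t) * (τ * ((p j).2 - b.pos.2)) < (X - x₀) * (τ * (b.pos.2 - a.pos.2))) →
      ∀ j, j ≠ r → j ≠ r' → (p j).1 = X → (b.tgt.1 - t) * (τ * ((p j).2 - b.pos.2)) <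
        (X - b.tgt.1) * (τ * (b.pos.2 - a.pos.2)) := by
    intro t ht H j hj hj' hX
    rcases h.extreme with h1 | h1
    · rw [h1]; exact H j hj hj' hX
    · have h2 := h1 j hj hj' hX
      refine lt_of_le_of_lt (mul_nonpos_of_nonneg_of_nonpos ?_ ?_)
        (mul_pos (by linarith) hbelow)
      · linarith
      · linarith
  rcases L.look _ h.height _ h.height' with h1 | ⟨h₁, hI, hle, hρ, h1⟩ | ⟨t, ht, h1, h2⟩
  · left
    rw [hd, h1, hpos]
  · right
    rw [← hd] at h1
    subst h1
    refine ⟨⟨⟨h.apart.le, h.left.ge, h.apart.right, hbt, hle, h.apart.below, h.apart.up, ?_⟩,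
      h.left, hr, h.height, hI, h.6, h.7, h.8, h.9, rfl, h.11, h.12⟩, ?_⟩
    · refine hhide x₀ le_rfl fun j hj hj' hX => ?_
      rw [sub_self, zero_mul]
      exact mul_pos (by linarith) hbelow
    · rw [hrank]
      simp only [columnRank, Rob.plan, if_true]
      omega
  · right
    rw [← hd] at h1
    subst h1
    refine ⟨⟨⟨h.apart.le, ?_, h.apart.right, hbt, le_rfl, h.apart.below, h.apart.up, ?_⟩,
      h.left, hr, h.height, h.height, h.6, h.7, h.8, h.9, rfl, h.11, h.12⟩, ?_⟩
    · simp only [Rob.plan, h.left]; linarith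
    · refine hhide (x₀ - t) (by linarith) fun j hj hj' hX => ?_
      rw [sub_sub_cancel]
      exact h2 j hj hj' hX
    · rw [hrank, columnRank, if_neg]
      · omega
      · intro h
        simp only [Rob.plan] at h
        linarith

theorem look_right (hx : x₀ < X)
    (L : Leaning stage2 F p r r' X x₀ τ I I' ρ ρ')
    (h : InColumn p r r' X x₀ τ I I' a b) (hb : b.pos = b.tgt) {d : Light × (ℝ × ℝ)}
    (hd : d = dec stage2 F (duoConfig p r r' a.pos b.pos a.light b.light) r') :
    d = (Light.candidate, b.pos) ∨ (InColumn p r r' X x₀ τ I I' a (b.plan d) ∧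
      columnRank x₀ ρ' (b.plan d) < columnRank x₀ ρ' b) := by
  have h0 := h.config
  have hpos : b.pos = (x₀, b.pos.2) := by rw [← h.right]
  have hl := h.left
  have hat := h.apart.left
  have hbelow := L.below _ h.height _ h.height'
  have hrank : columnRank x₀ ρ' b = ρ' b.pos.2 + 1 := by
    rw [columnRank, ← hb, if_pos h.right]
  have hhide := h.apart.hide
  rw [← hb, h.right] at hhide
  rw [h0] at hd
  rcases L.look' _ h.height _ h.height' with h1 | ⟨h₁, hI, hle, hρ, h1⟩ | ⟨h1, h2⟩
  · left
    rw [hd, h1, hpos]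
  · right
    rw [← hd] at h1
    subst h1
    refine ⟨⟨⟨h.apart.le, h.apart.left, h.right.le, hx, h.apart.down, h.apart.below, hle, hhide⟩,
      h.left, h.right, h.4, h.5, h.6, hI, Or.inl rfl, h.9, h.10, h.11, rfl⟩, ?_⟩
    rw [hrank]
    simp only [columnRank, Rob.plan, if_true]
    omega
  · right
    rw [← hd] at h1
    subst h1
    refine ⟨⟨⟨h.apart.le, h.apart.left, ?_, ?_, h.apart.down, h.apart.below, le_rfl, ?_⟩,
      h.left, h.right, h.4, h.5, h.6, h.6, Or.inr h2, h.9, h.10, h.11, rfl⟩, ?_⟩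
    · simp only [Rob.plan, h.right]; linarith
    · simp only [Rob.plan]; linarith
    · intro j hj hj' hX
      have h3 := h2 j hj hj' hX
      simp only [Rob.plan]
      refine lt_of_le_of_lt (mul_nonpos_of_nonneg_of_nonpos ?_ ?_) (mul_pos ?_ hbelow) <;> linarith
    · rw [hrank, columnRank, if_neg]
      · omega
      · intro h
        simp only [Rob.plan] at h
        linarith

theorem win_of_inColumn (T : Terrain p r r' X) (hx : x₀ < X)
    (L : Leaning stage2 F p r r' X x₀ τ I I' ρ ρ')
    (h : InColumn p r r' X x₀ τ I I' a b) : Win (algorithm n stage2) F (duo p r r' a b) := by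
  induction hN : columnRank x₀ ρ a + columnRank x₀ ρ' b using Nat.strong_induction_on
    generalizing a b with
  | _ N ih =>
  have ih' : ∀ a' b', InColumn p r r' X x₀ τ I I' a' b' →
      columnRank x₀ ρ a' + columnRank x₀ ρ' b' < N →
      Win (algorithm n stage2) F (duo p r r' a' b') := fun a' b' h1 h2 => ih _ h2 h1 rfl
  let R : Rob → Rob → Prop := fun a' b' =>
    InColumn p r r' X x₀ τ I I' a' b' ∧ a'.tgt = a.tgt ∧ b'.tgt = b.tgt
  have hrank : ∀ (ρ : ℝ → ℕ) (a a' : Rob), a'.tgt = a.tgt →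
      columnRank x₀ ρ a' = columnRank x₀ ρ a := fun ρ a a' h => by rw [columnRank, h, columnRank]
  have hact : ∀ a' b' a'', R a' b' → Act a' a'' → ¬ R a'' b' →
      Win (algorithm n stage2) F (duo p r r' a'' b') := by
    rintro a' b' a'' ⟨h1, h2, h3⟩ h4 h5
    rcases h1.act_left (stage2 := stage2) (F := F) T L.conn h4 with ⟨h6, h7⟩ | h6
    · exact absurd ⟨h6, h7.trans h2, h3⟩ h5
    · exact h6
  have hact' : ∀ a' b' b'', R a' b' → Act b' b'' → ¬ R a' b'' →
      Win (algorithm n stage2) F (duo p r r' a' b'') := by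
    rintro a' b' a'' ⟨h1, h2, h3⟩ h4 h5
    rcases h1.act_right (stage2 := stage2) (F := F) T L.conn' h4 with ⟨h6, h7⟩ | h6
    · exact absurd ⟨h6, h2, h7.trans h3⟩ h5
    · exact h6
  have hlook : ∀ a' b', R a' b' → a'.pos = a'.tgt → ∀ d,
      d = dec stage2 F (duoConfig p r r' a'.pos b'.pos a'.light b'.light) r →
      d ≠ (Light.candidate, a'.pos) → Win (algorithm n stage2) F (duo p r r' (a'.plan d) b') := by
    rintro a' b' ⟨h1, h2, h3⟩ h4 d hd h5
    obtain ⟨h6, h7⟩ := (L.look_left hx h1 h4 hd).resolve_left h5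
    refine ih' _ _ h6 ?_
    rw [hrank ρ a a' h2] at h7
    rw [hrank ρ' b b' h3]
    omega
  have hlook' : ∀ a' b', R a' b' → b'.pos = b'.tgt → ∀ d,
      d = dec stage2 F (duoConfig p r r' a'.pos b'.pos a'.light b'.light) r' →
      d ≠ (Light.candidate, b'.pos) → Win (algorithm n stage2) F (duo p r r' a' (b'.plan d)) := by
    rintro a' b' ⟨h1, h2, h3⟩ h4 d hd h5
    obtain ⟨h6, h7⟩ := (L.look_right hx h1 h4 hd).resolve_left h5
    refine ih' _ _ h6 ?_
    rw [hrank ρ' b b' h3] at h7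
    rw [hrank ρ a a' h2]
    omega
  -- a snapshot after which the robot stays does not leave the stage
  have hstay : ∀ a' b', R a' b' → a'.pos = a'.tgt → ∀ d, ¬ R (a'.plan d) b' →
      d ≠ (Light.candidate, a'.pos) := by
    rintro a' b' ⟨h1, h2, h3⟩ h4 d h5 rfl
    refine h5 ⟨⟨?_, h1.2, h1.3, h1.4, h1.4, h1.6, h1.7, h1.8, h1.9, rfl, h1.11, h1.12⟩,
      h4.trans h2, h3⟩
    have h6 := h1.apart
    refine ⟨h6.1, le_rfl, h6.3, h6.4, le_rfl, h6.6, h6.7, ?_⟩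
    have h7 := h6.hide
    rw [← h4] at h7
    exact h7
  have hstay' : ∀ a' b', R a' b' → b'.pos = b'.tgt → ∀ d, ¬ R a' (b'.plan d) →
      d ≠ (Light.candidate, b'.pos) := by
    rintro a' b' ⟨h1, h2, h3⟩ h4 d h5 rfl
    refine h5 ⟨⟨h1.apart.plan_right h4 _, h1.2, h1.3, h1.4, h1.5, h1.6, h1.6, ?_, h1.9, h1.10,
      h1.11, rfl⟩, h2, h4.trans h3⟩
    exact Or.inl h1.right
  have hl : (a.tgt.1 ≠ x₀ ∨ ∀ k' ∈ I', τ * k' ≤ τ * b.tgt.2 →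
      dec stage2 F (pairConfig p r r' x₀ a.tgt.2 k' Light.candidate) r ≠
        (Light.candidate, (x₀, a.tgt.2))) ∨
      (∀ k ∈ I, τ * a.tgt.2 ≤ τ * k →
      dec stage2 F (pairConfig p r r' x₀ k b.tgt.2 Light.candidate) r' ≠
        (Light.candidate, (x₀, b.tgt.2))) := by
    rcases L.act _ h.height_tgt _ h.height_tgt' with h1 | h1
    · exact Or.inl (Or.inr h1)
    · exact Or.inr h1
  rcases hl with hl | hl
  · refine win_duo T R (fun a b h => h.1.calm) hact hact' ?_
      (fun a' b' h1 h2 _ h4 => hlook' a' b' h1 h2 _ rfl (hstay' a' b' h1 h2 _ h4)) ⟨h, rfl, rfl⟩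
    intro a' b' h1 h2 _
    refine hlook a' b' h1 h2 _ rfl ?_
    rw [h1.1.config]
    have h4 : a'.pos.2 = a.tgt.2 := by rw [h2, h1.2.1]
    rcases hl with hl | hl
    · exact absurd (by rw [← h1.2.1, ← h2, h1.1.left]) hl
    · have h5 := hl b'.pos.2 h1.1.height' (by rw [← h1.2.2]; exact h1.1.apart.up)
      rw [← h4, ← h1.1.left] at h5
      rw [← h1.1.left]
      exact h5
  · refine win_duo_right T R (fun a b h => h.1.calm) hact hact' ?_
      (fun a' b' h1 h2 _ h4 => hlook a' b' h1 h2 _ rfl (hstay a' b' h1 h2 _ h4)) ⟨h, rfl, rfl⟩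
    intro a' b' h1 h2 _
    refine hlook' a' b' h1 h2 _ rfl ?_
    rw [h1.1.config]
    have h4 : b'.pos.2 = b.tgt.2 := by rw [h2, h1.2.2]
    have h5 := hl a'.pos.2 h1.1.height (by rw [← h1.2.1]; exact h1.1.apart.down)
    rw [← h4, ← h1.1.right] at h5
    rw [← h1.1.right]
    exact h5

/-- Two resting candidates, the tie between which is broken. -/
theorem win (T : Terrain p r r' X) (hx : x₀ < X)
    (L : Leaning stage2 F p r r' X x₀ τ I I' ρ ρ') {h h' : ℝ} (hI : h ∈ I) (hI' : h' ∈ I') :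
    Win (algorithm n stage2) F (duo p r r' (Rob.idle (x₀, h) Light.candidate)
      (Rob.idle (x₀, h') Light.candidate)) := by
  have h1 := L.below h hI h' hI'
  refine L.win_of_inColumn T hx ⟨⟨le_rfl, le_rfl, le_rfl, hx, le_rfl, ?_, le_rfl, ?_⟩, rfl, rfl,
    hI, hI, hI', hI', Or.inl rfl, rfl, rfl, rfl, rfl⟩
  · simp only [Rob.idle]; linarith
  · intro j _ _ _
    simp only [Rob.idle, sub_self, zero_mul]
    exact mul_pos (by linarith) h1

end Leaning

end Leaning

/-! ### How ties between two candidates of the same abscissa are broken -/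

section Verdict

variable {n : ℕ} {stage2 : Snapshot → Action} {F : Fin n → Frame}
  {p : Fin n → ℝ × ℝ} {r r' : Fin n} {X x₀ h h' τ K H : ℝ}

theorem pairConfig_swap (hne : r ≠ r') : pairConfig p r r' x₀ h h' Light.candidate =
    pairConfig p r' r x₀ h' h Light.candidate := duoConfig_swap hne _ _ _ _

/-- Far enough from the midline, a robot sees all others: every pair of robots obstructs the view
from at most one point of the vertical line. -/
theorem exists_exposed (T : Terrain p r r' X) (hx : x₀ < X) (hτ : τ = 1 ∨ τ = -1) (K : ℝ) :
    ∃ H, ∀ h, H ≤ τ * (K - h) → Exposed p r r' x₀ τ h := by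
  have hττ : τ * τ = 1 := by rcases hτ with rfl | rfl <;> norm_num
  have key : ∀ᶠ t : ℝ in Filter.atTop, Exposed p r r' x₀ τ (K - τ * t) := by
    refine Filter.Eventually.and ?_ ?_
    · simp only [Filter.eventually_all]
      intro j hj hj' k hk hk' hkj
      have hxj := hx.trans_le (T.le j hj hj')
      filter_upwards [Filter.eventually_ne_atTop (τ * (K - ((p k).2 -
        ((p k).1 - x₀) / ((p j).1 - x₀) * (p j).2) / (1 - ((p k).1 - x₀) / ((p j).1 - x₀))))]
        with t ht hs
      obtain ⟨θ, -, -, hx', hy'⟩ := exists_of_mem_segment hs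
      simp only at hx' hy'
      have hθ : θ = ((p k).1 - x₀) / ((p j).1 - x₀) := by
        rw [eq_div_iff (by linarith)]; linarith
      by_cases h1 : θ = 1
      · rw [h1] at hx' hy'
        exact hkj (T.inj k j hk hk' hj hj' (Prod.ext (by linarith) (by linarith)))
      · rw [← hθ] at ht
        apply ht
        have h2 : 1 - θ ≠ 0 := fun h => h1 (by linarith)
        have h3 : ((p k).2 - θ * (p j).2) / (1 - θ) = K - τ * t := by
          rw [div_eq_iff h2]; linarith
        rw [h3]
        linear_combination (-t) * hττ
    · simp only [Filter.eventually_all]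
      intro j hj hj'
      filter_upwards [Filter.eventually_ge_atTop (τ * (K - (p j).2))] with t ht
      linear_combination ht - t * hττ
  obtain ⟨H, hH⟩ := Filter.eventually_atTop.1 key
  refine ⟨H, fun h hh => ?_⟩
  have := hH _ hh
  rwa [show K - τ * (τ * (K - h)) = h by linear_combination (-(K - h)) * hττ] at this

/-- A bound for the number of outward moves, which double the distance from the midline. -/
def outRank (K H h : ℝ) : ℕ := ⌊H / |h - K|⌋₊

theorem outRank_lt (hτ : τ = 1 ∨ τ = -1) (hK : 0 < τ * (K - h)) (hH : τ * (K - h) < H) :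
    outRank K H (h - τ * |h - K|) < outRank K H h := by
  have h1 : |h - K| = τ * (K - h) := by
    rcases hτ with rfl | rfl
    · rw [abs_of_neg (by linarith)]; ring
    · rw [abs_of_pos (by linarith)]; ring
  have hττ : τ * τ = 1 := by rcases hτ with rfl | rfl <;> norm_num
  have h2 : |h - τ * |h - K| - K| = 2 * |h - K| := by
    rw [h1, show h - τ * (τ * (K - h)) - K = 2 * (h - K) by
      linear_combination (-(K - h)) * hττ, abs_mul, abs_of_pos (by norm_num : (0 : ℝ) < 2), h1]
  rw [outRank, outRank, h2, h1]
  have h3 : 1 ≤ H / (τ * (K - h)) := by rw [le_div_iff₀ hK]; linarith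
  have h4 : H / (2 * (τ * (K - h))) = H / (τ * (K - h)) / 2 := by
    rw [mul_comm, div_div]
  rw [h4, Nat.floor_lt (by linarith)]
  have h5 := Nat.lt_floor_add_one (H / (τ * (K - h)))
  have h6 : (1 : ℝ) ≤ ⌊H / (τ * (K - h))⌋₊ := by exact_mod_cast Nat.one_le_floor_iff _ |>.2 h3
  linarith

theorem GoesLeft.ne_stay {d : Light × (ℝ × ℝ)} {k k' l : ℝ}
    (hd : GoesLeft p r r' X x₀ τ k k' d) : d ≠ (Light.candidate, (x₀, l)) := by
  obtain ⟨b, hb, rfl, -⟩ := hd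
  simp only [ne_eq, Prod.mk.injEq, true_and, not_and]
  intro h
  linarith

theorem abs_eq_below (hτ : τ = 1 ∨ τ = -1) (hK : 0 ≤ τ * (K - h)) : |h - K| = τ * (K - h) := by
  rcases hτ with rfl | rfl
  · rw [abs_of_nonpos (by linarith)]; ring
  · rw [abs_of_nonneg (by linarith)]; ring

theorem abs_eq_above (hτ : τ = 1 ∨ τ = -1) (hK : 0 ≤ τ * (h - K)) : |h - K| = τ * (h - K) := by
  rcases hτ with rfl | rfl
  · rw [abs_of_nonneg (by linarith)]; ring
  · rw [abs_of_nonpos (by linarith)]; ring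

/-- The far robot goes outwards until it sees everything; then it does what `hd` says. -/
theorem dec_outward_or (T : Terrain p r r' X) (hx : x₀ < X) (hτ : τ = 1 ∨ τ = -1)
    (hh : 0 < τ * (h' - h))
    (hK : 0 < τ * (midline p r r' X - h)) (hK' : 0 < τ * (h' - midline p r r' X))
    (hl : firstColumn (sideList p r r' X (-τ)) = firstColumn (sideList p r r' X τ))
    (hd : |h' - midline p r r' X| ≤ |h - midline p r r' X|)
    (hH : ∀ h, H ≤ τ * (midline p r r' X - h) → Exposed p r r' x₀ τ h) :
    Exposed p r r' x₀ τ h ∨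
    ∃ h₁, τ * h₁ < τ * h ∧ outRank (midline p r r' X) H h₁ < outRank (midline p r r' X) H h ∧
      dec stage2 F (pairConfig p r r' x₀ h h' Light.candidate) r =
        (Light.candidate, (x₀, h₁)) := by
  by_cases hE : Exposed p r r' x₀ τ h
  · exact Or.inl hE
  · refine Or.inr ⟨_, ?_, ?_, dec_outward T hx hτ hh hK hK' hl hd hE⟩
    · rw [abs_eq_below hτ hK.le]
      have hττ : τ * τ = 1 := by rcases hτ with rfl | rfl <;> norm_num
      have : τ * (h - τ * (τ * (midline p r r' X - h))) = τ * h - τ * (midline p r r' X - h) := by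
        linear_combination (-(τ * (midline p r r' X - h))) * hττ
      linarith
    · exact outRank_lt hτ hK (not_le.1 fun h1 => hE (hH _ h1))

/-- The first robot leaves the column at once, the second waits. -/
theorem win_of_left_stay (T : Terrain p r r' X) (hx : x₀ < X)
    (hh : 0 < τ * (h' - h))
    (h1 : GoesLeft p r r' X x₀ τ h h'
      (dec stage2 F (pairConfig p r r' x₀ h h' Light.candidate) r))
    (h2 : dec stage2 F (pairConfig p r' r x₀ h' h Light.candidate) r' =
      (Light.candidate, (x₀, h'))) :
    Win (algorithm n stage2) F (duo p r r' (Rob.idle (x₀, h) Light.candidate)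
      (Rob.idle (x₀, h') Light.candidate)) := by
  have L : Leaning stage2 F p r r' X x₀ τ {h} {h'} (fun _ => 0) (fun _ => 0) := by
    refine ⟨Set.ordConnected_singleton, Set.ordConnected_singleton, ?_, ?_, ?_, ?_⟩
    · rintro _ rfl _ rfl; exact hh
    · rintro _ rfl _ rfl; exact Or.inr (Or.inr h1)
    · rintro _ rfl _ rfl; left; rw [pairConfig_swap T.ne]; exact h2
    · rintro _ rfl _ rfl
      left
      rintro _ rfl -
      exact h1.ne_stay
  exact L.win T hx rfl rfl

theorem win_of_same_side (T : Terrain p r r' X) (hx : x₀ < X) (hτ : τ = 1 ∨ τ = -1)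
    (hh : 0 < τ * (h' - h))
    (hs : 0 ≤ τ * (midline p r r' X - h) ∧ τ * (h' - midline p r r' X) ≤ 0 ∨
      τ * (midline p r r' X - h) ≤ 0 ∧ 0 ≤ τ * (h' - midline p r r' X))
    (hd : |h' - midline p r r' X| < |h - midline p r r' X|) :
    Win (algorithm n stage2) F (duo p r r' (Rob.idle (x₀, h) Light.candidate)
      (Rob.idle (x₀, h') Light.candidate)) := by
  refine win_of_left_stay T hx hh (dec_same_side_left T hx hτ hh hs hd) ?_
  refine dec_same_side_stay (τ := -τ) T.symm hx (by rcases hτ with rfl | rfl <;> simp)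
    (by linarith) ?_ (by rw [midline_swap]; exact hd.le)
  rw [midline_swap]
  rcases hs with ⟨h1, h2⟩ | ⟨h1, h2⟩
  · exact Or.inr ⟨by linarith, by linarith⟩
  · exact Or.inl ⟨by linarith, by linarith⟩

section Opposite

theorem win_of_column_prec (T : Terrain p r r' X) (hx : x₀ < X) (hτ : τ = 1 ∨ τ = -1)
    (hh : 0 < τ * (h' - h))
    (hK : 0 < τ * (midline p r r' X - h)) (hK' : 0 < τ * (h' - midline p r r' X))
    (hl : Prec (firstColumn (sideList p r r' X (-τ))) (firstColumn (sideList p r r' X τ))) :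
    Win (algorithm n stage2) F (duo p r r' (Rob.idle (x₀, h) Light.candidate)
      (Rob.idle (x₀, h') Light.candidate)) := by
  refine win_of_left_stay T hx hh (dec_column_prec_left T hx hτ hh hK hK' hl) ?_
  refine dec_column_prec_stay (τ := -τ) T.symm hx (by rcases hτ with rfl | rfl <;> simp)
    (by linarith) ?_ ?_ ?_
  · rw [midline_swap]; linarith
  · rw [midline_swap]; linarith
  · rw [sideList_swap p r r', sideList_swap p r r', neg_neg]; exact hl

theorem ordConnected_below (τ c : ℝ) : {t : ℝ | τ * t ≤ τ * c}.OrdConnected := by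
  refine ⟨fun a ha b hb t ht => ?_⟩
  simp only [Set.mem_ofPred_eq] at ha hb ⊢
  rcases le_total 0 τ with h | h
  · exact (mul_le_mul_of_nonneg_left ht.2 h).trans hb
  · exact (mul_le_mul_of_nonpos_left ht.1 h).trans ha

theorem ordConnected_above (τ c : ℝ) : {t : ℝ | τ * c ≤ τ * t}.OrdConnected := by
  have := ordConnected_below (-τ) c
  simpa only [neg_mul, neg_le_neg_iff] using this

/-- The lists of all robots break the tie: `r` leaves to the left, unless `r'` leaves to the
right. -/
theorem win_of_prec (T : Terrain p r r' X) (hx : x₀ < X) (hτ : τ = 1 ∨ τ = -1)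
    (hK : 0 < τ * (midline p r r' X - h)) (hK' : 0 < τ * (h' - midline p r r' X))
    (hl : firstColumn (sideList p r r' X (-τ)) = firstColumn (sideList p r r' X τ))
    (hp : Prec (sideList p r r' X (-τ)) (sideList p r r' X τ)) :
    Win (algorithm n stage2) F (duo p r r' (Rob.idle (x₀, h) Light.candidate)
      (Rob.idle (x₀, h') Light.candidate)) := by
  have hτ' : -τ = 1 ∨ -τ = -1 := by rcases hτ with rfl | rfl <;> simp
  obtain ⟨H, hH⟩ := exists_exposed T hx hτ (midline p r r' X)
  obtain ⟨H', hH'⟩ := exists_exposed T.symm hx hτ' (midline p r r' X)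
  set K := midline p r r' X with hKdef
  have hKs : midline p r' r X = K := midline_swap p r r' X
  have hrs : ∀ ε, sideList p r' r X ε = sideList p r r' X ε := sideList_swap p r r' X
  have hI : ∀ t ∈ {t : ℝ | τ * t ≤ τ * h}, 0 < τ * (K - t) := fun t ht => by
    have : τ * t ≤ τ * h := ht
    linarith
  have hI' : ∀ t ∈ {t : ℝ | τ * h' ≤ τ * t}, 0 < τ * (t - K) := fun t ht => by
    have : τ * h' ≤ τ * t := ht
    linarith
  -- the decisions of the robot that is not nearer to the midline than the other one
  have far : ∀ a ∈ {t : ℝ | τ * t ≤ τ * h}, ∀ b ∈ {t : ℝ | τ * h' ≤ τ * t}, |b - K| ≤ |a - K| →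
      (∃ h₁ ∈ {t : ℝ | τ * t ≤ τ * h}, τ * h₁ < τ * a ∧ outRank K H h₁ < outRank K H a ∧
        dec stage2 F (pairConfig p r r' x₀ a b Light.candidate) r =
          (Light.candidate, (x₀, h₁))) ∨
      GoesLeft p r r' X x₀ τ a b
        (dec stage2 F (pairConfig p r r' x₀ a b Light.candidate) r) := by
    intro a ha b hb hd
    have h1 := hI a ha
    have h2 := hI' b hb
    have h3 : 0 < τ * (b - a) := by linarith
    rcases dec_outward_or (stage2 := stage2) (F := F) T hx hτ h3 h1 h2 hl hd hH
      with hE | ⟨h₁, h4, h5, h6⟩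
    · exact Or.inr (dec_prec_left T hx hτ h3 h1 h2 hl hd hE hp)
    · exact Or.inl ⟨h₁, h4.le.trans ha, h4, h5, h6⟩
  have far' : ∀ a ∈ {t : ℝ | τ * t ≤ τ * h}, ∀ b ∈ {t : ℝ | τ * h' ≤ τ * t}, |a - K| ≤ |b - K| →
      (∃ h₁ ∈ {t : ℝ | τ * h' ≤ τ * t}, τ * b < τ * h₁ ∧ outRank K H' h₁ < outRank K H' b ∧
        dec stage2 F (pairConfig p r r' x₀ a b Light.candidate) r' =
          (Light.candidate, (x₀, h₁))) ∨
      (dec stage2 F (pairConfig p r r' x₀ a b Light.candidate) r' =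
          (Light.candidate, (x₀ + (X - x₀) / 2, b)) ∧
        ∀ j, j ≠ r → j ≠ r' → (p j).1 = X → τ * (p j).2 ≤ τ * b) := by
    intro a ha b hb hd
    have h1 := hI a ha
    have h2 := hI' b hb
    have h3 : 0 < -τ * (a - b) := by linarith
    have h1' : 0 < -τ * (midline p r' r X - b) := by rw [hKs]; linarith
    have h2' : 0 < -τ * (a - midline p r' r X) := by rw [hKs]; linarith
    have hl' : firstColumn (sideList p r' r X (- -τ)) = firstColumn (sideList p r' r X (-τ)) := by
      rw [hrs, hrs, neg_neg]; exact hl.symm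
    rw [pairConfig_swap T.ne]
    rw [← hKs] at hd hH'
    rcases dec_outward_or (stage2 := stage2) (F := F) T.symm hx hτ' h3 h1' h2' hl' hd hH'
      with hE | ⟨h₁, h4, h5, h6⟩
    · refine Or.inr ⟨dec_prec_right T.symm hx hτ' h3 h1' h2' hl' hd hE ?_, fun j hj hj' _ => ?_⟩
      · rw [hrs, hrs, neg_neg]; exact hp
      · have := hE.2 j hj' hj
        linarith
    · rw [hKs] at h5
      refine Or.inl ⟨h₁, ?_, by linarith, h5, h6⟩
      have : τ * h' ≤ τ * b := hb
      simp only [Set.mem_ofPred_eq]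
      linarith
  have near : ∀ a ∈ {t : ℝ | τ * t ≤ τ * h}, ∀ b ∈ {t : ℝ | τ * h' ≤ τ * t}, |a - K| < |b - K| →
      dec stage2 F (pairConfig p r r' x₀ a b Light.candidate) r = (Light.candidate, (x₀, a)) := by
    intro a ha b hb hd
    have h1 := hI a ha
    have h2 := hI' b hb
    exact dec_nearer_stay T hx hτ (by linarith) h1 h2 hl hd
  have near' : ∀ a ∈ {t : ℝ | τ * t ≤ τ * h}, ∀ b ∈ {t : ℝ | τ * h' ≤ τ * t}, |b - K| < |a - K| →
      dec stage2 F (pairConfig p r r' x₀ a b Light.candidate) r' = (Light.candidate, (x₀, b)) := by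
    intro a ha b hb hd
    have h1 := hI a ha
    have h2 := hI' b hb
    rw [pairConfig_swap T.ne]
    refine dec_nearer_stay T.symm hx hτ' (by linarith) ?_ ?_ ?_ ?_
    · rw [hKs]; linarith
    · rw [hKs]; linarith
    · rw [hrs, hrs, neg_neg]; exact hl.symm
    · rw [hKs]; exact hd
  have L : Leaning stage2 F p r r' X x₀ τ {t : ℝ | τ * t ≤ τ * h} {t : ℝ | τ * h' ≤ τ * t}
      (outRank K H) (outRank K H') := by
    refine ⟨ordConnected_below _ _, ordConnected_above _ _, ?_, ?_, ?_, ?_⟩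
    · intro a ha b hb
      have h1 := hI a ha
      have h2 := hI' b hb
      linarith
    · intro a ha b hb
      rcases lt_or_ge |a - K| |b - K| with hd | hd
      · exact Or.inl (near a ha b hb hd)
      · rcases far a ha b hb hd with ⟨h₁, h2, h3, h4, h5⟩ | h1
        · exact Or.inr (Or.inl ⟨h₁, h2, h3.le, h4, h5⟩)
        · exact Or.inr (Or.inr h1)
    · intro a ha b hb
      rcases lt_or_ge |b - K| |a - K| with hd | hd
      · exact Or.inl (near' a ha b hb hd)
      · rcases far' a ha b hb hd with ⟨h₁, h2, h3, h4, h5⟩ | h1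
        · exact Or.inr (Or.inl ⟨h₁, h2, h3.le, h4, h5⟩)
        · exact Or.inr (Or.inr h1)
    · intro a ha b hb
      rcases le_total |b - K| |a - K| with hd | hd
      · left
        intro k hk hkb
        have h0 : |k - K| ≤ |a - K| := by
          refine le_trans ?_ hd
          rw [abs_eq_above hτ (hI' k hk).le, abs_eq_above hτ (hI' b hb).le]
          linarith
        rcases far a ha k hk h0 with ⟨h₁, h2, h3, h4, h5⟩ | h1
        · rw [h5]
          intro heq
          simp only [Prod.mk.injEq, true_and] at heq
          rw [heq] at h3
          exact lt_irrefl _ h3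
        · exact h1.ne_stay
      · right
        intro k hk hkb
        have h0 : |k - K| ≤ |b - K| := by
          refine le_trans ?_ hd
          rw [abs_eq_below hτ (hI k hk).le, abs_eq_below hτ (hI a ha).le]
          linarith
        rcases far' k hk b hb h0 with ⟨h₁, h2, h3, h4, h5⟩ | h1
        · rw [h5]
          intro heq
          simp only [Prod.mk.injEq, true_and] at heq
          rw [heq] at h3
          exact lt_irrefl _ h3
        · rw [h1.1]
          intro heq
          simp only [Prod.mk.injEq, true_and] at heq
          linarith [heq.1]
  exact L.win T hx (h := h) (h' := h') (le_refl (τ * h)) (le_refl (τ * h'))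

/-- If the robots besides `r` and `r'` are placed symmetrically, and none is on the midline, then
the farther one of `r` and `r'` leaves to the left. -/
theorem win_of_farther (T : Terrain p r r' X) (hx : x₀ < X) (hτ : τ = 1 ∨ τ = -1)
    (hK : 0 < τ * (midline p r r' X - h)) (hK' : 0 < τ * (h' - midline p r r' X))
    (hp : sideList p r r' X (-τ) = sideList p r r' X τ)
    (hn : ∀ j, j ≠ r → j ≠ r' → (p j).2 ≠ midline p r r' X)
    (hd : |h' - midline p r r' X| < |h - midline p r r' X|) :
    Win (algorithm n stage2) F (duo p r r' (Rob.idle (x₀, h) Light.candidate)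
      (Rob.idle (x₀, h') Light.candidate)) := by
  have hτ' : -τ = 1 ∨ -τ = -1 := by rcases hτ with rfl | rfl <;> simp
  obtain ⟨H, hH⟩ := exists_exposed T hx hτ (midline p r r' X)
  set K := midline p r r' X with hKdef
  have hKs : midline p r' r X = K := midline_swap p r r' X
  have hrs : ∀ ε, sideList p r' r X ε = sideList p r r' X ε := sideList_swap p r r' X
  have hI : ∀ t ∈ {t : ℝ | τ * t ≤ τ * h}, 0 < τ * (K - t) := fun t ht => by
    have : τ * t ≤ τ * h := ht
    linarith
  have hfar : ∀ t ∈ {t : ℝ | τ * t ≤ τ * h}, |h' - K| < |t - K| := fun t ht => by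
    have h1 : τ * t ≤ τ * h := ht
    refine hd.trans_le ?_
    rw [abs_eq_below hτ (hI t ht).le, abs_eq_below hτ hK.le]
    linarith
  have far : ∀ a ∈ {t : ℝ | τ * t ≤ τ * h},
      (∃ h₁ ∈ {t : ℝ | τ * t ≤ τ * h}, τ * h₁ < τ * a ∧ outRank K H h₁ < outRank K H a ∧
        dec stage2 F (pairConfig p r r' x₀ a h' Light.candidate) r =
          (Light.candidate, (x₀, h₁))) ∨
      GoesLeft p r r' X x₀ τ a h'
        (dec stage2 F (pairConfig p r r' x₀ a h' Light.candidate) r) := by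
    intro a ha
    have h1 := hI a ha
    have h3 : 0 < τ * (h' - a) := by linarith
    rcases dec_outward_or (stage2 := stage2) (F := F) T hx hτ h3 h1 hK' (by rw [hp])
      (hfar a ha).le hH with hE | ⟨h₁, h4, h5, h6⟩
    · exact Or.inr (dec_eq_left T hx hτ h3 h1 hK' (hfar a ha).le hE hp hn)
    · exact Or.inl ⟨h₁, h4.le.trans ha, h4, h5, h6⟩
  have L : Leaning stage2 F p r r' X x₀ τ {t : ℝ | τ * t ≤ τ * h} {h'}
      (outRank K H) (fun _ => 0) := by
    refine ⟨ordConnected_below _ _, Set.ordConnected_singleton, ?_, ?_, ?_, ?_⟩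
    · rintro a ha _ rfl
      have h1 := hI a ha
      linarith
    · rintro a ha _ rfl
      rcases far a ha with ⟨h₁, h2, h3, h4, h5⟩ | h1
      · exact Or.inr (Or.inl ⟨h₁, h2, h3.le, h4, h5⟩)
      · exact Or.inr (Or.inr h1)
    · rintro a ha _ rfl
      left
      have h1 := hI a ha
      rw [pairConfig_swap T.ne]
      refine dec_nearer_stay T.symm hx hτ' (by linarith) ?_ ?_ ?_ ?_
      · rw [hKs]; linarith
      · rw [hKs]; linarith
      · rw [hrs, hrs, neg_neg, hp]
      · rw [hKs]; exact hfar a ha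
    · rintro a ha _ rfl
      left
      rintro _ rfl -
      rcases far a ha with ⟨h₁, h2, h3, h4, h5⟩ | h1
      · rw [h5]
        intro heq
        simp only [Prod.mk.injEq, true_and] at heq
        rw [heq] at h3
        exact lt_irrefl _ h3
      · exact h1.ne_stay
  exact L.win T hx (h := h) (h' := h') (le_refl (τ * h)) rfl

/-- Equal lists on both sides of the midline mean symmetry with respect to the midline. -/
theorem exists_mirror (hτ : τ = 1 ∨ τ = -1)
    (hp : sideList p r r' X (-τ) = sideList p r r' X τ) {j : Fin n} (hj : j ≠ r) (hj' : j ≠ r')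
    (hjK : (p j).2 ≠ midline p r r' X) :
    ∃ k, k ≠ r ∧ k ≠ r' ∧ p k = ((p j).1, 2 * midline p r r' X - (p j).2) := by
  set K := midline p r r' X with hKdef
  have hset : ∀ a, a ∈ sideSet p r r' X (-τ) ↔ a ∈ sideSet p r r' X τ := fun a => by
    have := congrArg (fun l => a ∈ l) hp
    simp only [sideList, Finset.mem_sort] at this
    exact Iff.of_eq this
  have h0 : ∀ ε : ℝ, (ε = 1 ∨ ε = -1) → (∀ a, a ∈ sideSet p r r' X ε ↔ a ∈ sideSet p r r' X (-ε)) →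
      0 < ε * ((p j).2 - K) →
      ∃ k, k ≠ r ∧ k ≠ r' ∧ p k = ((p j).1, 2 * K - (p j).2) := by
    intro ε hε hs hpos
    have h1 : toLex ((p j).1 - X, |(p j).2 - K|) ∈ sideSet p r r' X ε :=
      Finset.mem_image.2 ⟨j, by simp [hj, hj', ← hKdef, hpos], rfl⟩
    rw [hs, sideSet, Finset.mem_image] at h1
    obtain ⟨k, hk, heq⟩ := h1
    simp only [Finset.mem_filter, Finset.mem_univ, true_and, ← hKdef] at hk heq
    have h2 := congrArg ofLex heq
    simp only [ofLex_toLex, Prod.mk.injEq] at h2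
    refine ⟨k, hk.1.1, hk.1.2, Prod.ext (by simp only; linarith [h2.1]) ?_⟩
    have h3 := h2.2
    have h4 := hk.2
    rcases hε with rfl | rfl
    · rw [abs_of_neg (by linarith), abs_of_pos (by linarith)] at h3
      simp only; linarith
    · rw [abs_of_pos (by linarith), abs_of_neg (by linarith)] at h3
      simp only; linarith
  have hτ' : -τ = 1 ∨ -τ = -1 := by rcases hτ with rfl | rfl <;> simp
  rcases lt_or_gt_of_ne (show τ * ((p j).2 - K) ≠ 0 from mul_ne_zero
    (by rcases hτ with rfl | rfl <;> norm_num) (sub_ne_zero.2 hjK)) with h | h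
  · exact h0 (-τ) hτ' (fun a => by rw [neg_neg]; exact hset a) (by linarith)
  · exact h0 τ hτ (fun a => (hset a).symm) h

end Opposite

/-- Two resting candidates in a column to the left of all other robots: either a tie between them
is broken, or there is a symmetry with respect to the midline, except possibly for the distances
of the candidates, and this line contains a robot. -/
theorem win_of_candidates (T : Terrain p r r' X) (hx : x₀ < X) (hτ : τ = 1 ∨ τ = -1)
    (hh : 0 < τ * (h' - h))
    (hsymm : ¬ (h + h' = 2 * midline p r r' X ∧
      (∀ j, j ≠ r → j ≠ r' → ∃ k, k ≠ r ∧ k ≠ r' ∧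
        p k = ((p j).1, 2 * midline p r r' X - (p j).2)) ∧
      ∀ j, j ≠ r → j ≠ r' → (p j).2 ≠ midline p r r' X))
    (htie : 0 < τ * (midline p r r' X - h) → 0 < τ * (h' - midline p r r' X) →
      sideList p r r' X (-τ) = sideList p r r' X τ →
      (∃ j, j ≠ r ∧ j ≠ r' ∧ (p j).2 = midline p r r' X) →
      Win (algorithm n stage2) F (duo p r r' (Rob.idle (x₀, h) Light.candidate)
        (Rob.idle (x₀, h') Light.candidate))) :
    Win (algorithm n stage2) F (duo p r r' (Rob.idle (x₀, h) Light.candidate)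
      (Rob.idle (x₀, h') Light.candidate)) := by
  have hτ' : -τ = 1 ∨ -τ = -1 := by rcases hτ with rfl | rfl <;> simp
  have hττ : τ * τ = 1 := by rcases hτ with rfl | rfl <;> norm_num
  have hKs : midline p r' r X = midline p r r' X := midline_swap p r r' X
  have hrs : ∀ ε, sideList p r' r X ε = sideList p r r' X ε := sideList_swap p r r' X
  set K := midline p r r' X with hKdef
  by_cases hs : 0 ≤ τ * (K - h) ∧ τ * (h' - K) ≤ 0 ∨ τ * (K - h) ≤ 0 ∧ 0 ≤ τ * (h' - K)
  · rcases lt_trichotomy |h' - K| |h - K| with hd | hd | hd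
    · exact win_of_same_side T hx hτ hh hs hd
    · exfalso
      rcases hs with ⟨h1, h2⟩ | ⟨h1, h2⟩
      · rw [abs_eq_below hτ h1, abs_eq_below hτ (by linarith)] at hd
        linarith
      · rw [abs_eq_above hτ (by linarith), abs_eq_above hτ (by linarith)] at hd
        linarith
    · rw [duo_swap T.ne]
      refine win_of_same_side T.symm hx hτ' (by linarith) ?_ (by rw [hKs]; exact hd)
      rw [hKs]
      rcases hs with ⟨h1, h2⟩ | ⟨h1, h2⟩
      · exact Or.inr ⟨by linarith, by linarith⟩
      · exact Or.inl ⟨by linarith, by linarith⟩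
  · have hKK : 0 < τ * (K - h) ∧ 0 < τ * (h' - K) := by
      push Not at hs
      rcases le_or_gt (τ * (K - h)) 0 with h1 | h1
      · have := hs.2 h1
        linarith
      · exact ⟨h1, hs.1 h1.le⟩
    obtain ⟨hK, hK'⟩ := hKK
    have hK2 : 0 < -τ * (midline p r' r X - h') := by rw [hKs]; linarith
    have hK2' : 0 < -τ * (h - midline p r' r X) := by rw [hKs]; linarith
    rcases prec_trichotomy (firstColumn (sideList p r r' X (-τ)))
      (firstColumn (sideList p r r' X τ)) with hl | hl | hl
    · exact win_of_column_prec T hx hτ hh hK hK' hl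
    · rcases prec_trichotomy (sideList p r r' X (-τ)) (sideList p r r' X τ) with hp | hp | hp
      · exact win_of_prec T hx hτ hK hK' hl hp
      · by_cases hn : ∀ j, j ≠ r → j ≠ r' → (p j).2 ≠ K
        · rcases lt_trichotomy |h' - K| |h - K| with hd | hd | hd
          · exact win_of_farther T hx hτ hK hK' hp hn hd
          · refine absurd ⟨?_, fun j hj hj' => exists_mirror hτ hp hj hj' (hn j hj hj'), hn⟩ hsymm
            rw [abs_eq_below hτ hK.le, abs_eq_above hτ hK'.le] at hd
            linear_combination τ * hd - (h' + h - 2 * K) * hττ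
          · rw [duo_swap T.ne]
            refine win_of_farther T.symm hx hτ' hK2 hK2' ?_ ?_ (by rw [hKs]; exact hd)
            · rw [hrs, hrs, neg_neg]; exact hp.symm
            · intro j hj hj'
              rw [hKs]
              exact hn j hj' hj
        · push Not at hn
          exact htie hK hK' hp hn
      · rw [duo_swap T.ne]
        refine win_of_prec T.symm hx hτ' hK2 hK2' ?_ ?_
        · rw [hrs, hrs, neg_neg]; exact hl.symm
        · rw [hrs, hrs, neg_neg]; exact hp
    · rw [duo_swap T.ne]
      refine win_of_column_prec T.symm hx hτ' (by linarith) hK2 hK2' ?_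
      rw [hrs, hrs, neg_neg]; exact hl

end Verdict

/-! ### Two candidates in symmetric position, and a robot on the axis -/

section SymmetryLight

variable {n : ℕ} {stage2 : Snapshot → Action} {F : Fin n → Frame} {C : Config n} {i : Fin n}

theorem algorithm_symmetry (hd : C.Dark) (hi : C.light i = Light.symmetry) (f : Frame) :
    algorithm n stage2 (C.snapshot f i) =
      if ∃ q ∈ (C.snapshot f i).others, q.x < 0 ∧ q.light = Light.off then setLight Light.off
      else (C.snapshot f i).stay := by
  rw [algorithm_of_dark hd, if_pos, phase2]
  · simp only [Config.snapshot_light, hi]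
  · exact Or.inr ⟨_, Config.mem_all.2 ⟨i, Or.inl rfl, rfl⟩, hi⟩

theorem dec_symmetry_stay (hd : C.Dark) (hi : C.light i = Light.symmetry)
    (hl : ∀ j, (C.pos j).1 < (C.pos i).1 → C.light j ≠ Light.off) :
    dec stage2 F C i = (Light.symmetry, C.pos i) := by
  rw [← hi]
  apply dec_of_stay
  rw [algorithm_symmetry hd hi, if_neg]
  rintro ⟨q, hq, hx, h⟩
  obtain ⟨j, hj, rfl⟩ := Config.mem_others.1 hq
  exact hl j (Config.sighting_x_neg.1 hx) h

theorem dec_symmetry_off (hd : C.Dark) (hi : C.light i = Light.symmetry) {j : Fin n}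
    (hj : C.Visible i j) (hjx : (C.pos j).1 < (C.pos i).1) (hjc : C.light j = Light.off) :
    dec stage2 F C i = (Light.off, C.pos i) := by
  apply dec_of_setLight
  rw [algorithm_symmetry hd hi, if_pos]
  exact ⟨_, Config.mem_others.2 ⟨j, hj, rfl⟩, Config.sighting_x_neg.2 hjx, hjc⟩

end SymmetryLight

section Tie

variable {n : ℕ} {stage2 : Snapshot → Action} {F : Fin n → Frame}
  {p : Fin n → ℝ × ℝ} {r r' : Fin n} {X x₀ τ K M R b b' : ℝ} {S : Set ℝ}

theorem mem_segment_of {P Q Z : ℝ × ℝ} {θ : ℝ} (h0 : 0 ≤ θ) (h1 : θ ≤ 1)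
    (hx : Z.1 = P.1 + θ * (Q.1 - P.1)) (hy : Z.2 = P.2 + θ * (Q.2 - P.2)) :
    Z ∈ segment ℝ P Q := by
  refine ⟨1 - θ, θ, by linarith, h0, by ring, ?_⟩
  ext
  · simp only [Prod.fst_add, Prod.smul_fst, smul_eq_mul]; linarith
  · simp only [Prod.snd_add, Prod.smul_snd, smul_eq_mul]; linarith

/-- The set of robots besides `r` and `r'` is symmetric in the horizontal line at height `K`. -/
def Mirrored (p : Fin n → ℝ × ℝ) (r r' : Fin n) (K : ℝ) : Prop :=
  ∀ j, j ≠ r → j ≠ r' → ∃ k, k ≠ r ∧ k ≠ r' ∧ p k = ((p j).1, 2 * K - (p j).2)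

theorem exposed_mirror (T : Terrain p r r' X) (hm : Mirrored p r r' K) {h : ℝ}
    (hE : Exposed p r r' x₀ τ h) : Exposed p r r' x₀ (-τ) (2 * K - h) := by
  constructor
  · intro j hj hj' k hk hk' hkj hs
    obtain ⟨j₁, h1, h2, h3⟩ := hm j hj hj'
    obtain ⟨k₁, h4, h5, h6⟩ := hm k hk hk'
    obtain ⟨θ, h0, h7, hx, hy⟩ := exists_of_mem_segment hs
    refine hE.1 j₁ h1 h2 k₁ h4 h5 ?_ (mem_segment_of h0 h7 ?_ ?_)
    · rintro rfl
      rw [h3, Prod.mk.injEq] at h6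
      exact hkj (T.inj k j hk hk' hj hj' (Prod.ext h6.1.symm (by linarith [h6.2])))
    · rw [h6, h3]; exact hx
    · rw [h6, h3]
      simp only at hy ⊢
      rw [hy]; ring
  · intro j hj hj'
    obtain ⟨j₁, h1, h2, h3⟩ := hm j hj hj'
    have := hE.2 j₁ h1 h2
    rw [h3] at this
    simp only at this
    linarith

/-- The distances from the axis `K` at which the candidates can stop: the larger initial distance
`M` is doubled until all robots are visible, which happens at the distance `R`, simultaneously on
both sides. -/
structure Ladder (p : Fin n → ℝ × ℝ) (r r' : Fin n) (x₀ τ K M R : ℝ) (S : Set ℝ) : Prop where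
  pos : 0 < M
  bound : ∀ v ∈ S, M ≤ v ∧ v ≤ R
  bottom : M ∈ S
  top : R ∈ S
  step : ∀ v ∈ S, v ≠ R → 2 * v ∈ S ∧ ¬ Exposed p r r' x₀ τ (K - τ * v) ∧
    ¬ Exposed p r r' x₀ (-τ) (K - -τ * v)
  exposed : Exposed p r r' x₀ τ (K - τ * R)
  exposed' : Exposed p r r' x₀ (-τ) (K - -τ * R)

theorem Ladder.symm (L : Ladder p r r' x₀ τ K M R S) : Ladder p r' r x₀ (-τ) K M R S where
  pos := L.pos
  bound := L.bound
  bottom := L.bottom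
  top := L.top
  step v hv hvR := by
    obtain ⟨h1, h2, h3⟩ := L.step v hv hvR
    rw [neg_neg]
    exact ⟨h1, fun h => h3 (exposed_swap.1 h), fun h => h2 (exposed_swap.1 h)⟩
  exposed := by rw [exposed_swap]; exact L.exposed'
  exposed' := by rw [neg_neg, exposed_swap]; exact L.exposed

theorem exists_ladder (T : Terrain p r r' X) (hx : x₀ < X) (hτ : τ = 1 ∨ τ = -1)
    (hm : Mirrored p r r' K) (hM : 0 < M) : ∃ R S, Ladder p r r' x₀ τ K M R S := by
  have hττ : τ * τ = 1 := by rcases hτ with rfl | rfl <;> norm_num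
  have hmir : ∀ v, Exposed p r r' x₀ (-τ) (K - -τ * v) ↔ Exposed p r r' x₀ τ (K - τ * v) := by
    intro v
    constructor
    · intro h
      have := exposed_mirror T hm h
      rwa [neg_neg, show 2 * K - (K - -τ * v) = K - τ * v by ring] at this
    · intro h
      have := exposed_mirror T hm h
      rwa [show 2 * K - (K - τ * v) = K - -τ * v by ring] at this
  obtain ⟨H, hH⟩ := exists_exposed T hx hτ K
  have hex : ∃ N : ℕ, Exposed p r r' x₀ τ (K - τ * (M * 2 ^ N)) := by
    obtain ⟨N, hN⟩ := pow_unbounded_of_one_lt (H / M) (one_lt_two (α := ℝ))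
    refine ⟨N, hH _ ?_⟩
    rw [div_lt_iff₀ hM] at hN
    rw [show τ * (K - (K - τ * (M * 2 ^ N))) = τ * τ * (M * 2 ^ N) by ring, hττ]
    linarith
  refine ⟨M * 2 ^ Nat.find hex, {v | ∃ j ≤ Nat.find hex, v = M * 2 ^ j}, hM, ?_,
    ⟨0, Nat.zero_le _, by simp⟩, ⟨_, le_rfl, rfl⟩, ?_, Nat.find_spec hex,
    (hmir _).2 (Nat.find_spec hex)⟩
  · rintro v ⟨j, hj, rfl⟩
    have h1 : (1 : ℝ) ≤ 2 ^ j := one_le_pow₀ (by norm_num)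
    have h2 : (2 : ℝ) ^ j ≤ 2 ^ Nat.find hex := pow_le_pow_right₀ (by norm_num) hj
    constructor <;> nlinarith
  · rintro v ⟨j, hj, rfl⟩ hne
    have hlt : j < Nat.find hex := lt_of_le_of_ne hj fun h => hne (by rw [h])
    have hmin := Nat.find_min hex hlt
    refine ⟨⟨j + 1, hlt, by ring⟩, hmin, fun h => hmin ((hmir _).1 h)⟩

/-- Two candidates that cannot break the tie between them: the other robots are symmetric in the
midline, which contains one of them. The initial distances of `r` and `r'` from the midline are `b`
and `b'`. -/
structure Tie (p : Fin n → ℝ × ℝ) (r r' : Fin n) (X x₀ τ M R : ℝ) (S : Set ℝ) (b b' : ℝ) :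
    Prop where
  terrain : Terrain p r r' X
  lt : x₀ < X
  sign : τ = 1 ∨ τ = -1
  ladder : Ladder p r r' x₀ τ (midline p r r' X) M R S
  lists : sideList p r r' X (-τ) = sideList p r r' X τ
  axis : ¬ ∀ j, j ≠ r → j ≠ r' → (p j).2 ≠ midline p r r' X
  pos : 0 < b
  pos' : 0 < b'
  le : b ≤ M
  le' : b' ≤ M
  max : b = M ∨ b' = M

theorem Tie.symm (D : Tie p r r' X x₀ τ M R S b b') : Tie p r' r X x₀ (-τ) M R S b' b where
  terrain := D.terrain.symm
  lt := D.lt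
  sign := by rcases D.sign with rfl | rfl <;> simp
  ladder := by rw [midline_swap]; exact D.ladder.symm
  lists := by rw [sideList_swap p r r', sideList_swap p r r', neg_neg]; exact D.lists.symm
  axis h := D.axis fun j hj hj' => by rw [← midline_swap]; exact h j hj' hj
  pos := D.pos'
  pos' := D.pos
  le := D.le'
  le' := D.le
  max := D.max.symm

/-- The states that a candidate takes until it has stopped at the distance `R` from the axis and has
set its light to `symmetry`. The distances of its position and of its destination are `u`
and `v`. -/
def Climbs (x₀ τ K R : ℝ) (S : Set ℝ) (b : ℝ) (a : Rob) : Prop :=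
  ∃ u v, a.pos = (x₀, K - τ * u) ∧ a.tgt = (x₀, K - τ * v) ∧ b ≤ u ∧ u ≤ v ∧ v ≤ R ∧
    (v ∈ S ∨ v = b) ∧ ((a.light = Light.candidate ∧ a.nl = Light.candidate) ∨
      (u = R ∧ a.src = a.pos ∧ a.nl = Light.symmetry ∧
        (a.light = Light.candidate ∨ a.light = Light.symmetry)))

/-- A bound for the number of actions of a climbing candidate. -/
def climbRank (τ K R : ℝ) (a : Rob) : ℕ :=
  if a.nl = Light.symmetry then (if a.light = Light.symmetry then 0 else 1)
  else 2 + ⌈R / (τ * (K - a.tgt.2))⌉₊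

theorem Climbs.act {a a' : Rob} (h : Climbs x₀ τ K R S b a) (ha : Act a a') :
    Climbs x₀ τ K R S b a' ∧ a'.tgt = a.tgt ∧ a'.nl = a.nl ∧
      (a'.light = a.light ∨ climbRank τ K R a' < climbRank τ K R a) := by
  obtain ⟨u, v, h1, h2, h3, h4, h5, h6, h7⟩ := h
  cases ha with
  | color =>
    refine ⟨⟨u, v, h1, h2, h3, h4, h5, h6, ?_⟩, rfl, rfl, ?_⟩
    · rcases h7 with ⟨-, h8⟩ | ⟨h8, h9, h10, -⟩
      · exact Or.inl ⟨h8, h8⟩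
      · exact Or.inr ⟨h8, h9, h10, Or.inr h10⟩
    · rcases h7 with ⟨h8, h9⟩ | ⟨-, -, h8, h9 | h9⟩
      · left; simp only [h8, h9]
      · right; simp [climbRank, h8, h9]
      · left; simp only [h8, h9]
  | move q hl hq =>
    obtain ⟨θ, h0, h8, hx, hy⟩ := exists_of_mem_segment hq
    refine ⟨⟨u + θ * (v - u), v, ?_, h2, by nlinarith, by nlinarith, h5, h6, ?_⟩, rfl, rfl,
      Or.inl rfl⟩
    · ext
      · simp only [hx, h1, h2]; ring
      · simp only [hy, h1, h2]; ring
    · rcases h7 with h9 | ⟨h9, h10, h11, h12⟩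
      · exact Or.inl h9
      · have hv : v = R := by linarith
        have hq : q = a.pos := by
          ext
          · simp only [hx, h1, h2]; ring
          · simp only [hy, h1, h2, hv, h9]; ring
        refine Or.inr ⟨by rw [hv, h9]; ring, ?_, h11, h12⟩
        simp only [hq, h10]

theorem Climbs.plan_stay {a : Rob} (h : Climbs x₀ τ K R S b a) (ha : a.pos = a.tgt)
    (hl : a.light = a.nl) : Climbs x₀ τ K R S b (a.plan (a.light, a.pos)) := by
  obtain ⟨u, v, h1, h2, h3, h4, h5, h6, h7⟩ := h
  refine ⟨u, v, h1, ha.trans h2, h3, h4, h5, h6, ?_⟩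
  rcases h7 with ⟨h8, h9⟩ | ⟨h8, h9, h10, -⟩
  · exact Or.inl ⟨h8, h8⟩
  · exact Or.inr ⟨h8, rfl, hl.trans h10, Or.inr (hl.trans h10)⟩

theorem Climbs.light_ne_leader {a : Rob} (h : Climbs x₀ τ K R S b a) : a.light ≠ Light.leader := by
  obtain ⟨u, v, -, -, -, -, -, -, ⟨h, -⟩ | ⟨-, -, -, h | h⟩⟩ := h <;> rw [h] <;>
    exact Light.noConfusion

namespace Tie

variable {a c : Rob}

theorem calm (D : Tie p r r' X x₀ τ M R S b b') (ha : Climbs x₀ τ (midline p r r' X) R S b a)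
    (hc : Climbs x₀ (-τ) (midline p r r' X) R S b' c)
    (hns : ¬ (a.light = Light.symmetry ∧ c.light = Light.symmetry)) :
    Calm p r r' X a.pos c.pos a.light c.light := by
  have ha' := ha.light_ne_leader
  have hc' := hc.light_ne_leader
  obtain ⟨u, v, h1, -, h3, -⟩ := ha
  obtain ⟨u', v', h1', -, h3', -⟩ := hc
  have hττ : τ * τ = 1 := by rcases D.sign with h | h <;> rw [h] <;> norm_num
  have hu : 0 < u + u' := by linarith [D.pos, D.pos']
  have hne : a.pos ≠ c.pos := by
    rw [h1, h1']
    intro h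
    rw [Prod.mk.injEq] at h
    have : τ * τ * (u + u') = 0 := by linear_combination -τ * h.2
    rw [hττ] at this
    linarith
  have hx := D.lt
  have hseg : ∀ P Q : ℝ × ℝ, P.1 = x₀ → Q.1 = x₀ → P ≠ Q → ∀ j, j ≠ r → j ≠ r' → (p j).1 = X →
      P ∉ segment ℝ (p j) Q := by
    intro P Q hP hQ hPQ j _ _ hX hs
    obtain ⟨θ, h0, h1, hx', hy'⟩ := exists_of_mem_segment hs
    rw [hP, hQ, hX] at hx'
    have : θ = 1 := by
      have : (1 - θ) * (x₀ - X) = 0 := by linarith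
      rcases mul_eq_zero.1 this with h | h <;> linarith
    subst this
    exact hPQ (Prod.ext (hP.trans hQ.symm) (by linarith))
  exact ⟨by rw [h1]; exact hx, by rw [h1']; exact hx, hne,
    hseg _ _ (by rw [h1]) (by rw [h1']) hne, hseg _ _ (by rw [h1']) (by rw [h1]) hne.symm,
    ha', hc', fun h h' => hns ⟨h, h'⟩⟩

/-- A candidate goes outwards, switches to `symmetry`, or stays because the other candidate is
farther from the axis. -/
theorem look (D : Tie p r r' X x₀ τ M R S b b') (ha : Climbs x₀ τ (midline p r r' X) R S b a)
    (hc : Climbs x₀ (-τ) (midline p r r' X) R S b' c)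
    (hpos : a.pos = a.tgt) (hl : a.light = a.nl)
    (hns : ¬ (a.light = Light.symmetry ∧ c.light = Light.symmetry)) {d : Light × (ℝ × ℝ)}
    (hd : d = dec stage2 F (duoConfig p r r' a.pos c.pos a.light c.light) r) :
    (d = (a.light, a.pos) ∧ (a.light = Light.symmetry ∨ (c.light = Light.candidate ∧
      τ * (midline p r r' X - a.tgt.2) < -τ * (midline p r r' X - c.tgt.2)))) ∨
    (Climbs x₀ τ (midline p r r' X) R S b (a.plan d) ∧
      climbRank τ (midline p r r' X) R (a.plan d) < climbRank τ (midline p r r' X) R a) := by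
  have hcalm := D.calm ha hc hns
  have T := D.terrain
  have hττ : τ * τ = 1 := by rcases D.sign with h | h <;> rw [h] <;> norm_num
  set K := midline p r r' X with hKdef
  have hlists := D.lists
  have hx := D.lt
  have hcl := hc.light_ne_leader
  obtain ⟨u, v, h1, h2, h3, h4, h5, h6, h7⟩ := ha
  obtain ⟨u', v', h1', h2', h3', h4', h5', h6', h7'⟩ := hc
  have hb := D.pos
  have hb' := D.pos'
  have huv : u = v := by
    rw [h1, h2, Prod.mk.injEq] at hpos
    have : τ * τ * (u - v) = 0 := by linear_combination -τ * hpos.2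
    rw [hττ] at this
    linarith
  subst huv
  have e1 : τ * (K - (K - τ * u)) = u := by linear_combination u * hττ
  have e2 : -τ * (K - (K - -τ * v')) = v' := by linear_combination v' * hττ
  have e3 : τ * (K - -τ * u' - K) = u' := by linear_combination u' * hττ
  have hh : 0 < τ * (K - -τ * u' - (K - τ * u)) := by
    have : τ * (K - -τ * u' - (K - τ * u)) = u' + u := by linear_combination (u + u') * hττ
    linarith
  have hK : 0 < τ * (K - (K - τ * u)) := by rw [e1]; linarith
  have hK' : 0 < τ * (K - -τ * u' - K) := by rw [e3]; linarith
  have ed : |K - τ * u - K| = u := by rw [abs_eq_below D.sign hK.le, e1]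
  have ed' : |K - -τ * u' - K| = u' := by rw [abs_eq_above D.sign hK'.le, e3]
  have hu : 0 < u := by linarith
  rcases h7 with ⟨h8, h9⟩ | ⟨h8, h9, h10, -⟩
  · have hrank : climbRank τ K R a = 2 + ⌈R / u⌉₊ := by
      rw [climbRank, h9, h2, if_neg Light.noConfusion]
      simp only
      rw [e1]
    have hRu : 1 ≤ ⌈R / u⌉₊ := Nat.one_le_ceil_iff.2 (div_pos (by linarith) hu)
    -- a move to a farther rung of the ladder decreases the rank
    have hgo : ∀ w, u ≤ w → w ≤ R → w ∈ S → ⌈R / w⌉₊ < ⌈R / u⌉₊ →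
        d = (Light.candidate, (x₀, K - τ * w)) →
        Climbs x₀ τ K R S b (a.plan d) ∧ climbRank τ K R (a.plan d) < climbRank τ K R a := by
      rintro w hw hwR hwS hr rfl
      refine ⟨⟨u, w, h1, rfl, h3, hw, hwR, Or.inl hwS, Or.inl ⟨h8, rfl⟩⟩, ?_⟩
      rw [hrank, climbRank, if_neg Light.noConfusion]
      simp only [Rob.plan]
      rw [show τ * (K - (K - τ * w)) = w by linear_combination w * hττ]
      omega
    have hsym : u = R → d = (Light.symmetry, (x₀, K - τ * u)) →
        Climbs x₀ τ K R S b (a.plan d) ∧ climbRank τ K R (a.plan d) < climbRank τ K R a := by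
      rintro huR rfl
      refine ⟨⟨u, u, h1, rfl, h3, le_rfl, h5, h6, Or.inr ⟨huR, rfl, rfl, Or.inl h8⟩⟩, ?_⟩
      rw [hrank, climbRank, if_pos (show (a.plan _).nl = Light.symmetry from rfl)]
      simp only [Rob.plan, h8, reduceCtorEq, if_false]
      omega
    rw [h1, h1', h8] at hd
    by_cases hcs : c.light = Light.symmetry
    · -- the other robot is at the distance `R`
      have hu' : u' = R := by
        rcases h7' with ⟨h, -⟩ | ⟨h, -⟩
        · rw [hcs] at h; exact Light.noConfusion h
        · exact h
      rw [hcs] at hd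
      right
      rcases h5.lt_or_eq with hlt | heq
      · have key := dec_catch_up (stage2 := stage2) (F := F) T hx D.sign hh
          (by rw [← hKdef, ed, ed', hu']; exact hlt)
        rw [← hd, ← hKdef, ed, ed', hu'] at key
        refine hgo R h5 le_rfl D.ladder.top ?_ (key.trans ?_)
        · rw [div_self (by linarith), Nat.ceil_one, Nat.lt_ceil, Nat.cast_one, lt_div_iff₀ hu]
          linarith
        · congr 2; ring
      · have key := dec_join (stage2 := stage2) (F := F) T hx D.sign hh
          (by rw [← hKdef, ed, ed', hu']; exact heq)
        rw [← hd] at key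
        exact hsym heq key
    · have hcc : c.light = Light.candidate := by
        rcases h7' with ⟨h, -⟩ | ⟨-, -, -, h | h⟩
        · exact h
        · exact h
        · exact absurd h hcs
      rw [hcc] at hd
      rcases lt_or_ge u u' with hlt | hge
      · left
        have key := dec_nearer_stay (stage2 := stage2) (F := F) T hx D.sign hh hK hK'
          (by rw [hlists]) (by rw [← hKdef, ed, ed']; exact hlt)
        rw [← hd] at key
        refine ⟨by rw [key, h8, h1], Or.inr ⟨hcc, ?_⟩⟩
        rw [h2, h2', e1, e2]
        linarith
      · right
        have huS : u ∈ S := by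
          rcases h6 with h | h
          · exact h
          · have : u = M := by rcases D.max with h' | h' <;> linarith [D.le, D.le']
            rw [this]; exact D.ladder.bottom
        have hde : |K - -τ * u' - K| ≤ |K - τ * u - K| := by rw [ed, ed']; exact hge
        by_cases huR : u = R
        · have key := dec_eq_symmetry (stage2 := stage2) (F := F) T hx D.sign hh hK hK' hde
            (by rw [huR]; exact D.ladder.exposed) hlists D.axis
          rw [← hd] at key
          exact hsym huR key
        · obtain ⟨h10, h11, -⟩ := D.ladder.step u huS huR
          have key := dec_outward (stage2 := stage2) (F := F) T hx D.sign hh hK hK'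
            (by rw [hlists]) hde h11
          rw [← hd, ← hKdef, ed] at key
          have h12 := (D.ladder.bound _ h10).2
          refine hgo (2 * u) (by linarith) h12 h10 ?_ (key.trans ?_)
          · have h13 : 2 ≤ R / u := by rw [le_div_iff₀ hu]; exact h12
            have h14 : R / (2 * u) = R / u / 2 := by rw [mul_comm, div_div]
            rw [h14, Nat.lt_ceil]
            have h15 := Nat.ceil_lt_add_one (show 0 ≤ R / u / 2 by linarith)
            linarith
          · congr 2; ring
  · left
    have hls : a.light = Light.symmetry := hl.trans h10
    refine ⟨?_, Or.inl hls⟩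
    have := dec_symmetry_stay (stage2 := stage2) (F := F) (i := r) hcalm.dark
      (by rw [duoConfig_light_left]; exact hls) ?_
    · rw [hd, this, duoConfig_pos_left, hls]
    · intro j hj
      exfalso
      rw [duoConfig_pos_left, h1] at hj
      by_cases hjr : j = r
      · rw [hjr, duoConfig_pos_left] at hj; exact lt_irrefl _ hj
      by_cases hjr' : j = r'
      · rw [hjr', duoConfig_pos_right T.ne, h1'] at hj; exact lt_irrefl _ hj
      rw [duoConfig_pos_other hjr hjr'] at hj
      exact absurd (T.le j hjr hjr') (not_le.2 (hj.trans hx))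

/-- The stage in which `r` has to act next. -/
theorem win_of_active (D : Tie p r r' X x₀ τ M R S b b')
    (ha : Climbs x₀ τ (midline p r r' X) R S b a)
    (hc : Climbs x₀ (-τ) (midline p r r' X) R S b' c)
    (ih : ∀ a' c', Climbs x₀ τ (midline p r r' X) R S b a' →
      Climbs x₀ (-τ) (midline p r r' X) R S b' c' →
      climbRank τ (midline p r r' X) R a' + climbRank (-τ) (midline p r r' X) R c' <
        climbRank τ (midline p r r' X) R a + climbRank (-τ) (midline p r r' X) R c →
      Win (algorithm n stage2) F (duo p r r' a' c'))
    (hns : ¬ (a.light = Light.symmetry ∧ c.light = Light.symmetry))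
    (hact : a.light ≠ a.nl ∨ (a.light = Light.candidate ∧ (c.light = Light.symmetry ∨
      -τ * (midline p r r' X - c.tgt.2) ≤ τ * (midline p r r' X - a.tgt.2)))) :
    Win (algorithm n stage2) F (duo p r r' a c) := by
  set K := midline p r r' X with hKdef
  have hrk : ∀ τ (a a' : Rob), a'.tgt = a.tgt → a'.nl = a.nl → a'.light = a.light →
      climbRank τ K R a' = climbRank τ K R a := fun τ a a' h1 h2 h3 => by
    rw [climbRank, h1, h2, h3, climbRank]
  refine win_duo D.terrain (fun a' c' => (Climbs x₀ τ K R S b a' ∧ Climbs x₀ (-τ) K R S b' c') ∧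
    (a'.tgt = a.tgt ∧ a'.nl = a.nl ∧ a'.light = a.light) ∧
    (c'.tgt = c.tgt ∧ c'.nl = c.nl ∧ c'.light = c.light)) ?_ ?_ ?_ ?_ ?_
    ⟨⟨ha, hc⟩, ⟨rfl, rfl, rfl⟩, rfl, rfl, rfl⟩
  · rintro a' c' ⟨⟨h1, h2⟩, ⟨-, -, h3⟩, -, -, h4⟩
    exact D.calm h1 h2 (by rw [h3, h4]; exact hns)
  · rintro a' c' a'' ⟨⟨h1, h2⟩, ⟨h3, h4, h5⟩, h6, h7, h8⟩ hact hnot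
    obtain ⟨h9, h10, h11, h12⟩ := h1.act hact
    rcases h12 with h12 | h12
    · exact absurd ⟨⟨h9, h2⟩, ⟨h10.trans h3, h11.trans h4, h12.trans h5⟩, h6, h7, h8⟩ hnot
    · refine ih _ _ h9 h2 ?_
      rw [hrk (-τ) c c' h6 h7 h8]
      rw [hrk τ a a' h3 h4 h5] at h12
      omega
  · rintro a' c' c'' ⟨⟨h1, h2⟩, h345, h6, h7, h8⟩ hact hnot
    obtain ⟨h9, h10, h11, h12⟩ := h2.act hact
    rcases h12 with h12 | h12
    · exact absurd ⟨⟨h1, h9⟩, h345, h10.trans h6, h11.trans h7, h12.trans h8⟩ hnot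
    · refine ih _ _ h1 h9 ?_
      rw [hrk τ a a' h345.1 h345.2.1 h345.2.2]
      rw [hrk (-τ) c c' h6 h7 h8] at h12
      omega
  · rintro a' c' ⟨⟨h1, h2⟩, ⟨h3, h4, h5⟩, h6, h7, h8⟩ hpos hl
    rcases D.look (stage2 := stage2) (F := F) h1 h2 hpos hl (by rw [h5, h8]; exact hns) rfl with
      ⟨-, h9⟩ | ⟨h9, h10⟩
    · exfalso
      rw [h5, h8, h3, h6] at h9
      rw [h4, h5] at hl
      rcases hact with h | ⟨h, h'⟩
      · exact h hl
      · rw [h] at h9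
        rcases h9 with h9 | ⟨h9, h10⟩
        · exact Light.noConfusion h9
        · rcases h' with h' | h'
          · rw [h'] at h9; exact Light.noConfusion h9
          · exact absurd h10 (not_lt.2 h')
    · refine ih _ _ h9 h2 ?_
      rw [hrk (-τ) c c' h6 h7 h8]
      rw [← hKdef, hrk τ a a' h3 h4 h5] at h10
      omega
  · rintro a' c' ⟨⟨h1, h2⟩, h345, h6, h7, h8⟩ hpos hl hnot
    have h1s : Climbs x₀ (- -τ) K R S b a' := by rw [neg_neg]; exact h1
    have hKs : midline p r' r X = K := midline_swap p r r' X
    rcases D.symm.look (stage2 := stage2) (F := F) (by rw [hKs]; exact h2) (by rw [hKs]; exact h1s)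
      hpos hl (by rw [h345.2.2, h8]; exact fun h => hns h.symm) rfl with ⟨h9, -⟩ | ⟨h9, h10⟩
    · rw [duoConfig_swap D.terrain.ne, h9] at hnot
      exact absurd ⟨⟨h1, h2.plan_stay hpos hl⟩, h345, hpos.trans h6, hl.trans h7, h8⟩ hnot
    · rw [duoConfig_swap D.terrain.ne]
      rw [hKs] at h9 h10
      refine ih _ _ h1 h9 ?_
      rw [hrk τ a a' h345.1 h345.2.1 h345.2.2]
      rw [hrk (-τ) c c' h6 h7 h8] at h10
      omega

/-- In the end both candidates stop at the same distance from the axis, with light `symmetry`. -/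
theorem win_of_climbs (D : Tie p r r' X x₀ τ M R S b b')
    (hexit : Win (algorithm n stage2) F (duo p r r'
      (Rob.idle (x₀, midline p r r' X - τ * R) Light.symmetry)
      (Rob.idle (x₀, midline p r r' X - -τ * R) Light.symmetry)))
    (ha : Climbs x₀ τ (midline p r r' X) R S b a)
    (hc : Climbs x₀ (-τ) (midline p r r' X) R S b' c) :
    Win (algorithm n stage2) F (duo p r r' a c) := by
  set K := midline p r r' X with hKdef
  induction hN : climbRank τ K R a + climbRank (-τ) K R c using Nat.strong_induction_on
    generalizing a c with
  | _ N ih =>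
  have ih' : ∀ a' c', Climbs x₀ τ K R S b a' → Climbs x₀ (-τ) K R S b' c' →
      climbRank τ K R a' + climbRank (-τ) K R c' < climbRank τ K R a + climbRank (-τ) K R c →
      Win (algorithm n stage2) F (duo p r r' a' c') := fun a' c' h1 h2 h3 =>
    ih _ (hN ▸ h3) h1 h2 rfl
  by_cases hns : a.light = Light.symmetry ∧ c.light = Light.symmetry
  · have hidle : ∀ (τ b : ℝ) (a : Rob), Climbs x₀ τ K R S b a → a.light = Light.symmetry →
        a = Rob.idle (x₀, K - τ * R) Light.symmetry := by
      rintro τ b ⟨src, tgt, pos, light, nl⟩ ⟨u, v, h1, h2, h3, h4, h5, h6, h7⟩ hl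
      rcases h7 with ⟨h7, -⟩ | ⟨h7, h8, h9, -⟩
      · rw [hl] at h7; exact Light.noConfusion h7
      · have hv : v = R := by linarith
        simp only at h1 h2 h8 h9 hl
        rw [Rob.idle, h8, h1, h2, h9, hl, h7, hv]
    rw [hidle _ _ a ha hns.1, hidle _ _ c hc hns.2]
    exact hexit
  · have hc' : Climbs x₀ (-τ) (midline p r' r X) R S b' c := by rw [midline_swap]; exact hc
    have ha' : Climbs x₀ (- -τ) (midline p r' r X) R S b a := by
      rw [midline_swap, neg_neg]; exact ha
    have right : (c.light ≠ c.nl ∨ (c.light = Light.candidate ∧ (a.light = Light.symmetry ∨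
        τ * (K - a.tgt.2) ≤ -τ * (K - c.tgt.2)))) →
        Win (algorithm n stage2) F (duo p r r' a c) := by
      intro h
      rw [duo_swap D.terrain.ne]
      refine D.symm.win_of_active hc' ha' ?_ (fun h => hns h.symm) ?_
      · intro c' a' h1 h2 h3
        rw [duo_swap D.terrain.symm.ne]
        rw [midline_swap, neg_neg] at h2 h3
        rw [midline_swap] at h1
        exact ih' _ _ h2 h1 (by rw [← hKdef] at h3; omega)
      · rw [midline_swap, neg_neg]
        exact h
    have left := D.win_of_active (stage2 := stage2) (F := F) ha hc ih' hns
    have hlc : ∀ (τ b : ℝ) (a : Rob), Climbs x₀ τ K R S b a → a.light = Light.candidate ∨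
        a.light = Light.symmetry := by
      rintro τ b a ⟨u, v, -, -, -, -, -, -, ⟨h, -⟩ | ⟨-, -, -, h⟩⟩
      · exact Or.inl h
      · exact h
    by_cases hla : a.light = a.nl
    · by_cases hlc' : c.light = c.nl
      · rcases hlc _ _ a ha with h1 | h1 <;> rcases hlc _ _ c hc with h2 | h2
        · rcases le_total (-τ * (K - c.tgt.2)) (τ * (K - a.tgt.2)) with h3 | h3
          · exact left (Or.inr ⟨h1, Or.inr h3⟩)
          · exact right (Or.inr ⟨h2, Or.inr h3⟩)
        · exact left (Or.inr ⟨h1, Or.inl h2⟩)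
        · exact right (Or.inr ⟨h2, Or.inl h1⟩)
        · exact absurd ⟨h1, h2⟩ hns
      · exact right (Or.inl hlc')
    · exact left (Or.inl hla)

end Tie

end Tie

/-! ### The leftmost robot on the axis breaks the symmetry -/

section Break

variable {n : ℕ} {stage2 : Snapshot → Action} {F : Fin n → Frame} {C : Config n} {i k l : Fin n}

/-- A robot midway between the two robots with light `symmetry`, and the leftmost one on its
horizontal line, goes to the left of those two. -/
theorem dec_break (hd : C.Dark) (hi : C.light i = Light.off)
    (hk : C.Visible i k) (hl : C.Visible i l) (hkl : k ≠ l) (hks : C.light k = Light.symmetry)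
    (hls : C.light l = Light.symmetry) (huniq : ∀ j, C.light j = Light.symmetry → j = k ∨ j = l)
    (hlt : (C.pos k).1 < (C.pos i).1) (hx : (C.pos l).1 = (C.pos k).1)
    (hmid : (C.pos k).2 + (C.pos l).2 = 2 * (C.pos i).2)
    (hrow : ∀ j, j ≠ i → (C.pos j).2 = (C.pos i).2 → (C.pos i).1 < (C.pos j).1)
    (hC : Function.Injective C.pos) :
    dec stage2 F C i = (Light.off, ((C.pos k).1 - (F i).unit, (C.pos i).2)) := by
  have hu := (F i).unit_pos
  have hpair : (C.snapshot (F i) i).IsSymmetryPair (C.sighting (F i) i k, C.sighting (F i) i l) := by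
    refine ⟨Config.mem_others.2 ⟨k, hk, rfl⟩, Config.mem_others.2 ⟨l, hl, rfl⟩,
      fun h => hkl (Config.sighting_inj hC h), Config.sighting_x_neg.2 hlt, ?_, hks, hls⟩
    simp only [Config.sighting, hx]
  have hex : ∃ q, (C.snapshot (F i) i).IsSymmetryPair q := ⟨_, hpair⟩
  -- the chosen pair consists of `k` and `l`, in one of the two orders
  have hch : ∃ k' l', hex.choose = (C.sighting (F i) i k', C.sighting (F i) i l') ∧
      (C.pos k').1 = (C.pos k).1 ∧ (C.pos k').2 + (C.pos l').2 = 2 * (C.pos i).2 := by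
    obtain ⟨h3, h4, h5, -, -, h8, h9⟩ := hex.choose_spec
    obtain ⟨k', hk', hkp⟩ := Config.mem_others.1 h3
    obtain ⟨l', hl', hlp⟩ := Config.mem_others.1 h4
    rw [← hkp] at h8 h5
    rw [← hlp] at h9 h5
    have hne : k' ≠ l' := fun h => h5 (by rw [h])
    refine ⟨k', l', Prod.ext hkp.symm hlp.symm, ?_⟩
    rcases huniq k' h8 with rfl | rfl <;> rcases huniq l' h9 with rfl | rfl
    · exact absurd rfl hne
    · exact ⟨rfl, hmid⟩
    · exact ⟨hx, by linarith⟩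
    · exact absurd rfl hne
  obtain ⟨k', l', hchoose, h1, h2⟩ := hch
  have halg : algorithm n stage2 (C.snapshot (F i) i) =
      (C.snapshot (F i) i).moveTo (-(|((C.pos k).1 - (C.pos i).1) / (F i).unit| + 1), 0) := by
    rw [algorithm_of_dark hd, if_pos, phase2_off (by exact hi), dif_pos hex, if_pos, hchoose]
    · simp only [Config.sighting, h1]
    · rw [hchoose]
      constructor
      · have : (C.pos k').2 - (C.pos i).2 = -((C.pos l').2 - (C.pos i).2) := by linarith
        simp only [Config.sighting, this]
        ring
      · intro q hq hqy
        obtain ⟨j, hj, rfl⟩ := Config.mem_others.1 hq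
        rw [Config.sighting_y_zero] at hqy
        rw [Config.sighting_x_pos]
        exact hrow j hj.1 hqy
    · exact Or.inr ⟨_, Config.mem_all.2 ⟨k, Or.inr hk, rfl⟩, hks⟩
  rw [dec, decision, halg]
  simp only [Snapshot.moveTo, Config.snapshot_light, hi, Frame.toPlane, Prod.mk.injEq, true_and]
  constructor
  · rw [abs_of_neg (div_neg_of_neg_of_pos (by linarith) hu)]
    field_simp
    ring
  · ring

/-- To the left of all others, and in view of a light `symmetry`, a robot waits. -/
theorem dec_off_wait (hd : C.Dark) (hi : C.light i = Light.off)
    (hleft : ∀ j, j ≠ i → (C.pos i).1 ≤ (C.pos j).1) (hk : C.Visible i k)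
    (hks : C.light k = Light.symmetry) : dec stage2 F C i = (Light.off, C.pos i) := by
  rw [← hi]
  apply dec_of_stay
  rw [algorithm_of_dark hd, if_pos, phase2_off (by exact hi), dif_neg]
  · rintro ⟨q, h1, -, -, h2, -⟩
    obtain ⟨j, hj, hjq⟩ := Config.mem_others.1 h1
    rw [← hjq, Config.sighting_x_neg] at h2
    exact absurd (hleft j hj.1) (not_le.2 h2)
  · exact Or.inr ⟨_, Config.mem_all.2 ⟨k, Or.inr hk, rfl⟩, hks⟩

end Break

section Trio

variable {n : ℕ} {stage2 : Snapshot → Action} {F : Fin n → Frame}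
  {p : Fin n → ℝ × ℝ} {r r' q : Fin n} {X x₀ K : ℝ} {P P' : ℝ × ℝ}

/-- The state in which `r`, `r'` and `q` are in the states `a`, `b` and `c`, while every other robot
is idle at its place in `p`, with light `off`. -/
def trio (p : Fin n → ℝ × ℝ) (r r' q : Fin n) (a b c : Rob) : St n :=
  Function.update (duo p r r' a b) q c

/-- The robots `r` at `P` and `r'` at `P'` are in symmetric position with respect to the horizontal
line at height `K`, to the left of all other robots; `q` is the leftmost robot on this line. -/
structure Breaking (p : Fin n → ℝ × ℝ) (r r' q : Fin n) (X x₀ K : ℝ) (P P' : ℝ × ℝ) : Prop where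
  terrain : Terrain p r r' X
  lt : x₀ < X
  fst : P.1 = x₀
  fst' : P'.1 = x₀
  mid : P.2 + P'.2 = 2 * K
  ne : P.2 ≠ P'.2
  q_ne : q ≠ r
  q_ne' : q ≠ r'
  q_snd : (p q).2 = K
  leftmost : ∀ j, j ≠ r → j ≠ r' → (p j).2 = K → (p q).1 ≤ (p j).1

/-- The configuration with `r`, `r'` and `q` at `P`, `P'` and `Q`, and with the lights `c` and `c'` of
`r` and `r'`; all other robots, and `q`, have light `off`. -/
abbrev trioConfig (p : Fin n → ℝ × ℝ) (r r' q : Fin n) (P P' Q : ℝ × ℝ) (c c' : Light) : Config n :=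
  duoConfig (Function.update p q Q) r r' P P' c c'

namespace Breaking

variable {Q : ℝ × ℝ} {c c' : Light}

theorem symm (B : Breaking p r r' q X x₀ K P P') : Breaking p r' r q X x₀ K P' P where
  terrain := B.terrain.symm
  lt := B.lt
  fst := B.fst'
  fst' := B.fst
  mid := by linarith [B.mid]
  ne := B.ne.symm
  q_ne := B.q_ne'
  q_ne' := B.q_ne
  q_snd := B.q_snd
  leftmost j h1 h2 := B.leftmost j h2 h1

theorem pos_left : (trioConfig p r r' q P P' Q c c').pos r = P := duoConfig_pos_left

theorem pos_right (B : Breaking p r r' q X x₀ K P P') :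
    (trioConfig p r r' q P P' Q c c').pos r' = P' := duoConfig_pos_right B.terrain.ne

theorem pos_q (B : Breaking p r r' q X x₀ K P P') :
    (trioConfig p r r' q P P' Q c c').pos q = Q := by
  rw [duoConfig_pos_other B.q_ne B.q_ne', Function.update_self]

theorem pos_other {j : Fin n} (h : j ≠ r) (h' : j ≠ r') (hq : j ≠ q) :
    (trioConfig p r r' q P P' Q c c').pos j = p j := by
  rw [duoConfig_pos_other h h', Function.update_of_ne hq]

theorem config_trio (B : Breaking p r r' q X x₀ K P P') (a b c : Rob) (hc : c.light = Light.off) :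
    (trio p r r' q a b c).config = trioConfig p r r' q a.pos b.pos c.pos a.light b.light := by
  have h1 := B.q_ne
  have h2 := B.q_ne'
  simp only [St.config, trio, trioConfig, duoConfig, Config.mk.injEq]
  constructor
  · funext j
    by_cases hj : j = q
    · subst hj; simp [h1, h2]
    · rw [Function.update_of_ne hj, Function.update_of_ne hj, duo]
      split_ifs <;> rfl
  · funext j
    by_cases hj : j = q
    · subst hj; simp [h1, h2, hc]
    · rw [Function.update_of_ne hj, duo]
      split_ifs <;> rfl

theorem injective (B : Breaking p r r' q X x₀ K P P') (hQ : Q.2 = K) (hQx : Q.1 ≤ (p q).1) :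
    Function.Injective (trioConfig p r r' q P P' Q c c').pos := by
  have T := B.terrain
  have hPK : P.2 ≠ K := fun h => B.ne (by linarith [B.mid])
  have hPK' : P'.2 ≠ K := fun h => B.ne (by linarith [B.mid])
  have hpj : ∀ j, j ≠ r → j ≠ r' → P ≠ p j ∧ P' ≠ p j := fun j h1 h2 => by
    have h3 := T.le j h1 h2
    have h4 := B.lt
    constructor <;> intro h
    · have := B.fst; rw [h] at this; linarith
    · have := B.fst'; rw [h] at this; linarith
  have hQj : ∀ j, j ≠ r → j ≠ r' → j ≠ q → Q ≠ p j := by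
    intro j h1 h2 h3 h
    have h4 := B.leftmost j h1 h2 (by rw [← h, hQ])
    refine h3 (T.inj j q h1 h2 B.q_ne B.q_ne' ?_)
    rw [← h] at h4 ⊢
    exact Prod.ext (le_antisymm hQx h4) (by rw [hQ, B.q_snd])
  have hval : ∀ j, (j = r ∧ (trioConfig p r r' q P P' Q c c').pos j = P) ∨
      (j = r' ∧ (trioConfig p r r' q P P' Q c c').pos j = P') ∨
      (j = q ∧ (trioConfig p r r' q P P' Q c c').pos j = Q) ∨
      ((j ≠ r ∧ j ≠ r' ∧ j ≠ q) ∧ (trioConfig p r r' q P P' Q c c').pos j = p j) := by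
    intro j
    by_cases h1 : j = r
    · left; subst h1; exact ⟨rfl, pos_left⟩
    by_cases h2 : j = r'
    · right; left; subst h2; exact ⟨rfl, B.pos_right⟩
    by_cases h3 : j = q
    · right; right; left; subst h3; exact ⟨rfl, B.pos_q⟩
    · exact Or.inr (Or.inr (Or.inr ⟨⟨h1, h2, h3⟩, pos_other h1 h2 h3⟩))
  have hPP : P ≠ P' := fun h => B.ne (by rw [h])
  have hPQ : P ≠ Q := fun h => hPK (by rw [h, hQ])
  have hPQ' : P' ≠ Q := fun h => hPK' (by rw [h, hQ])
  intro j k h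
  rcases hval j with ⟨h1, h2⟩ | ⟨h1, h2⟩ | ⟨h1, h2⟩ | ⟨h1, h2⟩ <;>
    rcases hval k with ⟨h3, h4⟩ | ⟨h3, h4⟩ | ⟨h3, h4⟩ | ⟨h3, h4⟩ <;> rw [h2, h4] at h
  · rw [h1, h3]
  · exact absurd h hPP
  · exact absurd h hPQ
  · exact absurd h (hpj k h3.1 h3.2.1).1
  · exact absurd h.symm hPP
  · rw [h1, h3]
  · exact absurd h hPQ'
  · exact absurd h (hpj k h3.1 h3.2.1).2
  · exact absurd h.symm hPQ
  · exact absurd h.symm hPQ'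
  · rw [h1, h3]
  · exact absurd h (hQj k h3.1 h3.2.1 h3.2.2)
  · exact absurd h.symm (hpj j h1.1 h1.2.1).1
  · exact absurd h.symm (hpj j h1.1 h1.2.1).2
  · exact absurd h.symm (hQj j h1.1 h1.2.1 h1.2.2)
  · exact T.inj j k h1.1 h1.2.1 h3.1 h3.2.1 h

theorem dark (hc : c ≠ Light.leader) (hc' : c' ≠ Light.leader) :
    (trioConfig p r r' q P P' Q c c').Dark := by
  intro j
  simp only [duoConfig]
  split_ifs
  · exact hc
  · exact hc'
  · exact Light.noConfusion

theorem light_eq_symmetry {j : Fin n}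
    (h : (trioConfig p r r' q P P' Q c c').light j = Light.symmetry) :
    (j = r ∧ c = Light.symmetry) ∨ (j = r' ∧ c' = Light.symmetry) := by
  simp only [duoConfig] at h
  split_ifs at h with h1 h2
  · exact Or.inl ⟨h1, h⟩
  · exact Or.inr ⟨h2, h⟩

theorem light_ne_candidate (hc : c ≠ Light.candidate) (hc' : c' ≠ Light.candidate) (j : Fin n) :
    (trioConfig p r r' q P P' Q c c').light j ≠ Light.candidate := by
  simp only [duoConfig]
  split_ifs
  · exact hc
  · exact hc'
  · exact Light.noConfusion

theorem dec_other (B : Breaking p r r' q X x₀ K P P') (hQ : Q.2 = K) (hQx : Q.1 ≤ (p q).1)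
    (hc : c = Light.symmetry ∨ c = Light.off) (hc' : c' = Light.symmetry ∨ c' = Light.off)
    {j : Fin n} (h : j ≠ r) (h' : j ≠ r') (hq : j ≠ q) :
    dec stage2 F (trioConfig p r r' q P P' Q c c') j = (Light.off, p j) := by
  have hC := B.injective (c := c) (c' := c') hQ hQx
  have hlt : ((trioConfig p r r' q P P' Q c c').pos r).1 <
      ((trioConfig p r r' q P P' Q c c').pos j).1 := by
    rw [pos_left, pos_other h h' hq, B.fst]
    exact B.lt.trans_le (B.terrain.le j h h')
  have hcl : c ≠ Light.leader := by rcases hc with rfl | rfl <;> exact Light.noConfusion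
  have hcl' : c' ≠ Light.leader := by rcases hc' with rfl | rfl <;> exact Light.noConfusion
  have hcc : c ≠ Light.candidate := by rcases hc with rfl | rfl <;> exact Light.noConfusion
  have hcc' : c' ≠ Light.candidate := by rcases hc' with rfl | rfl <;> exact Light.noConfusion
  rw [dec_off_stay hC (dark hcl hcl') (duoConfig_light_other h h') h.symm hlt.le
    (not_leftMostTerminal_of_no_candidate hC hlt (light_ne_candidate hcc hcc') _),
    pos_other h h' hq]
  intro k l _ _ hkl _ _ hk hl hmid
  refine ⟨q, hq.symm, ?_⟩
  rw [B.pos_q, pos_other h h' hq]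
  rw [pos_other h h' hq] at hmid
  have hK : (p j).2 = K := by
    have hm := B.mid
    rcases light_eq_symmetry hk with ⟨rfl, -⟩ | ⟨rfl, -⟩ <;>
      rcases light_eq_symmetry hl with ⟨rfl, -⟩ | ⟨rfl, -⟩
    · exact absurd rfl hkl
    · rw [pos_left, B.pos_right] at hmid; linarith
    · rw [pos_left, B.pos_right] at hmid; linarith
    · exact absurd rfl hkl
  exact ⟨hQ.trans hK.symm, hQx.trans (B.leftmost j h h' hK)⟩

/-- Once `q` is to the left of the column, it sees `r`. -/
theorem visible_left (B : Breaking p r r' q X x₀ K P P') (hQx : Q.1 < x₀) :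
    (trioConfig p r r' q P P' Q c c').Visible r q := by
  refine ⟨B.q_ne, fun k hk hkq hs => ?_⟩
  rw [pos_left, B.pos_q] at hs
  obtain ⟨θ, h0, h1, hx, hy⟩ := exists_of_mem_segment hs
  have h2 := B.fst
  have h3 : ((trioConfig p r r' q P P' Q c c').pos k).1 ≤ x₀ := by rw [hx, h2]; nlinarith
  by_cases hk' : k = r'
  · subst hk'
    rw [B.pos_right] at hx hy
    rw [B.fst', h2] at hx
    have h4 : θ * (Q.1 - x₀) = 0 := by linarith
    have h5 : θ = 0 := (mul_eq_zero.1 h4).resolve_right (by linarith)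
    rw [h5] at hy
    exact B.ne (by linarith)
  · rw [pos_other hk hk' hkq] at h3
    exact absurd (B.lt.trans_le (B.terrain.le k hk hk')) (not_lt.2 h3)

/-- The states of a robot at `P` that changes its light from `symmetry` to `off`. -/
def Fading (P : ℝ × ℝ) (a : Rob) : Prop :=
  a = Rob.idle P Light.symmetry ∨ a = ⟨P, P, P, Light.symmetry, Light.off⟩ ∨
    a = Rob.idle P Light.off

/-- The number of actions left until a fading robot is `off`. -/
def fadeRank (a : Rob) : ℕ :=
  if a.nl = Light.symmetry then 2 else if a.light = Light.symmetry then 1 else 0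

theorem Fading.light {a : Rob} (h : Fading P a) :
    a.light = Light.symmetry ∨ a.light = Light.off := by
  rcases h with rfl | rfl | rfl
  · exact Or.inl rfl
  · exact Or.inl rfl
  · exact Or.inr rfl

theorem Fading.pos {a : Rob} (h : Fading P a) : a.pos = P := by
  rcases h with rfl | rfl | rfl <;> rfl

theorem Fading.act {a a' : Rob} (h : Fading P a) (ha : Act a a') :
    Fading P a' ∧ (a' = a ∨ fadeRank a' < fadeRank a) := by
  rcases h with rfl | rfl | rfl
  · rw [idle_act ha]; exact ⟨Or.inl rfl, Or.inl rfl⟩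
  · cases ha with
    | color =>
      refine ⟨Or.inr (Or.inr rfl), Or.inr ?_⟩
      simp [fadeRank]
    | move z h hz => exact Light.noConfusion h
  · rw [idle_act ha]; exact ⟨Or.inr (Or.inr rfl), Or.inl rfl⟩

/-- Robots to the left with light `off` make a robot with light `symmetry` switch off. -/
theorem Fading.look (B : Breaking p r r' q X x₀ K P P') (hQ : Q.2 = K) (hQx : Q.1 < x₀) {a b : Rob}
    (ha : Fading P a) (hb : Fading P' b) (hl : a.light = a.nl) {d : Light × (ℝ × ℝ)}
    (hd : d = dec stage2 F (trioConfig p r r' q a.pos b.pos Q a.light b.light) r) :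
    Fading P (a.plan d) ∧ ((a.plan d = a ∧ a = Rob.idle P Light.off) ∨
      fadeRank (a.plan d) < fadeRank a) := by
  have hxq : x₀ ≤ (p q).1 := B.lt.le.trans (B.terrain.le q B.q_ne B.q_ne')
  have hbl : b.light ≠ Light.leader := by
    rcases hb.light with h | h <;> rw [h] <;> exact Light.noConfusion
  have hbc : b.light ≠ Light.candidate := by
    rcases hb.light with h | h <;> rw [h] <;> exact Light.noConfusion
  have hC := B.injective (c := a.light) (c' := b.light) hQ (hQx.le.trans hxq)
  have hlt : ((trioConfig p r r' q P P' Q a.light b.light).pos q).1 <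
      ((trioConfig p r r' q P P' Q a.light b.light).pos r).1 := by
    rw [pos_left, B.pos_q, B.fst]; exact hQx
  rw [ha.pos, hb.pos] at hd
  rcases ha with rfl | rfl | rfl
  · have := dec_symmetry_off (stage2 := stage2) (F := F)
      (C := trioConfig p r r' q P P' Q Light.symmetry b.light) (i := r) (j := q)
      (dark Light.noConfusion hbl) duoConfig_light_left (B.visible_left hQx) hlt
      (duoConfig_light_other B.q_ne B.q_ne')
    rw [show d = _ from hd.trans this, pos_left]
    refine ⟨Or.inr (Or.inl rfl), Or.inr ?_⟩
    simp [fadeRank, Rob.plan, Rob.idle]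
  · exact Light.noConfusion hl
  · have := dec_off_stay (stage2 := stage2) (F := F)
      (C := trioConfig p r r' q P P' Q Light.off b.light) (i := r) (j := q) hC
      (dark Light.noConfusion hbl) duoConfig_light_left B.q_ne hlt.le
      (not_leftMostTerminal_of_no_candidate hC hlt (light_ne_candidate Light.noConfusion hbc) _) ?_
    · rw [show d = _ from hd.trans this, pos_left]
      exact ⟨Or.inr (Or.inr rfl), Or.inl ⟨rfl, rfl⟩⟩
    · intro k l _ _ hkl _ _ hk hl _
      exfalso
      rcases light_eq_symmetry hk with ⟨-, h⟩ | ⟨rfl, -⟩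
      · exact Light.noConfusion h
      · rcases light_eq_symmetry hl with ⟨-, h⟩ | ⟨rfl, -⟩
        · exact Light.noConfusion h
        · exact hkl rfl

/-- Only `r`, `r'` and `q` take part in the steps; all other robots stay. -/
theorem step_trio (B : Breaking p r r' q X x₀ K P P') {a b c : Rob} (ha : a.pos = P)
    (hb : b.pos = P') (hal : a.light = Light.symmetry ∨ a.light = Light.off)
    (hbl : b.light = Light.symmetry ∨ b.light = Light.off) (hc : c.light = Light.off)
    (hQ : c.pos.2 = K) (hQx : c.pos.1 ≤ (p q).1) {s : St n}
    (hs : Step (algorithm n stage2) F (trio p r r' q a b c) s) :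
    s = trio p r r' q a b c ∨
    (∃ i, (i = r ∨ i = r' ∨ i = q) ∧ Look (algorithm n stage2) F i (trio p r r' q a b c) s) ∨
    (∃ a', Act a a' ∧ s = trio p r r' q a' b c) ∨
    (∃ b', Act b b' ∧ s = trio p r r' q a b' c) ∨
    (∃ c', Act c c' ∧ s = trio p r r' q a b c') := by
  have h := hs.active {r, r', q} ?_
  · rcases h with h | ⟨i, hi, h | ⟨z, hz, h⟩⟩
    · exact Or.inl h
    · exact Or.inr (Or.inl ⟨i, by simpa using hi, h⟩)
    · right; right
      simp only [Set.mem_insert_iff, Set.mem_singleton_iff] at hi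
      rcases hi with rfl | rfl | rfl
      · left
        rw [trio, Function.update_of_ne B.q_ne.symm, duo_left] at hz
        refine ⟨z, hz, ?_⟩
        rw [h, trio, Function.update_comm B.q_ne, update_duo_left, trio]
      · right; left
        rw [trio, Function.update_of_ne B.q_ne'.symm, duo_right B.terrain.ne] at hz
        refine ⟨z, hz, ?_⟩
        rw [h, trio, Function.update_comm B.q_ne', update_duo_right B.terrain.ne, trio]
      · right; right
        rw [trio, Function.update_self] at hz
        refine ⟨z, hz, ?_⟩
        rw [h, trio, Function.update_idem, trio]
  · intro j hj
    simp only [Set.mem_insert_iff, Set.mem_singleton_iff, not_or] at hj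
    refine ⟨p j, Light.off, ?_, fun _ => ?_⟩
    · rw [trio, Function.update_of_ne hj.2.2, duo_other hj.1 hj.2.1]
    · rw [B.config_trio a b c hc, ha, hb]
      exact B.dec_other hQ hQx hal hbl hj.1 hj.2.1 hj.2.2

theorem look_trio (B : Breaking p r r' q X x₀ K P P') {a b c : Rob} (hc : c.light = Light.off)
    {s : St n} {i : Fin n} (hi : i = r ∨ i = r' ∨ i = q)
    (hs : Look (algorithm n stage2) F i (trio p r r' q a b c) s) :
    (i = r ∧ a.pos = a.tgt ∧ a.light = a.nl ∧ s = trio p r r' q (a.plan (dec stage2 F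
      (trioConfig p r r' q a.pos b.pos c.pos a.light b.light) r)) b c) ∨
    (i = r' ∧ b.pos = b.tgt ∧ b.light = b.nl ∧ s = trio p r r' q a (b.plan (dec stage2 F
      (trioConfig p r r' q a.pos b.pos c.pos a.light b.light) r')) c) ∨
    (i = q ∧ c.pos = c.tgt ∧ c.light = c.nl ∧ s = trio p r r' q a b (c.plan (dec stage2 F
      (trioConfig p r r' q a.pos b.pos c.pos a.light b.light) q))) := by
  obtain ⟨h1, h2, -, h3⟩ := hs
  rw [B.config_trio a b c hc] at h3
  rcases hi with rfl | rfl | rfl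
  · left
    have : trio p i r' q a b c i = a := by rw [trio, Function.update_of_ne B.q_ne.symm, duo_left]
    rw [this] at h1 h2 h3
    refine ⟨rfl, h1, h2, ?_⟩
    rw [h3, trio, Function.update_comm B.q_ne, update_duo_left, trio]
  · right; left
    have : trio p r i q a b c i = b := by
      rw [trio, Function.update_of_ne B.q_ne'.symm, duo_right B.terrain.ne]
    rw [this] at h1 h2 h3
    refine ⟨rfl, h1, h2, ?_⟩
    rw [h3, trio, Function.update_comm B.q_ne', update_duo_right B.terrain.ne, trio]
  · right; right
    have : trio p r r' i a b c i = c := by rw [trio, Function.update_self]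
    rw [this] at h1 h2 h3
    refine ⟨rfl, h1, h2, ?_⟩
    rw [h3, trio, Function.update_idem, trio]

/-- The robot `q` is to the left of the column, and `r` and `r'` switch off. -/
theorem win_of_fading (B : Breaking p r r' q X x₀ K P P') {a b c : Rob} (ha : Fading P a)
    (hb : Fading P' b) (hc : c.light = Light.off) (hcn : c.nl = Light.off) (hQ : c.pos.2 = K)
    (hQ' : c.tgt.2 = K) (hlt : c.pos.1 < x₀) (hlt' : c.tgt.1 < x₀) :
    Win (algorithm n stage2) F (trio p r r' q a b c) := by
  induction hN : fadeRank a + fadeRank b using Nat.strong_induction_on generalizing a b c with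
  | _ N ih =>
  have hxq : x₀ ≤ (p q).1 := B.lt.le.trans (B.terrain.le q B.q_ne B.q_ne')
  by_cases hoff : a = Rob.idle P Light.off ∧ b = Rob.idle P' Light.off
  · have hinj := B.injective (c := Light.off) (c' := Light.off) hQ (hlt.le.trans hxq)
    have hq : trio p r r' q a b c q = c := by rw [trio, Function.update_self]
    refine win_of_leftmost (l := q)
      (q := (trioConfig p r r' q P P' c.pos Light.off Light.off).pos)
      (fun j k _ _ h => hinj h) ?_ (by rw [hq]; exact hc) (by rw [hq]; exact hcn) ?_
    · intro j hj
      rw [trio, Function.update_of_ne hj, duo, hoff.1, hoff.2]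
      by_cases h1 : j = r
      · subst h1; rw [if_pos rfl, pos_left]
      · rw [if_neg h1]
        by_cases h2 : j = r'
        · subst h2; rw [if_pos rfl, B.pos_right]
        · rw [if_neg h2, pos_other h1 h2 hj]
    · intro j hj
      have : x₀ ≤ ((trioConfig p r r' q P P' c.pos Light.off Light.off).pos j).1 := by
        by_cases h1 : j = r
        · subst h1; rw [pos_left, B.fst]
        by_cases h2 : j = r'
        · subst h2; rw [B.pos_right, B.fst']
        · rw [pos_other h1 h2 hj]
          exact B.lt.le.trans (B.terrain.le j h1 h2)
      rw [hq]
      exact ⟨hlt.trans_le this, hlt'.trans_le this⟩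
  have hsym : a.light = Light.symmetry ∨ b.light = Light.symmetry := by
    rcases ha with rfl | rfl | rfl
    · exact Or.inl rfl
    · exact Or.inl rfl
    · rcases hb with rfl | rfl | rfl
      · exact Or.inr rfl
      · exact Or.inr rfl
      · exact absurd ⟨rfl, rfl⟩ hoff
  let S : Rob → Prop := fun c => c.light = Light.off ∧ c.nl = Light.off ∧ c.pos.2 = K ∧
    c.tgt.2 = K ∧ c.pos.1 < x₀ ∧ c.tgt.1 < x₀
  have lookr : ∀ c, S c → a.light = a.nl → ∀ d,
      d = dec stage2 F (trioConfig p r r' q a.pos b.pos c.pos a.light b.light) r →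
      (a.plan d = a ∧ a = Rob.idle P Light.off) ∨
        Win (algorithm n stage2) F (trio p r r' q (a.plan d) b c) := by
    rintro c ⟨h1, h2, h3, h4, h5, h6⟩ hl d hd
    obtain ⟨h7, h8⟩ := Fading.look B h3 h5 ha hb hl hd
    exact h8.imp id fun h8 => ih _ (by omega) h7 hb h1 h2 h3 h4 h5 h6 rfl
  have lookr' : ∀ c, S c → b.light = b.nl → ∀ d,
      d = dec stage2 F (trioConfig p r r' q a.pos b.pos c.pos a.light b.light) r' →
      (b.plan d = b ∧ b = Rob.idle P' Light.off) ∨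
        Win (algorithm n stage2) F (trio p r r' q a (b.plan d) c) := by
    rintro c ⟨h1, h2, h3, h4, h5, h6⟩ hl d hd
    rw [trioConfig, duoConfig_swap B.terrain.ne] at hd
    obtain ⟨h7, h8⟩ := Fading.look B.symm h3 h5 hb ha hl hd
    exact h8.imp id fun h8 => ih _ (by omega) ha h7 h1 h2 h3 h4 h5 h6 rfl
  have hdark : ∀ Q, (trioConfig p r r' q P P' Q a.light b.light).Dark := fun Q => by
    refine dark ?_ ?_
    · rcases ha.light with h | h <;> rw [h] <;> exact Light.noConfusion
    · rcases hb.light with h | h <;> rw [h] <;> exact Light.noConfusion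
  -- `q` waits, since it sees a light `symmetry`
  have lookq : ∀ c, S c →
      dec stage2 F (trioConfig p r r' q a.pos b.pos c.pos a.light b.light) q =
        (Light.off, c.pos) := by
    rintro c ⟨h1, h2, h3, h4, h5, h6⟩
    rw [ha.pos, hb.pos]
    have hleft : ∀ j, j ≠ q → ((trioConfig p r r' q P P' c.pos a.light b.light).pos q).1 ≤
        ((trioConfig p r r' q P P' c.pos a.light b.light).pos j).1 := by
      intro j hj
      rw [B.pos_q]
      by_cases h1 : j = r
      · subst h1; rw [pos_left, B.fst]; exact h5.le
      by_cases h2 : j = r'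
      · subst h2; rw [B.pos_right, B.fst']; exact h5.le
      · rw [pos_other h1 h2 hj]
        exact h5.le.trans (B.lt.le.trans (B.terrain.le j h1 h2))
    have hv' : (trioConfig p r r' q P P' c.pos a.light b.light).Visible r' q := by
      rw [trioConfig, duoConfig_swap B.terrain.ne]
      exact B.symm.visible_left h5
    rcases hsym with h | h
    · rw [dec_off_wait (hdark c.pos) (duoConfig_light_other B.q_ne B.q_ne') hleft
        (B.visible_left h5).symm (by rw [duoConfig_light_left]; exact h), B.pos_q]
    · rw [dec_off_wait (hdark c.pos) (duoConfig_light_other B.q_ne B.q_ne') hleft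
        hv'.symm (by rw [duoConfig_light_right B.terrain.ne]; exact h), B.pos_q]
  have hact : ∀ c c', S c → Act c c' → S c' := by
    rintro c c' ⟨h1, h2, h3, h4, h5, h6⟩ hcc
    cases hcc with
    | color => exact ⟨h2, h2, h3, h4, h5, h6⟩
    | move z h hz =>
      refine ⟨h1, h2, ?_, h4, fst_lt_of_mem_segment hz h5 h6, h6⟩
      obtain ⟨θ, -, -, -, hy⟩ := exists_of_mem_segment hz
      simp only [hy, h3, h4]
      ring
  have hS : S c := ⟨hc, hcn, hQ, hQ', hlt, hlt'⟩
  have stage : ∀ i, ((i = r ∧ a ≠ Rob.idle P Light.off) ∨ (i = r' ∧ b ≠ Rob.idle P' Light.off)) →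
      Win (algorithm n stage2) F (trio p r r' q a b c) := by
    intro i hi
    refine Win.stage _ (fun s => ∃ c, S c ∧ s = trio p r r' q a b c) i ⟨c, hS, rfl⟩ ?_ ?_ ?_
    · rintro s ⟨c, hS, rfl⟩
      rw [B.config_trio a b c hS.1, ha.pos, hb.pos]
      exact hdark _
    · rintro s s' ⟨c, hS, rfl⟩ hstep hnot
      rcases step_trio B ha.pos hb.pos ha.light hb.light hS.1 hS.2.2.1
        (hS.2.2.2.2.1.le.trans hxq) hstep with rfl | ⟨j, hj, hl⟩ | ⟨a', h1, rfl⟩ | ⟨b', h1, rfl⟩ |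
        ⟨c', h1, rfl⟩
      · exact absurd ⟨c, hS, rfl⟩ hnot
      · rcases look_trio B hS.1 hj hl with ⟨-, -, h2, rfl⟩ | ⟨-, -, h2, rfl⟩ | ⟨-, -, h2, rfl⟩
        · rcases lookr c hS h2 _ rfl with ⟨h3, -⟩ | h3
          · rw [h3] at hnot; exact absurd ⟨c, hS, rfl⟩ hnot
          · exact h3
        · rcases lookr' c hS h2 _ rfl with ⟨h3, -⟩ | h3
          · rw [h3] at hnot; exact absurd ⟨c, hS, rfl⟩ hnot
          · exact h3
        · rw [lookq c hS] at hnot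
          exact absurd ⟨c.plan (Light.off, c.pos),
            ⟨hS.1, rfl, hS.2.2.1, hS.2.2.1, hS.2.2.2.2.1, hS.2.2.2.2.1⟩, rfl⟩ hnot
      · obtain ⟨h2, rfl | h3⟩ := ha.act h1
        · exact absurd ⟨c, hS, rfl⟩ hnot
        · exact ih _ (by omega) h2 hb hS.1 hS.2.1 hS.2.2.1 hS.2.2.2.1 hS.2.2.2.2.1 hS.2.2.2.2.2 rfl
      · obtain ⟨h2, rfl | h3⟩ := hb.act h1
        · exact absurd ⟨c, hS, rfl⟩ hnot
        · exact ih _ (by omega) ha h2 hS.1 hS.2.1 hS.2.2.1 hS.2.2.2.1 hS.2.2.2.2.1 hS.2.2.2.2.2 rfl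
      · exact absurd ⟨c', hact c c' hS h1, rfl⟩ hnot
    · rintro s s' ⟨c, hS, rfl⟩ hl
      rcases look_trio B hS.1 (by tauto) hl with ⟨rfl, -, h2, rfl⟩ | ⟨rfl, -, h2, rfl⟩ |
        ⟨rfl, -, h2, rfl⟩
      · rcases lookr c hS h2 _ rfl with ⟨-, h3⟩ | h3
        · rcases hi with ⟨-, hi⟩ | ⟨hi, -⟩
          · exact absurd h3 hi
          · exact absurd hi B.terrain.ne
        · exact h3
      · rcases lookr' c hS h2 _ rfl with ⟨-, h3⟩ | h3
        · rcases hi with ⟨hi, -⟩ | ⟨-, hi⟩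
          · exact absurd hi.symm B.terrain.ne
          · exact absurd h3 hi
        · exact h3
      · rcases hi with ⟨hi, -⟩ | ⟨hi, -⟩
        · exact absurd hi B.q_ne
        · exact absurd hi B.q_ne'
  by_cases h : a = Rob.idle P Light.off
  · exact stage r' (Or.inr ⟨rfl, fun h' => hoff ⟨h, h'⟩⟩)
  · exact stage r (Or.inl ⟨rfl, h⟩)

/-- As long as no robot is to their left, the robots with light `symmetry` stay. -/
theorem dec_symmetry (B : Breaking p r r' q X x₀ K P P') (hQx : x₀ ≤ Q.1) :
    dec stage2 F (trioConfig p r r' q P P' Q Light.symmetry Light.symmetry) r =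
      (Light.symmetry, P) := by
  rw [dec_symmetry_stay (dark Light.noConfusion Light.noConfusion) duoConfig_light_left, pos_left]
  intro j hj
  exfalso
  rw [pos_left, B.fst] at hj
  by_cases h1 : j = r
  · rw [h1, pos_left, B.fst] at hj; exact lt_irrefl _ hj
  by_cases h2 : j = r'
  · rw [h2, B.pos_right, B.fst'] at hj; exact lt_irrefl _ hj
  by_cases h3 : j = q
  · rw [h3, B.pos_q] at hj; exact absurd hQx (not_le.2 hj)
  · rw [pos_other h1 h2 h3] at hj
    exact absurd (B.lt.trans_le (B.terrain.le j h1 h2)) (not_lt.2 hj.le)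

/-- A stage in which `r` and `r'` wait for `q`. -/
theorem win_of_waiting (B : Breaking p r r' q X x₀ K P P') (S : Rob → Prop)
    (hS : ∀ c, S c → c.light = Light.off ∧ c.pos.2 = K ∧ x₀ ≤ c.pos.1 ∧ c.pos.1 ≤ (p q).1)
    (hact : ∀ c c', S c → Act c c' → S c' ∨ Win (algorithm n stage2) F (trio p r r' q
      (Rob.idle P Light.symmetry) (Rob.idle P' Light.symmetry) c'))
    (hlook : ∀ c, S c → c.pos = c.tgt → c.light = c.nl → Win (algorithm n stage2) F (trio p r r' q
      (Rob.idle P Light.symmetry) (Rob.idle P' Light.symmetry) (c.plan (dec stage2 F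
      (trioConfig p r r' q P P' c.pos Light.symmetry Light.symmetry) q))))
    {c : Rob} (hc : S c) : Win (algorithm n stage2) F (trio p r r' q
      (Rob.idle P Light.symmetry) (Rob.idle P' Light.symmetry) c) := by
  refine Win.stage _ (fun s => ∃ c, S c ∧ s = trio p r r' q (Rob.idle P Light.symmetry)
    (Rob.idle P' Light.symmetry) c) q ⟨c, hc, rfl⟩ ?_ ?_ ?_
  · rintro s ⟨c, hc, rfl⟩
    rw [B.config_trio _ _ c (hS c hc).1]
    exact dark Light.noConfusion Light.noConfusion
  · rintro s s' ⟨c, hc, rfl⟩ hstep hnot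
    obtain ⟨h1, h2, h3, h4⟩ := hS c hc
    rcases step_trio B rfl rfl (Or.inl rfl) (Or.inl rfl) h1 h2 h4 hstep with rfl | ⟨j, hj, hl⟩ |
      ⟨a', h5, rfl⟩ | ⟨b', h5, rfl⟩ | ⟨c', h5, rfl⟩
    · exact absurd ⟨c, hc, rfl⟩ hnot
    · rcases look_trio B h1 hj hl with ⟨-, -, -, rfl⟩ | ⟨-, -, -, rfl⟩ | ⟨-, h6, h7, rfl⟩
      · refine absurd ⟨c, hc, ?_⟩ hnot
        congr 1
        exact congrArg (Rob.plan _) (B.dec_symmetry h3)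
      · refine absurd ⟨c, hc, ?_⟩ hnot
        congr 1
        refine congrArg (Rob.plan (Rob.idle P' Light.symmetry)) (a₂ := (Light.symmetry, P')) ?_
        rw [trioConfig, duoConfig_swap B.terrain.ne]
        exact B.symm.dec_symmetry h3
      · exact hlook c hc h6 h7
    · rw [idle_act h5] at hnot ⊢
      exact absurd ⟨c, hc, rfl⟩ hnot
    · rw [idle_act h5] at hnot ⊢
      exact absurd ⟨c, hc, rfl⟩ hnot
    · rcases hact c c' hc h5 with h | h
      · exact absurd ⟨c', h, rfl⟩ hnot
      · exact h
  · rintro s s' ⟨c, hc, rfl⟩ hl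
    rcases look_trio B (hS c hc).1 (Or.inr (Or.inr rfl)) hl with ⟨h, -⟩ | ⟨h, -⟩ | ⟨-, h6, h7, rfl⟩
    · exact absurd h B.q_ne
    · exact absurd h B.q_ne'
    · exact hlook c hc h6 h7

/-- The robot `q` is on its way along the axis to the left of `r` and `r'`. -/
theorem win_of_walking (B : Breaking p r r' q X x₀ K P P') {c : Rob} (hc : c.light = Light.off)
    (hcn : c.nl = Light.off) (hQ : c.pos.2 = K) (hQ' : c.tgt.2 = K) (hx : c.pos.1 ≤ (p q).1)
    (hx₀ : x₀ ≤ c.pos.1) (hlt : c.tgt.1 < x₀) : Win (algorithm n stage2) F (trio p r r' q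
      (Rob.idle P Light.symmetry) (Rob.idle P' Light.symmetry) c) := by
  refine B.win_of_waiting (fun c => (c.light = Light.off ∧ c.pos.2 = K ∧ x₀ ≤ c.pos.1 ∧
    c.pos.1 ≤ (p q).1) ∧ c.nl = Light.off ∧ c.tgt.2 = K ∧ c.tgt.1 < x₀) (fun c h => h.1) ?_ ?_
    ⟨⟨hc, hQ, hx₀, hx⟩, hcn, hQ', hlt⟩
  · rintro c c' ⟨⟨h1, h2, h3, h4⟩, h5, h6, h7⟩ hcc
    cases hcc with
    | color => exact Or.inl ⟨⟨h5, h2, h3, h4⟩, h5, h6, h7⟩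
    | move z h hz =>
      obtain ⟨θ, h0, h8, hzx, hzy⟩ := exists_of_mem_segment hz
      have h9 : z.2 = K := by rw [hzy, h2, h6]; ring
      rcases le_or_gt x₀ z.1 with h10 | h10
      · left
        exact ⟨⟨h1, h9, h10, by simp only [hzx]; nlinarith⟩, h5, h6, h7⟩
      · right
        exact B.win_of_fading (Or.inl rfl) (Or.inl rfl) h1 h5 h9 h6 h10 h7
  · rintro c ⟨⟨h1, h2, h3, h4⟩, h5, h6, h7⟩ h8 -
    rw [h8] at h3
    exact absurd h7 (not_lt.2 h3)

/-- Both `r` and `r'` rest with light `symmetry`, and `q` sees them. -/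
theorem win_of_symmetry (B : Breaking p r r' q X x₀ K P P')
    (hv : (duoConfig p r r' P P' Light.symmetry Light.symmetry).Visible r q)
    (hv' : (duoConfig p r r' P P' Light.symmetry Light.symmetry).Visible r' q) :
    Win (algorithm n stage2) F (duo p r r' (Rob.idle P Light.symmetry)
      (Rob.idle P' Light.symmetry)) := by
  have hxq := B.terrain.le q B.q_ne B.q_ne'
  have hlt := B.lt
  have htrio : duo p r r' (Rob.idle P Light.symmetry) (Rob.idle P' Light.symmetry) =
      trio p r r' q (Rob.idle P Light.symmetry) (Rob.idle P' Light.symmetry)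
        (Rob.idle (p q) Light.off) := by
    rw [trio, ← duo_other B.q_ne B.q_ne' (Rob.idle P Light.symmetry) (Rob.idle P' Light.symmetry),
      Function.update_eq_self]
  rw [htrio]
  refine B.win_of_waiting (fun c => c = Rob.idle (p q) Light.off) ?_ ?_ ?_ rfl
  · rintro c rfl
    exact ⟨rfl, B.q_snd, by simp only [Rob.idle]; linarith, le_rfl⟩
  · rintro c c' rfl h
    exact Or.inl (idle_act h)
  · rintro c rfl - -
    have hC := B.injective (c := Light.symmetry) (c' := Light.symmetry) B.q_snd le_rfl
    have hup : trioConfig p r r' q P P' (p q) Light.symmetry Light.symmetry =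
        duoConfig p r r' P P' Light.symmetry Light.symmetry := by
      rw [trioConfig, Function.update_eq_self]
    have key := dec_break (stage2 := stage2) (F := F)
      (C := trioConfig p r r' q P P' (p q) Light.symmetry Light.symmetry) (i := q) (k := r)
      (l := r') (dark Light.noConfusion Light.noConfusion) (duoConfig_light_other B.q_ne B.q_ne')
      (by rw [hup]; exact hv.symm) (by rw [hup]; exact hv'.symm) B.terrain.ne duoConfig_light_left
      (duoConfig_light_right B.terrain.ne)
      (fun j hj => (light_eq_symmetry hj).imp And.left And.left)
      (by rw [pos_left, B.pos_q, B.fst]; linarith) (by rw [pos_left, B.pos_right, B.fst, B.fst'])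
      (by rw [pos_left, B.pos_right, B.pos_q, B.q_snd]; exact B.mid) ?_ hC
    · rw [pos_left, B.pos_q, B.fst, B.q_snd] at key
      rw [show (Rob.idle (p q) Light.off).pos = p q from rfl, key]
      have hu := (F q).unit_pos
      refine B.win_of_walking rfl rfl B.q_snd rfl le_rfl ?_ ?_
      · simp only [Rob.plan, Rob.idle]; linarith
      · simp only [Rob.plan]; linarith
    · intro j hj hjK
      rw [B.pos_q] at hjK ⊢
      rw [B.q_snd] at hjK
      have hPK : P.2 ≠ K := fun h => B.ne (by linarith [B.mid])
      have hPK' : P'.2 ≠ K := fun h => B.ne (by linarith [B.mid])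
      by_cases h1 : j = r
      · rw [h1, pos_left] at hjK; exact absurd hjK hPK
      by_cases h2 : j = r'
      · rw [h2, B.pos_right] at hjK; exact absurd hjK hPK'
      rw [pos_other h1 h2 hj] at hjK ⊢
      refine lt_of_le_of_ne (B.leftmost j h1 h2 hjK) fun h => hj ?_
      exact B.terrain.inj j q h1 h2 B.q_ne B.q_ne' (Prod.ext h.symm (hjK.trans B.q_snd.symm))

end Breaking

end Trio

/-! ### Two candidates at the same abscissa -/

section Candidates

variable {n : ℕ} {stage2 : Snapshot → Action} {F : Fin n → Frame}
  {p : Fin n → ℝ × ℝ} {r r' : Fin n} {X x₀ τ h h' : ℝ}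

theorem Exposed.visible {c c' : Light} {P P' : ℝ × ℝ} (hE : Exposed p r r' x₀ τ P.2)
    (T : Terrain p r r' X) (hx : x₀ < X) (hP : P.1 = x₀) (hP' : P'.1 = x₀) (hne : P ≠ P')
    {q : Fin n} (hq : q ≠ r) (hq' : q ≠ r') : (duoConfig p r r' P P' c c').Visible r q := by
  refine ⟨hq, fun k hk hkq => ?_⟩
  rw [duoConfig_pos_left, duoConfig_pos_other hq hq']
  by_cases hk' : k = r'
  · rw [hk', duoConfig_pos_right T.ne]
    intro hs
    obtain ⟨θ, -, -, h1, h2⟩ := exists_of_mem_segment hs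
    have h3 := T.le q hq hq'
    have h4 : θ * ((p q).1 - x₀) = 0 := by rw [hP, hP'] at h1; linarith
    rcases mul_eq_zero.1 h4 with h5 | h5
    · rw [h5] at h2
      exact hne (Prod.ext (hP.trans hP'.symm) (by linarith))
    · linarith
  · rw [duoConfig_pos_other hk hk', show P = (x₀, P.2) from Prod.ext hP rfl]
    exact hE.1 q hq hq' k hk hk' hkq

/-- Two resting candidates in a column to the left of all other robots, if the configuration has no
symmetry that the algorithm cannot break. -/
theorem win_of_column (T : Terrain p r r' X) (hx : x₀ < X) (hτ : τ = 1 ∨ τ = -1)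
    (hh : 0 < τ * (h' - h))
    (hsymm : ¬ (h + h' = 2 * midline p r r' X ∧
      (∀ j, j ≠ r → j ≠ r' → ∃ k, k ≠ r ∧ k ≠ r' ∧
        p k = ((p j).1, 2 * midline p r r' X - (p j).2)) ∧
      ∀ j, j ≠ r → j ≠ r' → (p j).2 ≠ midline p r r' X)) :
    Win (algorithm n stage2) F (duo p r r' (Rob.idle (x₀, h) Light.candidate)
      (Rob.idle (x₀, h') Light.candidate)) := by
  refine win_of_candidates T hx hτ hh hsymm fun hK hK' hp hex => ?_
  have hττ : τ * τ = 1 := by rcases hτ with rfl | rfl <;> norm_num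
  set K := midline p r r' X with hKdef
  have hm : Mirrored p r r' K := by
    intro j hj hj'
    by_cases hjK : (p j).2 = K
    · exact ⟨j, hj, hj', Prod.ext rfl (by simp only [hjK]; ring)⟩
    · exact exists_mirror hτ hp hj hj' hjK
  obtain ⟨R, S, L⟩ := exists_ladder (M := max (τ * (K - h)) (τ * (h' - K))) T hx hτ hm
    (lt_max_of_lt_left hK)
  have hRpos : 0 < R := L.pos.trans_le (L.bound _ L.bottom).2
  have D : Tie p r r' X x₀ τ (max (τ * (K - h)) (τ * (h' - K))) R S (τ * (K - h))
      (τ * (h' - K)) := by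
    refine ⟨T, hx, hτ, L, hp, ?_, hK, hK', le_max_left _ _, le_max_right _ _, ?_⟩
    · intro hn
      obtain ⟨j, hj, hj', hjK⟩ := hex
      exact hn j hj hj' hjK
    · rcases max_choice (τ * (K - h)) (τ * (h' - K)) with h1 | h1
      · exact Or.inl h1.symm
      · exact Or.inr h1.symm
  obtain ⟨q, hq, hmin⟩ := Finset.exists_min_image
    (Finset.univ.filter fun j => j ≠ r ∧ j ≠ r' ∧ (p j).2 = K) (fun j => (p j).1)
    (by obtain ⟨j, hj⟩ := hex; exact ⟨j, by simpa using hj⟩)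
  simp only [Finset.mem_filter, Finset.mem_univ, true_and] at hq hmin
  have hτR : τ * R ≠ 0 := mul_ne_zero (by rcases hτ with rfl | rfl <;> norm_num) hRpos.ne'
  have hne : K - τ * R ≠ K - -τ * R := fun h => hτR (by linarith)
  have B : Breaking p r r' q X x₀ K (x₀, K - τ * R) (x₀, K - -τ * R) :=
    ⟨T, hx, rfl, rfl, by simp only; ring, hne, hq.1, hq.2.1, hq.2.2,
      fun j hj hj' hjK => hmin j ⟨hj, hj', hjK⟩⟩
  refine D.win_of_climbs (B.win_of_symmetry ?_ ?_) ?_ ?_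
  · exact L.exposed.visible T hx rfl rfl (fun h => hne (Prod.mk.injEq _ _ _ _ ▸ h).2) hq.1 hq.2.1
  · rw [duoConfig_swap T.ne]
    exact (exposed_swap.2 L.exposed').visible T.symm hx rfl rfl
      (fun h => hne (Prod.mk.injEq _ _ _ _ ▸ h).2.symm) hq.2.1 hq.1
  · have h1 : K - τ * (τ * (K - h)) = h := by linear_combination -(K - h) * hττ
    exact ⟨_, _, by rw [h1]; rfl, by rw [h1]; rfl, le_rfl, le_rfl,
      (le_max_left _ _).trans (L.bound _ L.bottom).2, Or.inr rfl, Or.inl ⟨rfl, rfl⟩⟩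
  · have h1 : K - -τ * (τ * (h' - K)) = h' := by linear_combination (h' - K) * hττ
    exact ⟨_, _, by rw [h1]; rfl, by rw [h1]; rfl, le_rfl, le_rfl,
      (le_max_right _ _).trans (L.bound _ L.bottom).2, Or.inr rfl, Or.inl ⟨rfl, rfl⟩⟩

end Candidates

/-! ### Both ends of the leftmost column leave it -/

section Leave

variable {n : ℕ} {stage2 : Snapshot → Action} {F : Fin n → Frame} {C : Config n} {i : Fin n}

/-- The destination of a robot that leaves the leftmost column, if there is a robot to the right. -/
theorem toPlane_computeDestination (hC : Function.Injective C.pos) (f : Frame) {Y : ℝ}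
    (hY : (C.pos i).1 < Y) (hex : ∃ j, (C.pos j).1 = Y)
    (hmin : ∀ j, (C.pos i).1 < (C.pos j).1 → Y ≤ (C.pos j).1) :
    f.toPlane (C.pos i) (computeDestination (C.snapshot f i)) =
      ((C.pos i).1 - (Y - (C.pos i).1), (C.pos i).2) := by
  have hu := f.unit_pos
  obtain ⟨j, hj⟩ := hex
  obtain ⟨m, hm, hms⟩ := Config.exists_visible_mem_segment hC (i := i) (j := j)
    (fun h => by rw [h] at hj; exact hY.ne hj)
  -- the robot nearest to the observer on the way to the next column belongs to this column
  have hmY : (C.pos m).1 = Y := by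
    obtain ⟨θ, h0, h1, hx, hy⟩ := exists_of_mem_segment hms
    rw [hj] at hx
    refine le_antisymm (by nlinarith) (hmin m ?_)
    rcases h0.eq_or_lt with h | h
    · subst h
      exact absurd (hC (Prod.ext (by simpa using hx) (by simpa using hy))) hm.1
    · nlinarith
  have hright : C.sighting f i m ∈ (C.snapshot f i).right := by
    rw [Snapshot.right, Finset.mem_filter]
    exact ⟨Config.mem_others.2 ⟨m, hm, rfl⟩, Config.sighting_x_pos.2 (by rwa [hmY])⟩
  have hne : (C.snapshot f i).right.Nonempty := ⟨_, hright⟩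
  have hgap : (C.snapshot f i).gap = (Y - (C.pos i).1) / f.unit := by
    rw [Snapshot.gap, dif_pos hne]
    refine le_antisymm ((Finset.inf'_le _ hright).trans_eq (by simp only [Config.sighting, hmY]))
      (Finset.le_inf' _ _ fun q hq => ?_)
    rw [Snapshot.right, Finset.mem_filter] at hq
    obtain ⟨l, -, rfl⟩ := Config.mem_others.1 hq.1
    have := hmin l (Config.sighting_x_pos.1 hq.2)
    simp only [Config.sighting]
    gcongr
  rw [computeDestination, if_pos hne, hgap, Frame.toPlane]
  ext <;> simp only
  · field_simp; ring
  · ring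

/-- The destination of a robot that leaves the leftmost column, if there is no robot to the
right. -/
theorem toPlane_computeDestination_unit (f : Frame) (h : ∀ j, (C.pos j).1 ≤ (C.pos i).1) :
    f.toPlane (C.pos i) (computeDestination (C.snapshot f i)) =
      ((C.pos i).1 - f.unit, (C.pos i).2) := by
  rw [computeDestination, if_neg, Frame.toPlane]
  · ext <;> simp only <;> ring
  · rintro ⟨q, hq⟩
    rw [Snapshot.right, Finset.mem_filter] at hq
    obtain ⟨l, -, rfl⟩ := Config.mem_others.1 hq.1
    exact absurd (Config.sighting_x_pos.1 hq.2) (not_lt.2 (h l))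

theorem dec_leave (hC : Function.Injective C.pos) (hd : C.Dark)
    (hs : ∀ j, C.light j ≠ Light.symmetry)
    (hc : ∀ j k, j ≠ k → (C.pos j).1 = (C.pos k).1 → C.light j = Light.candidate →
      C.light k ≠ Light.candidate) (hi : C.light i = Light.off) {j : Fin n} (hj : j ≠ i)
    (hji : (C.pos j).1 ≤ (C.pos i).1) (hterm : LeftMostTerminal (C.snapshot (F i) i)) :
    dec stage2 F C i = (Light.terminal,
      (F i).toPlane (C.pos i) (computeDestination (C.snapshot (F i) i))) := by
  rw [dec, decision, algorithm_phase1 hd hs hc, phase1_off (by exact hi),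
    if_neg (not_uniqueLeftmost hC hj hji), if_pos hterm]

end Leave

section Start

variable {n : ℕ} {stage2 : Snapshot → Action} {F : Fin n → Frame}
  {p : Fin n → ℝ × ℝ} {r r' : Fin n} {X x₁ τ d d' : ℝ} {k k' : ℕ} {a b : Rob}

/-- The leftmost column of the initial configuration has the abscissa `x₁` and the different end
points `r` and `r'`. They will leave it by the distances `d` and `d'`: the distance to the next
column if there is one, and their units of length otherwise. -/
structure Start (F : Fin n → Frame) (p : Fin n → ℝ × ℝ) (r r' : Fin n) (X x₁ τ d d' : ℝ) :
    Prop where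
  inj : Function.Injective p
  terrain : Terrain p r r' X
  sign : τ = 1 ∨ τ = -1
  fst : (p r).1 = x₁
  fst' : (p r').1 = x₁
  le : x₁ ≤ X
  lt : τ * (p r).2 < τ * (p r').2
  between : ∀ j, j ≠ r → j ≠ r' → (p j).1 = x₁ →
    τ * (p r).2 < τ * (p j).2 ∧ τ * (p j).2 < τ * (p r').2
  dist : (∃ Y, x₁ < Y ∧ (∃ j, j ≠ r ∧ j ≠ r' ∧ (p j).1 = Y) ∧
      (∀ j, j ≠ r → j ≠ r' → x₁ < (p j).1 → Y ≤ (p j).1) ∧ d = Y - x₁ ∧ d' = Y - x₁) ∨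
    ((∀ j, j ≠ r → j ≠ r' → (p j).1 = x₁) ∧ d = (F r).unit ∧ d' = (F r').unit)

/-- The successive states of a robot that leaves its place `P` to the left by the distance `d` and
becomes a candidate, numbered backwards: it rests, goes, switches to `candidate`, has arrived. -/
inductive Leaving (P : ℝ × ℝ) (d : ℝ) : ℕ → Rob → Prop
  | home : Leaving P d 3 (Rob.idle P Light.off)
  | go (a : Rob) (htgt : a.tgt = (P.1 - d, P.2)) (hpos : a.pos.2 = P.2) (hle : P.1 - d ≤ a.pos.1)
      (hle' : a.pos.1 ≤ P.1) (hnl : a.nl = Light.terminal)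
      (hlight : a.light = Light.off ∧ a.pos = P ∨ a.light = Light.terminal) : Leaving P d 2 a
  | switch : Leaving P d 1 ⟨(P.1 - d, P.2), (P.1 - d, P.2), (P.1 - d, P.2), Light.terminal,
      Light.candidate⟩
  | arrived : Leaving P d 0 (Rob.idle (P.1 - d, P.2) Light.candidate)

theorem Start.symm (S : Start F p r r' X x₁ τ d d') : Start F p r' r X x₁ (-τ) d' d where
  inj := S.inj
  terrain := S.terrain.symm
  sign := by rcases S.sign with rfl | rfl <;> simp
  fst := S.fst'
  fst' := S.fst
  le := S.le
  lt := by linarith [S.lt]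
  between j hj hj' hx := by
    obtain ⟨h1, h2⟩ := S.between j hj' hj hx
    constructor <;> linarith
  dist := by
    rcases S.dist with ⟨Y, h1, ⟨j, h2, h3, h4⟩, h5, h6, h7⟩ | ⟨h1, h2, h3⟩
    · exact Or.inl ⟨Y, h1, ⟨j, h3, h2, h4⟩, fun j hj hj' => h5 j hj' hj, h7, h6⟩
    · exact Or.inr ⟨fun j hj hj' => h1 j hj' hj, h3, h2⟩

theorem Start.pos (S : Start F p r r' X x₁ τ d d') : 0 < d := by
  rcases S.dist with ⟨Y, h1, -, -, h6, -⟩ | ⟨-, h2, -⟩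
  · linarith
  · rw [h2]; exact (F r).unit_pos

namespace Leaving

variable {P : ℝ × ℝ} {a' : Rob}

theorem snd (h : Leaving P d k a) : a.pos.2 = P.2 := by
  cases h <;> first | rfl | assumption

theorem le_fst (h : Leaving P d k a) (hd : 0 < d) : P.1 - d ≤ a.pos.1 := by
  cases h <;> first | assumption | simp [Rob.idle] <;> linarith

theorem fst_le (h : Leaving P d k a) (hd : 0 < d) : a.pos.1 ≤ P.1 := by
  cases h <;> first | assumption | simp [Rob.idle] <;> linarith

theorem light (h : Leaving P d k a) :
    a.light = Light.off ∧ a.pos = P ∨ a.light = Light.terminal ∨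
      a.light = Light.candidate ∧ k = 0 ∧ a.pos = (P.1 - d, P.2) := by
  cases h <;> simp_all [Rob.idle]

theorem le_three (h : Leaving P d k a) : k ≤ 3 := by cases h <;> omega

theorem act (h : Leaving P d k a) (ha : Act a a') :
    Leaving P d k a' ∨ ∃ l < k, Leaving P d l a' := by
  cases h with
  | home => rw [idle_act ha]; exact Or.inl home
  | arrived => rw [idle_act ha]; exact Or.inl arrived
  | switch =>
    cases ha with
    | color => exact Or.inr ⟨0, by omega, arrived⟩
    | move z h => exact Light.noConfusion h
  | go _ htgt hpos hle hle' hnl hlight =>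
    left
    cases ha with
    | color => exact go _ htgt hpos hle hle' hnl (Or.inr hnl)
    | move z h hz =>
      obtain ⟨θ, h0, h1, hx, hy⟩ := exists_of_mem_segment hz
      rw [htgt] at hx hy
      simp only at hx hy
      refine go _ htgt (by simp only; rw [hy, hpos]; ring) ?_ ?_ hnl (Or.inr (h.trans hnl))
      · simp only; nlinarith
      · simp only; nlinarith

end Leaving

namespace Start

/-- The positions of the end points while they leave are different from each other and from those
of all other robots. -/
theorem injective (S : Start F p r r' X x₁ τ d d') (ha : Leaving (p r) d k a)
    (hb : Leaving (p r') d' k' b) {c c' : Light} :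
    Function.Injective (duoConfig p r r' a.pos b.pos c c').pos := by
  have h1 : ∀ {r r' τ d d' k a}, Start F p r r' X x₁ τ d d' → Leaving (p r) d k a →
      ∀ j, j ≠ r → j ≠ r' → a.pos ≠ p j := by
    intro r r' τ d d' k a S ha j hj hj' heq
    have h2 := ha.fst_le S.pos
    have h3 := S.terrain.le j hj hj'
    have h4 := S.le
    rw [S.fst, heq] at h2
    refine hj (S.inj (Prod.ext ?_ ?_))
    · rw [S.fst]; linarith
    · rw [← heq, ha.snd]
  have h2 : a.pos ≠ b.pos := by
    intro heq
    have := S.lt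
    rw [← ha.snd, ← hb.snd, heq] at this
    exact lt_irrefl _ this
  have hS := h1 S ha
  have hS' := h1 S.symm hb
  intro i j h
  simp only [duoConfig] at h
  split_ifs at h with h4 h5 h6 h7 h8 h9
  all_goals first
    | (subst_vars; rfl)
    | (exact absurd h h2)
    | (exact absurd h.symm h2)
    | (exact absurd h (hS _ (by assumption) (by assumption)))
    | (exact absurd h.symm (hS _ (by assumption) (by assumption)))
    | (exact absurd h (hS' _ (by assumption) (by assumption)))
    | (exact absurd h.symm (hS' _ (by assumption) (by assumption)))
    | (exact S.inj h)

theorem lights (S : Start F p r r' X x₁ τ d d') (ha : Leaving (p r) d k a)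
    (hb : Leaving (p r') d' k' b) (hk : ¬ (k = 0 ∧ k' = 0)) :
    (duoConfig p r r' a.pos b.pos a.light b.light).Dark ∧
    (∀ j, (duoConfig p r r' a.pos b.pos a.light b.light).light j ≠ Light.symmetry) ∧
    ∀ i j, i ≠ j → (duoConfig p r r' a.pos b.pos a.light b.light).light i = Light.candidate →
      (duoConfig p r r' a.pos b.pos a.light b.light).light j ≠ Light.candidate := by
  have h1 := ha.light
  have h2 := hb.light
  refine ⟨fun j => ?_, fun j => ?_, fun i j hij => ?_⟩
  · simp only [duoConfig]
    split_ifs <;> aesop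
  · simp only [duoConfig]
    split_ifs <;> aesop
  · simp only [duoConfig]
    split_ifs <;> aesop

/-- When `r` has arrived at its new place, it does not hide all other robots on the left from a robot
`j` that is an end of its own column: if `j` is still in the column of `r'`, then `r'` is beyond it,
and otherwise `r'` is not behind `r`, as it is on the other side of `j`, or its way to the left is
not longer. -/
theorem not_hidden (S : Start F p r r' X x₁ τ d d') (ha : Leaving (p r) d k a)
    (hb : Leaving (p r') d' k' b) (hac : a.pos = ((p r).1 - d, (p r).2)) {j : Fin n}
    (hj : j ≠ r) (hj' : j ≠ r')
    (hseg : ∀ l, ((duoConfig p r r' a.pos b.pos a.light b.light).pos l).1 < (p j).1 →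
      a.pos ∈ segment ℝ (p j) ((duoConfig p r r' a.pos b.pos a.light b.light).pos l))
    (hterm : (p j).2 ≤ a.pos.2 ∧ (duoConfig p r r' a.pos b.pos a.light b.light).IsBottom j ∨
      a.pos.2 ≤ (p j).2 ∧ (duoConfig p r r' a.pos b.pos a.light b.light).IsTop j) : False := by
  have T := S.terrain
  have hd := S.pos
  have hle := S.le
  have hb1 := hb.fst_le S.symm.pos
  have hb2 := hb.snd
  have hlt := S.lt
  rw [S.fst'] at hb1
  have hXj := T.le j hj hj'
  have hpr : (duoConfig p r r' a.pos b.pos a.light b.light).pos r' = b.pos :=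
    duoConfig_pos_right T.ne
  have hpj : (duoConfig p r r' a.pos b.pos a.light b.light).pos j = p j :=
    duoConfig_pos_other hj hj'
  -- the robot belongs to the first of the remaining columns
  have hjX : (p j).1 = X := by
    by_contra hne
    obtain ⟨t, ht, ht', htX⟩ := T.ex
    have h2 : X < (p j).1 := lt_of_le_of_ne hXj (Ne.symm hne)
    have h3 := hseg t (by rwa [duoConfig_pos_other ht ht', htX])
    rw [duoConfig_pos_other ht ht', hac, S.fst] at h3
    obtain ⟨θ, h4, h5, hx, -⟩ := exists_of_mem_segment h3
    rw [htX] at hx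
    simp only at hx
    nlinarith
  by_cases hbj : b.pos.1 < (p j).1
  · have h3 := hseg r' (by rwa [hpr])
    rw [hpr, hac, S.fst] at h3
    obtain ⟨θ, h4, h5, hx, hy⟩ := exists_of_mem_segment h3
    simp only at hx hy
    by_cases hX : x₁ = X
    · obtain ⟨h6, h7⟩ := S.between j hj hj' (hjX.trans hX.symm)
      rw [hb2] at hy
      have : τ * (p r).2 = τ * (p j).2 + θ * (τ * (p r').2 - τ * (p j).2) := by rw [hy]; ring
      nlinarith
    · have hX' : x₁ < X := lt_of_le_of_ne hle hX
      have hdd : d = d' := by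
        rcases S.dist with ⟨Y, -, -, -, h6, h7⟩ | ⟨h6, -⟩
        · rw [h6, h7]
        · exact absurd (h6 j hj hj') (by rw [hjX]; exact hX'.ne')
      have h8 := hb.le_fst S.symm.pos
      rw [S.fst', ← hdd] at h8
      have hθ : θ = 1 := by nlinarith
      rw [hθ, hb2] at hy
      have : (p r).2 = (p r').2 := by linarith
      rw [this] at hlt
      exact lt_irrefl _ hlt
  · have hbx : b.pos.1 = (p j).1 := by linarith
    have hX : (p j).1 = x₁ := by linarith
    obtain ⟨h6, h7⟩ := S.between j hj hj' hX
    rw [ha.snd] at hterm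
    rcases hterm with ⟨h8, h9⟩ | ⟨h8, h9⟩
    · have h10 := h9 r' (by rw [hpr, hpj, hbx])
      rw [hpr, hpj, hb2] at h10
      rcases S.sign with h | h <;> rw [h] at h6 h7 <;> linarith
    · have h10 := h9 r' (by rw [hpr, hpj, hbx])
      rw [hpr, hpj, hb2] at h10
      rcases S.sign with h | h <;> rw [h] at h6 h7 <;> linarith

/-- The robots different from the end points stay. -/
theorem dec_other (S : Start F p r r' X x₁ τ d d') (ha : Leaving (p r) d k a)
    (hb : Leaving (p r') d' k' b) (hk : ¬ (k = 0 ∧ k' = 0)) {j : Fin n} (hj : j ≠ r)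
    (hj' : j ≠ r') : dec stage2 F (duoConfig p r r' a.pos b.pos a.light b.light) j =
      (Light.off, p j) := by
  have T := S.terrain
  have hC := S.injective ha hb (c := a.light) (c' := b.light)
  obtain ⟨hdark, hsym, hcand⟩ := S.lights ha hb hk
  have hpr : (duoConfig p r r' a.pos b.pos a.light b.light).pos r = a.pos := duoConfig_pos_left
  have hpr' : (duoConfig p r r' a.pos b.pos a.light b.light).pos r' = b.pos :=
    duoConfig_pos_right T.ne
  have hpj : (duoConfig p r r' a.pos b.pos a.light b.light).pos j = p j :=
    duoConfig_pos_other hj hj'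
  have hXj := T.le j hj hj'
  have hle := S.le
  have ha1 := ha.fst_le S.pos
  have hb1 := hb.fst_le S.symm.pos
  rw [S.fst] at ha1
  rw [S.fst'] at hb1
  have key := dec_off_stay (stage2 := stage2) (F := F) hC hdark (duoConfig_light_other hj hj')
    hj.symm (by rw [hpr, hpj]; linarith) ?_ fun k l _ _ _ _ _ h => absurd h (hsym k)
  · rw [key, hpj]
  · by_cases hall : ∀ l, ((duoConfig p r r' a.pos b.pos a.light b.light).pos j).1 ≤
        ((duoConfig p r r' a.pos b.pos a.light b.light).pos l).1
    · rw [Config.leftMostTerminal_iff_of_forall_le hC hall]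
      have h1 := hall r
      have h2 := hall r'
      rw [hpr, hpj] at h1
      rw [hpr', hpj] at h2
      obtain ⟨h6, h7⟩ := S.between j hj hj' (by linarith)
      have h3 : a.pos.1 = (p j).1 := by linarith
      have h4 : b.pos.1 = (p j).1 := by linarith
      rintro (h | h)
      · have h8 := h r (by rw [hpr, hpj, h3])
        have h9 := h r' (by rw [hpr', hpj, h4])
        rw [hpr, hpj, ha.snd] at h8
        rw [hpr', hpj, hb.snd] at h9
        rcases S.sign with h | h <;> rw [h] at h6 h7 <;> linarith
      · have h8 := h r (by rw [hpr, hpj, h3])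
        have h9 := h r' (by rw [hpr', hpj, h4])
        rw [hpr, hpj, ha.snd] at h8
        rw [hpr', hpj, hb.snd] at h9
        rcases S.sign with h | h <;> rw [h] at h6 h7 <;> linarith
    · push Not at hall
      obtain ⟨l, hl⟩ := hall
      rw [Config.leftMostTerminal_iff_of_lt hC hl]
      rintro ⟨m, hm, hmx, hmc, hseg, hterm⟩
      rw [hpj] at hseg hterm
      by_cases hmr : m = r
      · rw [hmr, hpr] at hseg hterm
        rw [hmr, duoConfig_light_left] at hmc
        have := ha.light
        simp only [hmc, reduceCtorEq, false_and, true_and, false_or] at this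
        exact S.not_hidden ha hb this.2 hj hj' hseg hterm
      by_cases hmr' : m = r'
      · rw [hmr', hpr'] at hseg hterm
        rw [hmr', duoConfig_light_right T.ne] at hmc
        have := hb.light
        simp only [hmc, reduceCtorEq, false_and, true_and, false_or] at this
        rw [duoConfig_swap T.ne] at hseg hterm
        exact S.symm.not_hidden hb ha this.2 hj' hj hseg hterm
      · rw [duoConfig_light_other hmr hmr'] at hmc
        exact Light.noConfusion hmc

/-- The destination of an end point at its initial place. -/
theorem destination (S : Start F p r r' X x₁ τ d d') (hb : Leaving (p r') d' k' b) {c c' : Light} :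
    (F r).toPlane (p r) (computeDestination
      ((duoConfig p r r' (p r) b.pos c c').snapshot (F r) r)) = ((p r).1 - d, (p r).2) := by
  have hC := S.injective (k := 3) Leaving.home hb (c := c) (c' := c')
  have hpr : (duoConfig p r r' (p r) b.pos c c').pos r = p r := duoConfig_pos_left
  have hpr' : (duoConfig p r r' (p r) b.pos c c').pos r' = b.pos :=
    duoConfig_pos_right S.terrain.ne
  have hb1 := hb.fst_le S.symm.pos
  rw [S.fst'] at hb1
  rcases S.dist with ⟨Y, h1, ⟨j, h2, h3, h4⟩, h5, h6, h7⟩ | ⟨h1, h2, h3⟩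
  · have := toPlane_computeDestination (i := r) hC (F r) (Y := Y) ?_ ⟨j, ?_⟩ ?_
    · simp only [Rob.idle, hpr] at this
      rw [this, h6, S.fst]
    · simp only [Rob.idle, hpr, S.fst, h1]
    · rw [duoConfig_pos_other h2 h3, h4]
    · intro l hl
      simp only [Rob.idle, hpr, S.fst] at hl
      by_cases hlr : l = r
      · rw [hlr, hpr, S.fst] at hl; exact absurd hl (lt_irrefl _)
      by_cases hlr' : l = r'
      · rw [hlr', hpr'] at hl; exact absurd hl (not_lt.2 hb1)
      simp only [duoConfig_pos_other hlr hlr'] at hl ⊢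
      exact h5 l hlr hlr' hl
  · have := toPlane_computeDestination_unit (C := duoConfig p r r' (p r) b.pos c c') (i := r) (F r) ?_
    · rw [hpr] at this
      rw [this, h2]
    · intro l
      rw [hpr, S.fst]
      by_cases hlr : l = r
      · rw [hlr, hpr, S.fst]
      by_cases hlr' : l = r'
      · rw [hlr', hpr']; exact hb1
      rw [duoConfig_pos_other hlr hlr', h1 l hlr hlr']

/-- A snapshot of an end point either brings it closer to its new place, or changes nothing; the
latter happens only when it has arrived, or while the other one is on its way. -/
theorem look (S : Start F p r r' X x₁ τ d d') (ha : Leaving (p r) d k a)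
    (hb : Leaving (p r') d' k' b) (hk : ¬ (k = 0 ∧ k' = 0)) (hpos : a.pos = a.tgt)
    (hl : a.light = a.nl) :
    (∃ l < k, Leaving (p r) d l
      (a.plan (dec stage2 F (duoConfig p r r' a.pos b.pos a.light b.light) r))) ∨
    Leaving (p r) d k (a.plan (dec stage2 F (duoConfig p r r' a.pos b.pos a.light b.light) r)) ∧
      (k = 0 ∨ k = 3 ∧ (k' = 1 ∨ k' = 2)) := by
  have T := S.terrain
  have hC := S.injective ha hb (c := a.light) (c' := b.light)
  obtain ⟨hdark, hsym, hcand⟩ := S.lights ha hb hk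
  have hpr : (duoConfig p r r' a.pos b.pos a.light b.light).pos r = a.pos := duoConfig_pos_left
  have hlr : (duoConfig p r r' a.pos b.pos a.light b.light).light r = a.light :=
    duoConfig_light_left
  have hpr' : (duoConfig p r r' a.pos b.pos a.light b.light).pos r' = b.pos :=
    duoConfig_pos_right T.ne
  have hlr' : (duoConfig p r r' a.pos b.pos a.light b.light).light r' = b.light :=
    duoConfig_light_right T.ne
  have hb1 := hb.fst_le S.symm.pos
  rw [S.fst'] at hb1
  have hle := S.le
  have hlt := S.lt
  have hd := S.pos
  cases ha with
  | switch => exact Light.noConfusion hl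
  | go _ htgt hpos' hle hle' hnl hlight =>
    left
    refine ⟨1, by omega, ?_⟩
    rw [dec_terminal hdark hsym (fun i j h _ => hcand i j h) (hlr.trans (hl.trans hnl)), hpr,
      Rob.plan, hpos, htgt, hl, hnl]
    exact Leaving.switch
  | arrived =>
    right
    refine ⟨?_, Or.inl rfl⟩
    rw [dec_candidate_stay hdark hsym (fun i j h _ => hcand i j h) hlr, hpr]
    · exact Leaving.arrived
    · intro j hj
      refine hcand r j (fun h => ?_) hlr
      rw [← h] at hj
      exact lt_irrefl _ hj
    · intro j hj hjo
      rw [hpr] at hj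
      change _ < (p r).1 - d at hj
      have hfst := S.fst
      by_cases hjr : j = r
      · rw [hjr, hlr] at hjo; exact Light.noConfusion hjo
      by_cases hjr' : j = r'
      · rw [hjr', hpr'] at hj
        rw [hjr', hlr'] at hjo
        have h1 := hb.light
        simp only [hjo, reduceCtorEq, false_and, true_and, or_false] at h1
        rw [h1, S.fst'] at hj
        linarith
      · rw [duoConfig_pos_other hjr hjr'] at hj
        have := T.le j hjr hjr'
        linarith
  | home =>
    simp only [Rob.idle] at hC hpr hpr' hlr hlr' hdark hsym hcand
    have hoth : ∀ j, j ≠ r → j ≠ r' → x₁ ≤ (p j).1 := fun j hj hj' => hle.trans (T.le j hj hj')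
    have hterm : LeftMostTerminal ((duoConfig p r r' (p r) b.pos Light.off b.light).snapshot
        (F r) r) → Leaving (p r) d 2 ((Rob.idle (p r) Light.off).plan
          (dec stage2 F (duoConfig p r r' (p r) b.pos Light.off b.light) r)) := by
      intro h
      rw [dec_leave hC hdark hsym (fun i j h _ => hcand i j h) hlr T.ne.symm
        (by rw [hpr, hpr']; exact hb1.trans_eq S.fst.symm) h]
      have h2 := S.destination hb (c := Light.off) (c' := b.light)
      simp only [Rob.idle, Rob.plan, duoConfig_pos_left, h2]
      exact Leaving.go _ rfl rfl (by simp only; linarith) le_rfl rfl (Or.inl ⟨rfl, rfl⟩)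
    -- `r` is the last robot of its column in one direction
    have hend : ∀ j, ((duoConfig p r r' (p r) b.pos Light.off b.light).pos j).1 =
        ((duoConfig p r r' (p r) b.pos Light.off b.light).pos r).1 → τ * (p r).2 ≤
        τ * ((duoConfig p r r' (p r) b.pos Light.off b.light).pos j).2 := by
      intro j hj
      by_cases hjr : j = r
      · rw [hjr, duoConfig_pos_left]
      by_cases hjr' : j = r'
      · rw [hjr', duoConfig_pos_right T.ne, hb.snd]; exact hlt.le
      · rw [duoConfig_pos_left, duoConfig_pos_other hjr hjr'] at hj
        rw [duoConfig_pos_other hjr hjr']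
        exact (S.between j hjr hjr' (hj.trans S.fst)).1.le
    by_cases hbx : b.pos.1 = x₁
    · left
      refine ⟨2, by omega, hterm ((Config.leftMostTerminal_iff_of_forall_le hC ?_).2 ?_)⟩
      · intro j
        rw [hpr, S.fst]
        by_cases hjr : j = r
        · rw [hjr, hpr, S.fst]
        by_cases hjr' : j = r'
        · rw [hjr', hpr', hbx]
        · rw [duoConfig_pos_other hjr hjr']; exact hoth j hjr hjr'
      · rcases S.sign with h | h
        · right
          intro j hj
          have := hend j hj
          rw [h] at this
          rw [hpr]; linarith
        · left
          intro j hj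
          have := hend j hj
          rw [h] at this
          rw [hpr]; linarith
    · have hbx' : b.pos.1 < x₁ := lt_of_le_of_ne hb1 hbx
      have hbl : ((duoConfig p r r' (p r) b.pos Light.off b.light).pos r').1 <
          ((duoConfig p r r' (p r) b.pos Light.off b.light).pos r).1 := by
        rw [hpr, hpr', S.fst]; exact hbx'
      have honly : ∀ j, ((duoConfig p r r' (p r) b.pos Light.off b.light).pos j).1 <
          ((duoConfig p r r' (p r) b.pos Light.off b.light).pos r).1 → j = r' := by
        intro j hj
        by_contra hjr'
        by_cases hjr : j = r
        · rw [hjr] at hj; exact lt_irrefl _ hj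
        rw [hpr, duoConfig_pos_other hjr hjr', S.fst] at hj
        exact absurd (hoth j hjr hjr') (not_le.2 hj)
      rcases hb.light with ⟨-, h⟩ | h | ⟨hbc, -, -⟩
      · rw [h, S.fst'] at hbx; exact absurd rfl hbx
      · right
        constructor
        · have := dec_off_stay (stage2 := stage2) (F := F) hC hdark hlr T.ne.symm hbl.le ?_
            fun k l _ _ _ _ _ h => absurd h (hsym k)
          · simp only [Rob.idle, this, hpr]
            exact Leaving.home
          · rw [Config.leftMostTerminal_iff_of_lt hC hbl]
            rintro ⟨m, -, hm, hmc, -⟩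
            rw [honly m hm, hlr', h] at hmc
            exact Light.noConfusion hmc
        · refine Or.inr ⟨rfl, ?_⟩
          cases hb with
          | home => exact Light.noConfusion h
          | go => exact Or.inr rfl
          | switch => exact Or.inl rfl
          | arrived => exact Light.noConfusion h
      · left
        refine ⟨2, by omega, hterm ((Config.leftMostTerminal_iff_of_lt hC hbl).2 ?_)⟩
        obtain ⟨m, hm, hmx, hms⟩ := Config.exists_visible_left hC hbl
        obtain rfl := honly m hmx
        refine ⟨m, hm, hbl, hlr'.trans hbc, fun l hl => ?_, ?_⟩
        · rw [honly l hl]; exact right_mem_segment ℝ _ _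
        · rw [hpr, hpr', hb.snd]
          rcases S.sign with h | h <;> rw [h] at hlt
          · left
            refine ⟨by linarith, fun j hj => ?_⟩
            have := hend j hj
            rw [h] at this
            rw [hpr]; linarith
          · right
            refine ⟨by linarith, fun j hj => ?_⟩
            have := hend j hj
            rw [h] at this
            rw [hpr]; linarith

/-- Both end points have become candidates. -/
theorem win_of_arrived (S : Start F p r r' X x₁ τ d d')
    (hsymm : ¬ ((p r).2 + (p r').2 = 2 * midline p r r' X ∧
      (∀ j, j ≠ r → j ≠ r' → ∃ k, k ≠ r ∧ k ≠ r' ∧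
        p k = ((p j).1, 2 * midline p r r' X - (p j).2)) ∧
      ∀ j, j ≠ r → j ≠ r' → (p j).2 ≠ midline p r r' X)) :
    Win (algorithm n stage2) F (duo p r r' (Rob.idle ((p r).1 - d, (p r).2) Light.candidate)
      (Rob.idle ((p r').1 - d', (p r').2) Light.candidate)) := by
  have T := S.terrain
  have hlt := S.lt
  have hle := S.le
  have hd := S.pos
  have hd' := S.symm.pos
  rw [S.fst, S.fst']
  -- different distances occur only if all other robots belong to the column that is left
  have hX : d ≠ d' → ∀ j, j ≠ r → j ≠ r' → (p j).1 = x₁ := by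
    intro hdd
    rcases S.dist with ⟨Y, -, -, -, h6, h7⟩ | ⟨h6, -⟩
    · exact absurd (h6.trans h7.symm) hdd
    · exact h6
  have hapart : ∀ {r r' τ d d'}, Start F p r r' X x₁ τ d d' → d' < d →
      (∀ j, j ≠ r → j ≠ r' → (p j).1 = x₁) →
      Win (algorithm n stage2) F (duo p r r' (Rob.idle (x₁ - d, (p r).2) Light.candidate)
        (Rob.idle (x₁ - d', (p r').2) Light.candidate)) := by
    intro r r' τ d d' S hdd hall
    have hle := S.le
    have hlt := S.lt
    have hd' := S.symm.pos
    refine win_of_apart (τ := τ) S.terrain ⟨?_, le_rfl, le_rfl, ?_, le_rfl, hlt, le_rfl, ?_⟩ ?_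
      rfl rfl rfl rfl
    · simp only [Rob.idle]; linarith
    · simp only [Rob.idle]; linarith
    · intro j hj hj' hjX
      obtain ⟨-, h2⟩ := S.between j hj hj' (hall j hj hj')
      simp only [Rob.idle]
      nlinarith
    · simp only [Rob.idle]; linarith
  rcases lt_trichotomy d d' with h | h | h
  · rw [duo_swap T.ne]
    exact hapart S.symm h fun j hj hj' => hX h.ne j hj' hj
  · rw [← h]
    exact win_of_column T (by linarith) S.sign (by linarith) hsymm
  · exact hapart S h (hX h.ne')

/-- The first part of every execution, if the leftmost column contains at least two robots. -/
theorem win_of_leaving (S : Start F p r r' X x₁ τ d d')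
    (hsymm : ¬ ((p r).2 + (p r').2 = 2 * midline p r r' X ∧
      (∀ j, j ≠ r → j ≠ r' → ∃ k, k ≠ r ∧ k ≠ r' ∧
        p k = ((p j).1, 2 * midline p r r' X - (p j).2)) ∧
      ∀ j, j ≠ r → j ≠ r' → (p j).2 ≠ midline p r r' X))
    (ha : Leaving (p r) d k a) (hb : Leaving (p r') d' k' b) :
    Win (algorithm n stage2) F (duo p r r' a b) := by
  have T := S.terrain
  induction hN : k + k' using Nat.strong_induction_on generalizing k k' a b with
  | _ N ih =>
  have ihl : ∀ l < k, ∀ a' b', Leaving (p r) d l a' → Leaving (p r') d' k' b' →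
      Win (algorithm n stage2) F (duo p r r' a' b') := fun l hl a' b' h1 h2 =>
    ih (l + k') (by omega) h1 h2 rfl
  have ihr : ∀ l < k', ∀ a' b', Leaving (p r) d k a' → Leaving (p r') d' l b' →
      Win (algorithm n stage2) F (duo p r r' a' b') := fun l hl a' b' h1 h2 =>
    ih (k + l) (by omega) h1 h2 rfl
  by_cases hk : k = 0 ∧ k' = 0
  · obtain ⟨rfl, rfl⟩ := hk
    cases ha
    cases hb
    exact S.win_of_arrived hsymm
  have hlk : ∀ a b s', Leaving (p r) d k a → Leaving (p r') d' k' b →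
      Look (algorithm n stage2) F r (duo p r r' a b) s' → Win (algorithm n stage2) F s' ∨
        (∃ a', s' = duo p r r' a' b ∧ Leaving (p r) d k a') ∧
          (k = 0 ∨ k = 3 ∧ (k' = 1 ∨ k' = 2)) := by
    rintro a b s' ha hb ⟨h1, h2, -, rfl⟩
    rw [duo_left] at h1 h2
    rw [config_duo, duo_left, update_duo_left]
    rcases S.look (stage2 := stage2) ha hb hk h1 h2 with ⟨l, hl, h⟩ | ⟨h, h3⟩
    · exact Or.inl (ihl l hl _ _ h hb)
    · exact Or.inr ⟨⟨_, rfl, h⟩, h3⟩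
  have hlk' : ∀ a b s', Leaving (p r) d k a → Leaving (p r') d' k' b →
      Look (algorithm n stage2) F r' (duo p r r' a b) s' → Win (algorithm n stage2) F s' ∨
        (∃ b', s' = duo p r r' a b' ∧ Leaving (p r') d' k' b') ∧
          (k' = 0 ∨ k' = 3 ∧ (k = 1 ∨ k = 2)) := by
    rintro a b s' ha hb ⟨h1, h2, -, rfl⟩
    rw [duo_right T.ne] at h1 h2
    rw [config_duo, duo_right T.ne, update_duo_right T.ne, duoConfig_swap T.ne]
    rcases S.symm.look (stage2 := stage2) hb ha (by tauto) h1 h2 with ⟨l, hl, h⟩ | ⟨h, h3⟩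
    · exact Or.inl (ihr l hl _ _ ha h)
    · exact Or.inr ⟨⟨_, rfl, h⟩, h3⟩
  have stage : ∀ i, (∀ a b s', Leaving (p r) d k a → Leaving (p r') d' k' b →
      Look (algorithm n stage2) F i (duo p r r' a b) s' → Win (algorithm n stage2) F s') →
      Win (algorithm n stage2) F (duo p r r' a b) := by
    intro i hi
    refine Win.stage _ (fun s => ∃ a b, s = duo p r r' a b ∧ Leaving (p r) d k a ∧
      Leaving (p r') d' k' b) i ⟨a, b, rfl, ha, hb⟩ ?_ ?_ ?_
    · rintro s ⟨a, b, rfl, ha, hb⟩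
      rw [config_duo]
      exact (S.lights ha hb hk).1
    · rintro s s' ⟨a, b, rfl, ha, hb⟩ hstep hnot
      have hby : ∀ j, j ∉ ({r, r'} : Set (Fin n)) → ∃ q c, duo p r r' a b j = Rob.idle q c ∧
          ((duo p r r' a b).config.Dark →
            decision (algorithm n stage2) F (duo p r r' a b).config j = (c, q)) := by
        intro j hj
        simp only [Set.mem_insert_iff, Set.mem_singleton_iff, not_or] at hj
        refine ⟨p j, Light.off, duo_other hj.1 hj.2 a b, fun _ => ?_⟩
        rw [config_duo]
        exact S.dec_other ha hb hk hj.1 hj.2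
      rcases hstep.active {r, r'} hby with rfl | ⟨i, hi, hlook | ⟨a', hact, rfl⟩⟩
      · exact absurd ⟨a, b, rfl, ha, hb⟩ hnot
      · rcases hi with rfl | hi
        · rcases hlk a b s' ha hb hlook with h | ⟨⟨a', rfl, h⟩, -⟩
          · exact h
          · exact absurd ⟨_, _, rfl, h, hb⟩ hnot
        · rw [Set.mem_singleton_iff] at hi
          subst hi
          rcases hlk' a b s' ha hb hlook with h | ⟨⟨b', rfl, h⟩, -⟩
          · exact h
          · exact absurd ⟨_, _, rfl, ha, h⟩ hnot
      · rcases hi with rfl | hi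
        · rw [duo_left] at hact
          rw [update_duo_left] at hnot ⊢
          rcases ha.act hact with h | ⟨l, hl, h⟩
          · exact absurd ⟨_, _, rfl, h, hb⟩ hnot
          · exact ihl l hl _ _ h hb
        · rw [Set.mem_singleton_iff] at hi
          subst hi
          rw [duo_right T.ne] at hact
          rw [update_duo_right T.ne] at hnot ⊢
          rcases hb.act hact with h | ⟨l, hl, h⟩
          · exact absurd ⟨_, _, rfl, ha, h⟩ hnot
          · exact ihr l hl _ _ ha h
    · rintro s s' ⟨a, b, rfl, ha, hb⟩ hlook
      exact hi a b s' ha hb hlook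
  have hk3 := ha.le_three
  have hk3' := hb.le_three
  by_cases hr : k = 0 ∨ k = 3 ∧ (k' = 1 ∨ k' = 2)
  · refine stage r' fun a b s' ha hb hlook => (hlk' a b s' ha hb hlook).resolve_right ?_
    rintro ⟨-, h⟩
    omega
  · exact stage r fun a b s' ha hb hlook =>
      (hlk a b s' ha hb hlook).resolve_right fun h => hr h.2

end Start

/-- From an initial configuration without the forbidden symmetry, a leader configuration cannot be
avoided. -/
theorem win_of_initial (hp : Function.Injective p)
    (hsymm : ¬ ∃ c : ℝ, (∀ i, ∃ j, p j = ((p i).1, 2 * c - (p i).2)) ∧ ∀ i, (p i).2 ≠ c) :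
    Win (algorithm n stage2) F (fun i => Rob.idle (p i) Light.off) := by
  have hne : (Finset.univ : Finset (Fin n)).Nonempty := by
    rw [Finset.univ_nonempty_iff]
    by_contra h
    rw [not_nonempty_iff] at h
    exact hsymm ⟨0, fun i => h.elim i, fun i => h.elim i⟩
  obtain ⟨m, -, hm⟩ := Finset.exists_min_image Finset.univ (fun j => (p j).1) hne
  by_cases hu : ∀ j, j ≠ m → (p j).1 ≠ (p m).1
  · have hlt : ∀ j, j ≠ m → (p m).1 < (p j).1 := fun j hj =>
      lt_of_le_of_ne (hm j (Finset.mem_univ j)) (hu j hj).symm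
    exact win_of_leftmost (l := m) (q := p) (fun j k _ _ h => hp h) (fun j _ => rfl) rfl rfl
      fun j hj => ⟨hlt j hj, hlt j hj⟩
  push Not at hu
  obtain ⟨m', hmm', hm'x⟩ := hu
  set x₁ := (p m).1 with hx₁
  have hcol : (Finset.univ.filter fun j => (p j).1 = x₁).Nonempty := ⟨m, by simp [hx₁]⟩
  obtain ⟨r, hr, hrmin⟩ := Finset.exists_min_image _ (fun j => (p j).2) hcol
  obtain ⟨r', hr', hrmax⟩ := Finset.exists_max_image _ (fun j => (p j).2) hcol
  simp only [Finset.mem_filter, Finset.mem_univ, true_and] at hr hr' hrmin hrmax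
  have hlt : (p r).2 < (p r').2 := by
    by_contra hle
    push Not at hle
    refine hmm' (hp (Prod.ext hm'x ?_))
    linarith [hrmin m rfl, hrmin m' hm'x, hrmax m rfl, hrmax m' hm'x]
  have hrr' : r ≠ r' := fun h => by rw [h] at hlt; exact lt_irrefl _ hlt
  have hstrict : ∀ j, j ≠ r → j ≠ r' → (p j).1 = x₁ → (p r).2 < (p j).2 ∧ (p j).2 < (p r').2 := by
    intro j hj hj' hjx
    constructor
    · exact lt_of_le_of_ne (hrmin j hjx) fun h => hj (hp (Prod.ext (hjx.trans hr.symm) h.symm))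
    · exact lt_of_le_of_ne (hrmax j hjx) fun h => hj' (hp (Prod.ext (hjx.trans hr'.symm) h))
  have hothers : (Finset.univ.filter fun j => j ≠ r ∧ j ≠ r').Nonempty := by
    by_contra hempty
    rw [Finset.not_nonempty_iff_eq_empty, Finset.filter_eq_empty_iff] at hempty
    -- two robots in a column are in symmetric position
    have hor : ∀ j, j = r ∨ j = r' := fun j => by
      have := hempty (Finset.mem_univ j)
      tauto
    refine hsymm ⟨((p r).2 + (p r').2) / 2, fun i => ?_, fun i => ?_⟩
    · rcases hor i with rfl | rfl
      · exact ⟨r', Prod.ext (hr'.trans hr.symm) (by simp only; ring)⟩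
      · exact ⟨r, Prod.ext (hr.trans hr'.symm) (by simp only; ring)⟩
    · rcases hor i with rfl | rfl <;> intro h <;> linarith
  obtain ⟨t, ht, htmin⟩ := Finset.exists_min_image _ (fun j => (p j).1) hothers
  simp only [Finset.mem_filter, Finset.mem_univ, true_and] at ht htmin
  have T : Terrain p r r' (p t).1 := ⟨hrr', fun j k _ _ _ _ h => hp h,
    fun j hj hj' => htmin j ⟨hj, hj'⟩, ⟨t, ht.1, ht.2, rfl⟩⟩
  obtain ⟨d, d', S⟩ : ∃ d d', Start F p r r' (p t).1 x₁ 1 d d' := by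
    have mk : ∀ d d', _ → Start F p r r' (p t).1 x₁ 1 d d' := fun d d' h =>
      ⟨hp, T, Or.inl rfl, hr, hr', hm t (Finset.mem_univ t), by linarith,
        fun j hj hj' hjx => by simpa using hstrict j hj hj' hjx, h⟩
    by_cases hright : (Finset.univ.filter fun j => x₁ < (p j).1).Nonempty
    · obtain ⟨y, hy, hymin⟩ := Finset.exists_min_image _ (fun j => (p j).1) hright
      simp only [Finset.mem_filter, Finset.mem_univ, true_and] at hy hymin
      refine ⟨_, _, mk _ _ (Or.inl ⟨(p y).1, hy, ⟨y, ?_, ?_, rfl⟩, fun j _ _ => hymin j, rfl, rfl⟩)⟩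
      · rintro rfl; exact hy.ne' hr
      · rintro rfl; exact hy.ne' hr'
    · rw [Finset.not_nonempty_iff_eq_empty, Finset.filter_eq_empty_iff] at hright
      refine ⟨_, _, mk _ _ (Or.inr ⟨fun j _ _ => ?_, rfl, rfl⟩)⟩
      exact le_antisymm (not_lt.1 (hright (Finset.mem_univ j))) (hm j (Finset.mem_univ j))
  have hduo : (fun i => Rob.idle (p i) Light.off) =
      duo p r r' (Rob.idle (p r) Light.off) (Rob.idle (p r') Light.off) := by
    funext j
    simp only [duo]
    split_ifs with h1 h2
    · rw [h1]
    · rw [h2]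
    · rfl
  rw [hduo]
  refine S.win_of_leaving ?_ Leaving.home Leaving.home
  rintro ⟨h1, h2, h3⟩
  refine hsymm ⟨midline p r r' (p t).1, fun i => ?_, fun i => ?_⟩
  · by_cases hir : i = r
    · subst hir
      exact ⟨r', Prod.ext (hr'.trans hr.symm) (by simp only; linarith)⟩
    by_cases hir' : i = r'
    · subst hir'
      exact ⟨r, Prod.ext (hr.trans hr'.symm) (by simp only; linarith)⟩
    · obtain ⟨k, -, -, hk⟩ := h2 i hir hir'
      exact ⟨k, hk⟩
  · by_cases hir : i = r
    · subst hir; intro h; linarith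
    by_cases hir' : i = r'
    · subst hir'; intro h; linarith
    · exact h3 i hir hir'

end Start

end

end OpaqueRobots

theorem mainTheorem5 (n : ℕ) (stage2 : OpaqueRobots.Snapshot → OpaqueRobots.Action)
    (E : OpaqueRobots.Execution n (OpaqueRobots.algorithm n stage2))
    (hinit : (E.config 0).IsInitial)
    (hsymm : ¬ (E.config 0).HasForbiddenSymmetry) :
    ∃ T : ℝ, 0 < T ∧ E.IsLeaderConfiguration T := by
  exact E.exists_isLeaderConfiguration hinit
    (OpaqueRobots.win_of_initial hinit.1 hsymm)
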